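/- **Setting.** Let $X_{t+1}=AX_t+BU_t+DW_t$ in $\mathbb R^d$ with $X_0\sim\mathcal N(x,\Sigma)$, where $\Sigma\in\mathcal M_0^+$ (the real symmetric positive semidefinite $d\times d$ matrices), and $W_t\sim\mathcal N(0,I)$ are i.i.d. and independent of $X_0$. The network state $S_t$ takes values in a finite set $\mathbb S$, with $S_0=s$; at each time a query $Q_t$ in a finite set $\mathbb Q$ is chosen. Given the past, $S_{t+1}=s'$ with probability $p_{Q_t}(S_t,s')$ and, independently, the observation is lost ($\gamma_{t+1}=0$) with probability $\lambda(S_t,Q_t)\in[0,1)$; otherwise ($\gamma_{t+1}=1$) the controller receives $Y_{t+1}=C_{Q_t,S_t}X_{t+1}+F_{Q_t,S_t}W_{t+1}$, whose dimension may depend on $(Q_t,S_t)$. Assume $\det(F_{q,s}F_{q,s}^{\mathsf T})\ne0$ and $DF_{q,s}^{\mathsf T}=0$ for all $q,s$. An admissible policy $v$ chooses $(Q_t,U_t)$ as a measurable function of $x,\Sigma,S_0,\dots,S_t,\gamma_1,\dots,\gamma_t$ and the observations received up to time $t$. With $\mathscr R_{\mathsf{net}}\ge0$ on $\mathbb S\times\mathbb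 Q$ and $R,M$ symmetric positive definite, let $$J_\alpha^v(x,s,\Sigma)=\mathbb E^v\Big[\sum_{t\ge0}\alpha^t\big(\mathscr R_{\mathsf{net}}(S_t,Q_t)+X_t^{\mathsf T}RX_t+U_t^{\mathsf T}MU_t\big)\Big],\qquad J^*_\alpha=\inf_vJ^v_\alpha .$$ Put $\Xi(\Sigma)=DD^{\mathsf T}+A\Sigma A^{\mathsf T}$, $\widehat K_{q,s}(\Sigma)=\Xi(\Sigma)C_{q,s}^{\mathsf T}(C_{q,s}\Xi(\Sigma)C_{q,s}^{\mathsf T}+F_{q,s}F_{q,s}^{\mathsf T})^{-1}$, $\mathcal T_{q,s}(\Sigma)=\Xi(\Sigma)-\widehat K_{q,s}(\Sigma)C_{q,s}\Xi(\Sigma)$ and $$\widehat{\mathcal T}_qf(s,\Sigma)=\sum_{s'}p_q(s,s')\big((1-\lambda(s,q))f(s',\mathcal T_{q,s}(\Sigma))+\lambda(s,q)f(s',\Xi(\Sigma))\big).$$ The Kalman filter starts at $\hat x_0=x$, $\widehat\Pi_0=\Sigma$; with $x^+=A\hat x_t+BU_t$ it is $\hat x_{t+1}=x^+$, $\widehat\Pi_{t+1}=\Xi(\widehat\Pi_t)$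 if $\gamma_{t+1}=0$, and $\hat x_{t+1}=x^++\widehat K_{Q_t,S_t}(\widehat\Pi_t)(Y_{t+1}-C_{Q_t,S_t}x^+)$, $\widehat\Pi_{t+1}=\mathcal T_{Q_t,S_t}(\widehat\Pi_t)$ if $\gamma_{t+1}=1$. **Theorem.** Let $\alpha\in(0,1)$, let $(A,B)$ be stabilizable, and suppose that $J^*_\alpha$ is locally bounded on $\mathbb R^d\times\mathbb S\times\mathcal M_0^+$. Then the Riccati equation $$\Pi=R+\alpha A^{\mathsf T}\Pi A-\alpha^2A^{\mathsf T}\Pi B(M+\alpha B^{\mathsf T}\Pi B)^{-1}B^{\mathsf T}\Pi A$$ has a unique positive definite solution $\Pi^*_\alpha$. Put $\widetilde\Pi_\alpha=R-\Pi^*_\alpha+\alpha A^{\mathsf T}\Pi^*_\alpha A$ and $c^\alpha_q(s,\Sigma)=\mathscr R_{\mathsf{net}}(s,q)+\operatorname{tr}(\widetilde\Pi_\alpha\Sigma)$. There is a function $f^*_\alpha:\mathbb S\times\mathcal M_0^+\to[0,\infty)$ with $$J^*_\alpha(x,s,\Sigma)=x^{\mathsf T}\Pi^*_\alpha x+\operatorname{tr}(\Pi^*_\alpha\Sigma)+\tfrac{\alpha}{1-\alpha}\operatorname{tr}(\Pi^*_\alpha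 DD^{\mathsf T})+f^*_\alpha(s,\Sigma),$$ and $f^*_\alpha$ is the unique nonnegative lower semicontinuous solution of $$f(s,\Sigma)=\min_{q\in\mathbb Q}\{c^\alpha_q(s,\Sigma)+\alpha\widehat{\mathcal T}_qf(s,\Sigma)\}$$ satisfying $f(s,\Sigma)\le\kappa(1+\operatorname{tr}\Sigma)$ for some constant $\kappa$. If $\widetilde\Pi_\alpha$ is positive definite, then also $f^*_\alpha(s,\Sigma)\le\kappa'(1+\operatorname{tr}(\widetilde\Pi_\alpha\Sigma))$ for some constant $\kappa'$. Moreover $f^*_\alpha(s,\cdot)$ is concave for each $s$. The minimizer in the equation for $f^*_\alpha$ has a measurable selector, and for every measurable selector $q^*_\alpha$ the stationary policy $$Q_t=q^*_\alpha(S_t,\widehat\Pi_t),\qquad U_t=-K^*_\alpha\hat x_t,\qquad K^*_\alpha=(M+\alpha B^{\mathsf T}\Pi^*_\alpha B)^{-1}\alpha B^{\mathsf T}\Pi^*_\alpha A,$$ is admissible and attains $J^*_\alpha(x,s,\Sigma)$ for all $(x,s,\Sigma)$. -/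

import Mathlib

open MeasureTheory ProbabilityTheory Filter Topology Matrix
open scoped ENNReal

namespace SensorLQG

/-- The Borel (equivalently, product) sigma-algebra on real matrices. -/
instance instMeasurableSpaceMatrix {m n : ℕ} : MeasurableSpace (Matrix (Fin m) (Fin n) ℝ) :=
  inferInstanceAs (MeasurableSpace (Fin m → Fin n → ℝ))

/-- The cone of real symmetric positive semidefinite `d × d` matrices. -/
def psdCone (d : ℕ) : Set (Matrix (Fin d) (Fin d) ℝ) := {V | V.PosSemidef}

/-- `(A, B)` is stabilizable: some real feedback gain `K` places all (complex) eigenvalues of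
`A + B K` in the open unit disc. -/
def IsStabilizable {d du : ℕ} (A : Matrix (Fin d) (Fin d) ℝ) (B : Matrix (Fin d) (Fin du) ℝ) :
    Prop :=
  ∃ K : Matrix (Fin du) (Fin d) ℝ,
    ∀ z ∈ spectrum ℂ ((A + B * K).map (algebraMap ℝ ℂ)), ‖z‖ < 1

/-- Data of the networked LQG problem with plant dimension `d`, control dimension `du`, noise
dimension `dw`, finite set `S` of network states and finite set `Q` of sensor queries. -/
structure Model (d du dw : ℕ) (S Q : Type*) [Fintype S] where
  /-- plant matrix -/
  A : Matrix (Fin d) (Fin d) ℝ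
  /-- control matrix -/
  B : Matrix (Fin d) (Fin du) ℝ
  /-- noise matrix -/
  D : Matrix (Fin d) (Fin dw) ℝ
  /-- dimension of the observation, which may depend on query and network state -/
  obsDim : Q → S → ℕ
  /-- observation matrices -/
  C : (q : Q) → (s : S) → Matrix (Fin (obsDim q s)) (Fin d) ℝ
  /-- observation noise matrices -/
  F : (q : Q) → (s : S) → Matrix (Fin (obsDim q s)) (Fin dw) ℝ
  /-- network transition probabilities `p q s s'` from `s` to `s'` under query `q` -/
  p : Q → S → S → ℝ
  /-- loss rate -/
  loss : S → Q → ℝ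
  /-- network cost -/
  netCost : S → Q → ℝ
  /-- state weight of the plant cost -/
  R : Matrix (Fin d) (Fin d) ℝ
  /-- control weight of the plant cost -/
  M : Matrix (Fin du) (Fin du) ℝ
  det_F_ne_zero : ∀ q s, (F q s * (F q s)ᵀ).det ≠ 0
  D_mul_F : ∀ q s, D * (F q s)ᵀ = 0
  p_nonneg : ∀ q s s', 0 ≤ p q s s'
  p_sum : ∀ q s, ∑ s', p q s s' = 1
  loss_nonneg : ∀ s q, 0 ≤ loss s q
  loss_lt_one : ∀ s q, loss s q < 1
  netCost_nonneg : ∀ s q, 0 ≤ netCost s q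
  R_posDef : R.PosDef
  M_posDef : M.PosDef

/-- What the controller sees at one time step: the network state, whether the observation was
received, and the observation itself. An observation `y ∈ ℝ^k` is stored as the zero-padded
sequence `(y₀, …, y_{k-1}, 0, 0, …)`; a lost observation is stored as `0`. -/
abbrev Signal (S : Type*) := S × Bool × (ℕ → ℝ)

/-- Everything at one time step: plant state, plant noise, and the signal to the controller. -/
abbrev State (d dw : ℕ) (S : Type*) := ((Fin d → ℝ) × (Fin dw → ℝ)) × Signal S

/-- Signals received at times `0, …, t`. -/
abbrev History (S : Type*) (t : ℕ) := (i : Finset.Iic t) → Signal S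

/-- The parameters of the law of the initial plant state: mean and covariance. -/
abbrev Init (d : ℕ) := (Fin d → ℝ) × Matrix (Fin d) (Fin d) ℝ

/-- The last entry of a history. -/
def last {Y : Type*} {t : ℕ} (h : (i : Finset.Iic t) → Y) : Y :=
  h ⟨t, Finset.mem_Iic.2 le_rfl⟩

/-- A history with its last entry dropped. -/
def previous {Y : Type*} {t : ℕ} (h : (i : Finset.Iic (t + 1)) → Y) :
    (i : Finset.Iic t) → Y :=
  fun i => h ⟨i.1, Finset.mem_Iic.2 ((Finset.mem_Iic.1 i.2).trans (Nat.le_succ t))⟩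

/-- Zero-padding of a vector. -/
def pad {k : ℕ} (y : Fin k → ℝ) : ℕ → ℝ := fun i => if h : i < k then y ⟨i, h⟩ else 0

/-- An admissible policy: query and control at time `t` are measurable functions of the initial
data and of the signals up to time `t`. -/
structure Policy (d du : ℕ) (S Q : Type*) [MeasurableSpace S] [MeasurableSpace Q] where
  /-- the query at time `t` -/
  query : (t : ℕ) → Init d × History S t → Q
  /-- the control at time `t` -/
  control : (t : ℕ) → Init d × History S t → Fin du → ℝ
  measurable_query : ∀ t, Measurable (query t)
  measurable_control : ∀ t, Measurable (control t)

theorem measurable_last {Y : Type*} [MeasurableSpace Y] {t : ℕ} :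
    Measurable (last : ((i : Finset.Iic t) → Y) → Y) :=
  measurable_pi_apply _

theorem measurable_pad {k : ℕ} : Measurable (pad : (Fin k → ℝ) → ℕ → ℝ) := by
  refine measurable_pi_lambda _ fun i => ?_
  by_cases h : i < k
  · simpa [pad, h] using measurable_pi_apply _
  · simp [pad, h]

theorem measurable_mulVec {m n : ℕ} (G : Matrix (Fin m) (Fin n) ℝ) :
    Measurable fun x : Fin n → ℝ => G *ᵥ x :=
  (Continuous.matrix_mulVec continuous_const continuous_id).measurable

variable {d du dw : ℕ} {S Q : Type*}

set_option linter.unusedSectionVars false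

section Dynamics

variable [Fintype S] [MeasurableSpace S] [MeasurableSpace Q]

/-- Law `N(0, I)` of the plant noise. -/
noncomputable def noiseLaw (dw : ℕ) : Measure (Fin dw → ℝ) :=
  Measure.pi fun _ => gaussianReal 0 1

/-- Law `N(x, V)` of the initial plant state. -/
noncomputable def initialPlantLaw (x : Fin d → ℝ) (V : Matrix (Fin d) (Fin d) ℝ) :
    Measure (Fin d → ℝ) :=
  (multivariateGaussian (WithLp.toLp 2 x) V).map WithLp.ofLp

/-- Law of the next network state. -/
noncomputable def Model.netLaw (m : Model d du dw S Q) (s : S) (q : Q) : Measure S :=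
  ∑ s', ENNReal.ofReal (m.p q s s') • Measure.dirac s'

/-- Law of the next reception indicator (`true` means received). -/
noncomputable def Model.receptionLaw (m : Model d du dw S Q) (s : S) (q : Q) : Measure Bool :=
  ENNReal.ofReal (1 - m.loss s q) • Measure.dirac true +
    ENNReal.ofReal (m.loss s q) • Measure.dirac false

instance : IsProbabilityMeasure (noiseLaw dw) := by
  unfold noiseLaw; infer_instance

instance (x : Fin d → ℝ) (V : Matrix (Fin d) (Fin d) ℝ) :
    IsProbabilityMeasure (initialPlantLaw x V) := by
  unfold initialPlantLaw
  exact Measure.isProbabilityMeasure_map (by fun_prop)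

instance (m : Model d du dw S Q) (s : S) (q : Q) : IsProbabilityMeasure (m.netLaw s q) := by
  constructor
  simp only [Model.netLaw, Measure.coe_finsetSum, Measure.coe_smul, Finset.sum_apply,
    Pi.smul_apply, measure_univ, smul_eq_mul, mul_one]
  rw [← ENNReal.ofReal_sum_of_nonneg (fun s' _ => m.p_nonneg q s s'), m.p_sum,
    ENNReal.ofReal_one]

instance (m : Model d du dw S Q) (s : S) (q : Q) :
    IsProbabilityMeasure (m.receptionLaw s q) := by
  constructor
  simp only [Model.receptionLaw, Measure.coe_add, Measure.coe_smul, Pi.add_apply,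
    Pi.smul_apply, measure_univ, smul_eq_mul, mul_one]
  rw [← ENNReal.ofReal_add (by linarith [m.loss_lt_one s q]) (m.loss_nonneg s q)]
  simp

/-- Joint law of the fresh plant noise, the next network state and the next reception indicator
(independent given the current network state and query). -/
noncomputable def Model.freshLaw (m : Model d du dw S Q) (z : S × Q) :
    Measure ((Fin dw → ℝ) × S × Bool) :=
  (noiseLaw dw).prod ((m.netLaw z.1 z.2).prod (m.receptionLaw z.1 z.2))

instance (m : Model d du dw S Q) (z : S × Q) : IsProbabilityMeasure (m.freshLaw z) := by
  unfold Model.freshLaw; infer_instance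

/-- The signals contained in the full history. -/
def signals {t : ℕ} (ω : (i : Finset.Iic t) → State d dw S) : History S t := fun i => (ω i).2

/-- Query made at time `t` along a full history. -/
def Policy.queryAt (v : Policy d du S Q) (z : Init d) (t : ℕ)
    (ω : (i : Finset.Iic t) → State d dw S) : Q := v.query t (z, signals ω)

/-- Control used at time `t` along a full history. -/
def Policy.controlAt (v : Policy d du S Q) (z : Init d) (t : ℕ)
    (ω : (i : Finset.Iic t) → State d dw S) : Fin du → ℝ := v.control t (z, signals ω)

/-- The next full state: `X' = A X + B U + D W`, and, if received, the observation
`C X' + F W'`, where `e = (W', S', γ')` is the fresh noise, network state and reception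
indicator. -/
noncomputable def Model.next (m : Model d du dw S Q) (v : Policy d du S Q) (z : Init d) (t : ℕ)
    (a : ((i : Finset.Iic t) → State d dw S) × ((Fin dw → ℝ) × S × Bool)) : State d dw S :=
  let ω := a.1
  let e := a.2
  let q := v.queryAt z t ω
  let s := (last ω).2.1
  let x' := m.A *ᵥ (last ω).1.1 + m.B *ᵥ v.controlAt z t ω + m.D *ᵥ (last ω).1.2
  ((x', e.1), e.2.1, e.2.2, if e.2.2 then pad (m.C q s *ᵥ x' + m.F q s *ᵥ e.1) else 0)

theorem measurable_signals {t : ℕ} :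
    Measurable (signals : ((i : Finset.Iic t) → State d dw S) → History S t) :=
  measurable_pi_lambda _ fun i => measurable_snd.comp (measurable_pi_apply i)

theorem Policy.measurable_queryAt (v : Policy d du S Q) (z : Init d) (t : ℕ) :
    Measurable (v.queryAt (dw := dw) z t) :=
  (v.measurable_query t).comp (measurable_const.prodMk measurable_signals)

theorem Policy.measurable_controlAt (v : Policy d du S Q) (z : Init d) (t : ℕ) :
    Measurable (v.controlAt (dw := dw) z t) :=
  (v.measurable_control t).comp (measurable_const.prodMk measurable_signals)

theorem measurable_netState_query (v : Policy d du S Q) (z : Init d) (t : ℕ) :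
    Measurable fun ω : (i : Finset.Iic t) → State d dw S =>
      ((last ω).2.1, v.queryAt z t ω) :=
  (measurable_last.snd.fst).prodMk (v.measurable_queryAt z t)

variable [Fintype Q] [MeasurableSingletonClass S] [MeasurableSingletonClass Q]

theorem Model.measurable_next (m : Model d du dw S Q) (v : Policy d du S Q) (z : Init d)
    (t : ℕ) : Measurable (m.next v z t) := by
  have hl : Measurable fun a : ((i : Finset.Iic t) → State d dw S) ×
      ((Fin dw → ℝ) × S × Bool) => last a.1 := measurable_last.comp measurable_fst
  have hx : Measurable fun a : ((i : Finset.Iic t) → State d dw S) ×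
      ((Fin dw → ℝ) × S × Bool) =>
      m.A *ᵥ (last a.1).1.1 + m.B *ᵥ v.controlAt z t a.1 + m.D *ᵥ (last a.1).1.2 :=
    (((measurable_mulVec m.A).comp hl.fst.fst).add ((measurable_mulVec m.B).comp
      ((v.measurable_controlAt z t).comp measurable_fst))).add
      ((measurable_mulVec m.D).comp hl.fst.snd)
  have hg : Measurable fun b : ((Fin d → ℝ) × (Fin dw → ℝ)) × (S × Q) =>
      pad (m.C b.2.2 b.2.1 *ᵥ b.1.1 + m.F b.2.2 b.2.1 *ᵥ b.1.2) :=
    measurable_from_prod_countable_left fun z' => measurable_pad.comp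
      (((measurable_mulVec (m.C z'.2 z'.1)).comp measurable_fst).add
        ((measurable_mulVec (m.F z'.2 z'.1)).comp measurable_snd))
  have hw : Measurable fun a : ((i : Finset.Iic t) → State d dw S) ×
      ((Fin dw → ℝ) × S × Bool) => a.2.1 := measurable_snd.fst
  have hs : Measurable fun a : ((i : Finset.Iic t) → State d dw S) ×
      ((Fin dw → ℝ) × S × Bool) => a.2.2.1 := measurable_snd.snd.fst
  have hb : Measurable fun a : ((i : Finset.Iic t) → State d dw S) ×
      ((Fin dw → ℝ) × S × Bool) => a.2.2.2 := measurable_snd.snd.snd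
  refine (hx.prodMk hw).prodMk (hs.prodMk (hb.prodMk ?_))
  refine Measurable.ite (hb (measurableSet_singleton true)) ?_ measurable_const
  exact hg.comp ((hx.prodMk hw).prodMk ((measurable_netState_query v z t).comp measurable_fst))

/-- The one-step transition kernel from full histories to the next full state. -/
noncomputable def Model.step (m : Model d du dw S Q) (v : Policy d du S Q) (z : Init d)
    (t : ℕ) : Kernel ((i : Finset.Iic t) → State d dw S) (State d dw S) :=
  (Kernel.id ×ₖ (Kernel.ofFunOfCountable m.freshLaw).comap
    (fun ω => ((last ω).2.1, v.queryAt z t ω)) (measurable_netState_query v z t)).map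
    (m.next v z t)

instance (m : Model d du dw S Q) (v : Policy d du S Q) (z : Init d) (t : ℕ) :
    IsMarkovKernel (m.step v z t) := by
  have : IsMarkovKernel (Kernel.ofFunOfCountable m.freshLaw) :=
    ⟨fun z' => by change IsProbabilityMeasure (m.freshLaw z'); infer_instance⟩
  unfold Model.step
  exact Kernel.IsMarkovKernel.map _ (m.measurable_next v z t)

/-- Law of the full state at time `0`: the plant state is `N(x, V)`, the network state is `s`,
and nothing has been observed yet. -/
noncomputable def initialLaw (dw : ℕ) (z : Init d) (s : S) : Measure (State d dw S) :=
  ((initialPlantLaw z.1 z.2).prod (noiseLaw dw)).prod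
    (Measure.dirac ((s, false, 0) : Signal S))

/-- Law of the trajectory under the policy `v`. -/
noncomputable def Model.law (m : Model d du dw S Q) (v : Policy d du S Q) (z : Init d) (s : S) :
    Measure (ℕ → State d dw S) :=
  Kernel.trajMeasure (X := fun _ => State d dw S) (initialLaw dw z s) (m.step v z)

/-- Running cost at time `t` along a trajectory: network cost plus `Xᵀ R X + Uᵀ M U`. -/
noncomputable def Model.runningCost (m : Model d du dw S Q) (v : Policy d du S Q) (z : Init d)
    (t : ℕ) (ω : ℕ → State d dw S) : ℝ :=
  let h : (i : Finset.Iic t) → State d dw S := fun i => ω i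
  let x := (ω t).1.1
  let u := v.controlAt z t h
  m.netCost (ω t).2.1 (v.queryAt z t h) + (x ⬝ᵥ (m.R *ᵥ x) + u ⬝ᵥ (m.M *ᵥ u))

/-- The `α`-discounted cost of a policy (all terms are nonnegative, `∞` is allowed). -/
noncomputable def Model.discountedCost (m : Model d du dw S Q) (α : ℝ) (v : Policy d du S Q)
    (x : Fin d → ℝ) (s : S) (V : Matrix (Fin d) (Fin d) ℝ) : ℝ≥0∞ :=
  ∫⁻ ω, ∑' t : ℕ, ENNReal.ofReal (α ^ t * m.runningCost v (x, V) t ω) ∂(m.law v (x, V) s)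

/-- The optimal `α`-discounted cost over all admissible policies. -/
noncomputable def Model.discountedValue (m : Model d du dw S Q) (α : ℝ)
    (x : Fin d → ℝ) (s : S) (V : Matrix (Fin d) (Fin d) ℝ) : ℝ≥0∞ :=
  ⨅ v : Policy d du S Q, m.discountedCost α v x s V

/-- The optimal discounted cost is locally bounded on `ℝ^d × S × psdCone d`. -/
def Model.ValueLocallyBounded (m : Model d du dw S Q) (α : ℝ) : Prop :=
  ∀ x s, ∀ V ∈ psdCone d, ∃ c : ℝ≥0∞, c < ∞ ∧
    ∀ᶠ y in 𝓝 x ×ˢ 𝓝[psdCone d] V, m.discountedValue α y.1 s y.2 ≤ c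

end Dynamics

section Filtering

variable [Fintype S]

/-- `Ξ(V) = D Dᵀ + A V Aᵀ`. -/
def Model.Xi (m : Model d du dw S Q) (V : Matrix (Fin d) (Fin d) ℝ) :
    Matrix (Fin d) (Fin d) ℝ :=
  m.D * m.Dᵀ + m.A * V * m.Aᵀ

/-- The Kalman gain `Ξ(V) Cᵀ (C Ξ(V) Cᵀ + F Fᵀ)⁻¹` for a received observation. -/
noncomputable def Model.kalmanGain (m : Model d du dw S Q) (q : Q) (s : S)
    (V : Matrix (Fin d) (Fin d) ℝ) : Matrix (Fin d) (Fin (m.obsDim q s)) ℝ :=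
  m.Xi V * (m.C q s)ᵀ * (m.C q s * m.Xi V * (m.C q s)ᵀ + m.F q s * (m.F q s)ᵀ)⁻¹

/-- Error covariance update after a received observation. -/
noncomputable def Model.covUpdate (m : Model d du dw S Q) (q : Q) (s : S)
    (V : Matrix (Fin d) (Fin d) ℝ) : Matrix (Fin d) (Fin d) ℝ :=
  m.Xi V - m.kalmanGain q s V * m.C q s * m.Xi V

/-- The transition operator of the controlled chain (network state, error covariance). -/
noncomputable def Model.transition (m : Model d du dw S Q) (q : Q)
    (f : S → Matrix (Fin d) (Fin d) ℝ → ℝ) (s : S) (V : Matrix (Fin d) (Fin d) ℝ) : ℝ :=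
  ∑ s', m.p q s s' *
    ((1 - m.loss s q) * f s' (m.covUpdate q s V) + m.loss s q * f s' (m.Xi V))

/-- The Kalman filter under the policy `v`: state estimate and error covariance at time `t` as
functions of the signals up to time `t`. -/
noncomputable def Model.kalmanFilter [MeasurableSpace S] [MeasurableSpace Q]
    (m : Model d du dw S Q) (v : Policy d du S Q) (z : Init d) :
    (t : ℕ) → History S t → (Fin d → ℝ) × Matrix (Fin d) (Fin d) ℝ
  | 0, _ => z
  | t + 1, h =>
    let x := (m.kalmanFilter v z t (previous h)).1
    let V := (m.kalmanFilter v z t (previous h)).2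
    let q := v.query t (z, previous h)
    let s := (last (previous h)).1
    let xp := m.A *ᵥ x + m.B *ᵥ v.control t (z, previous h)
    let y : Fin (m.obsDim q s) → ℝ := fun i => (last h).2.2 i
    if (last h).2.1 then
      (xp + m.kalmanGain q s V *ᵥ (y - m.C q s *ᵥ xp), m.covUpdate q s V)
    else (xp, m.Xi V)

/-- `v` is the stationary Markov policy `Q_t = q(S_t, V_t)`, `U_t = -K x̂_t`, with `x̂_t` and
`V_t` the state estimate and error covariance given by the Kalman filter. -/
def Model.IsStationaryFeedback [MeasurableSpace S] [MeasurableSpace Q]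
    (m : Model d du dw S Q) (K : Matrix (Fin du) (Fin d) ℝ)
    (q : S × Matrix (Fin d) (Fin d) ℝ → Q) (v : Policy d du S Q) : Prop :=
  ∀ (z : Init d), z.2 ∈ psdCone d → ∀ (t : ℕ) (h : History S t),
    v.query t (z, h) = q ((last h).1, (m.kalmanFilter v z t h).2) ∧
    v.control t (z, h) = -(K *ᵥ (m.kalmanFilter v z t h).1)

end Filtering

section Riccati

variable [Fintype S]

/-- The discounted algebraic Riccati equation for `P`. -/
def Model.IsRiccatiSolution (m : Model d du dw S Q) (α : ℝ) (P : Matrix (Fin d) (Fin d) ℝ) :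
    Prop :=
  P = m.R + α • (m.Aᵀ * P * m.A) -
    α ^ 2 • (m.Aᵀ * P * m.B * (m.M + α • (m.Bᵀ * P * m.B))⁻¹ * m.Bᵀ * P * m.A)

/-- The feedback gain `(M + α Bᵀ P B)⁻¹ α Bᵀ P A`. -/
noncomputable def Model.feedbackGain (m : Model d du dw S Q) (α : ℝ)
    (P : Matrix (Fin d) (Fin d) ℝ) : Matrix (Fin du) (Fin d) ℝ :=
  (m.M + α • (m.Bᵀ * P * m.B))⁻¹ * (α • (m.Bᵀ * P * m.A))

/-- The weight `R - P + α Aᵀ P A` of the estimation error. -/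
def Model.errorWeight (m : Model d du dw S Q) (α : ℝ) (P : Matrix (Fin d) (Fin d) ℝ) :
    Matrix (Fin d) (Fin d) ℝ :=
  m.R - P + α • (m.Aᵀ * P * m.A)

/-- The part `xᵀ P x + tr(P V) + α / (1 - α) tr(P D Dᵀ)` of the discounted value. -/
noncomputable def Model.plantValue (m : Model d du dw S Q) (α : ℝ)
    (P : Matrix (Fin d) (Fin d) ℝ) (x : Fin d → ℝ) (V : Matrix (Fin d) (Fin d) ℝ) : ℝ :=
  x ⬝ᵥ (P *ᵥ x) + (P * V).trace + α / (1 - α) * (P * (m.D * m.Dᵀ)).trace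

/-- The expression `c_q(s, V) + α T_q f(s, V)` minimized in the dynamic programming equation,
where `c_q(s, V)` is the network cost plus `tr((R - P + α Aᵀ P A) V)`. -/
noncomputable def Model.bellmanTerm (m : Model d du dw S Q) (α : ℝ)
    (P : Matrix (Fin d) (Fin d) ℝ) (f : S → Matrix (Fin d) (Fin d) ℝ → ℝ) (q : Q) (s : S)
    (V : Matrix (Fin d) (Fin d) ℝ) : ℝ :=
  (m.netCost s q + (m.errorWeight α P * V).trace) + α * m.transition q f s V

/-- `f` is a nonnegative lower semicontinuous solution on `S × psdCone d` of the dynamic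
programming equation `f = min_q (c_q + α T_q f)`, with at most linear growth in the trace.
(Values of `f` off the cone are irrelevant.) -/
structure Model.IsDPSolution (m : Model d du dw S Q) (α : ℝ)
    (P : Matrix (Fin d) (Fin d) ℝ) (f : S → Matrix (Fin d) (Fin d) ℝ → ℝ) : Prop where
  nonneg : ∀ s, ∀ V ∈ psdCone d, 0 ≤ f s V
  lsc : ∀ s, LowerSemicontinuousOn (f s) (psdCone d)
  equation : ∀ s, ∀ V ∈ psdCone d,
    IsLeast (Set.range fun q => m.bellmanTerm α P f q s V) (f s V)
  growth : ∃ κ : ℝ, ∀ s, ∀ V ∈ psdCone d, f s V ≤ κ * (1 + V.trace)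

/-- `q` is a measurable selector of the minimizer in the dynamic programming equation. -/
def Model.IsMinSelector [MeasurableSpace S] [MeasurableSpace Q] (m : Model d du dw S Q) (α : ℝ)
    (P : Matrix (Fin d) (Fin d) ℝ) (f : S → Matrix (Fin d) (Fin d) ℝ → ℝ)
    (q : S × Matrix (Fin d) (Fin d) ℝ → Q) : Prop :=
  Measurable q ∧ ∀ s, ∀ V ∈ psdCone d, ∀ q',
    m.bellmanTerm α P f (q (s, V)) s V ≤ m.bellmanTerm α P f q' s V

end Riccati

end SensorLQG

open SensorLQG

namespace SensorLQG

variable {d du dw : ℕ} {S Q : Type*}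

set_option linter.unusedSectionVars false


/-! The argument separates control from sensing by completing the square, and then solves the
sensing problem by value iteration.

Let `P` solve the Riccati equation. The Riccati map is a minimum over controls
(`Model.quadForm_riccatiMap`): the cost of a control exceeds this minimum by a square in `u + K x`.
Hence the map is monotone and dominates `R`. Its iterates from zero increase, stay below the
discounted cost of a stabilizing feedback, and converge to a positive definite fixed point.
Uniqueness is a contraction estimate under the optimal feedback.

Given the signals up to time `t`, the plant state is Gaussian with the mean and covariance of the
Kalman filter, and independent of the disturbance `D W_t` that drives the next step
(`Model.lintegral_law_eq_filterIntegral`). The condition `D Fᵀ = 0` is what keeps this disturbance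
independent of the observation noise. Averaging the completed square over the conditional law gives
the identity `Model.expectedCost_add_expectedValue`: expected cost plus discounted value-to-go
equals the current plant value, plus a Bellman term in (network state, covariance), plus a
nonnegative square that vanishes exactly when the control is `-K` times the estimate. The covariance
evolves independently of the control, so what is left is a controlled chain steered by the queries
alone, with the error cost `tr(errorWeight * V)`.

For this chain, `covUpdate` is the minimum over linear gains of maps that are affine and monotone in
the covariance, so it is monotone and concave in the Loewner order. These properties survive the
Bellman operator, and every value iterate is monotone, concave and continuous. Each policy costs at
least plant value plus iterate: iterate the one-step inequality and note that finite total cost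
kills the terminal term. Finiteness of the value therefore bounds the iterates. Their supremum
solves the equation, is concave and lower semicontinuous, and is attained by the feedback with a
minimizing query, since for this policy the one-step inequality is an equality and telescopes.
Concavity together with local boundedness gives linear growth.

Uniqueness needs more than discounting, because the covariance may grow faster than `α^(-n)`. The
solution itself supplies a Lyapunov function: one plus the value with zero mean is of the order of
`1 + tr V` and contracts under the discounted transition along minimizing queries
(`Model.le_of_isDPSolution`). -/

/-! ### Quadratic forms -/

/-- The quadratic form `xᵀ G x`. -/
def quadForm {n : ℕ} (G : Matrix (Fin n) (Fin n) ℝ) (x : Fin n → ℝ) : ℝ := x ⬝ᵥ (G *ᵥ x)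

section QuadForm

variable {n k : ℕ}

theorem dotProduct_mulVec_transpose (G : Matrix (Fin n) (Fin k) ℝ) (x : Fin n → ℝ)
    (y : Fin k → ℝ) : x ⬝ᵥ (G *ᵥ y) = (Gᵀ *ᵥ x) ⬝ᵥ y := by
  rw [dotProduct_mulVec, ← mulVec_transpose]

theorem dotProduct_mulVec_symm {G : Matrix (Fin n) (Fin n) ℝ} (hG : Gᵀ = G) (x y : Fin n → ℝ) :
    x ⬝ᵥ (G *ᵥ y) = y ⬝ᵥ (G *ᵥ x) := by
  rw [dotProduct_mulVec_transpose, hG, dotProduct_comm]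

theorem quadForm_add_vec {G : Matrix (Fin n) (Fin n) ℝ} (hG : Gᵀ = G) (x y : Fin n → ℝ) :
    quadForm G (x + y) = quadForm G x + 2 * (y ⬝ᵥ (G *ᵥ x)) + quadForm G y := by
  simp only [quadForm, mulVec_add, dotProduct_add, add_dotProduct]
  rw [dotProduct_mulVec_symm hG x y]; ring

theorem quadForm_neg_vec (G : Matrix (Fin n) (Fin n) ℝ) (x : Fin n → ℝ) :
    quadForm G (-x) = quadForm G x := by
  simp [quadForm, mulVec_neg]

theorem quadForm_zero_vec (G : Matrix (Fin n) (Fin n) ℝ) : quadForm G 0 = 0 := by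
  simp [quadForm]

theorem quadForm_add (G H : Matrix (Fin n) (Fin n) ℝ) (x : Fin n → ℝ) :
    quadForm (G + H) x = quadForm G x + quadForm H x := by
  simp [quadForm, add_mulVec]

theorem quadForm_sub (G H : Matrix (Fin n) (Fin n) ℝ) (x : Fin n → ℝ) :
    quadForm (G - H) x = quadForm G x - quadForm H x := by
  simp [quadForm, sub_mulVec]

theorem quadForm_smul (c : ℝ) (G : Matrix (Fin n) (Fin n) ℝ) (x : Fin n → ℝ) :
    quadForm (c • G) x = c * quadForm G x := by
  simp [quadForm, smul_mulVec]

theorem quadForm_conj (G : Matrix (Fin n) (Fin n) ℝ) (H : Matrix (Fin n) (Fin k) ℝ)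
    (x : Fin k → ℝ) : quadForm (Hᵀ * G * H) x = quadForm G (H *ᵥ x) := by
  unfold quadForm
  rw [← mulVec_mulVec, ← mulVec_mulVec, dotProduct_mulVec_transpose, transpose_transpose]

theorem quadForm_conj' (G : Matrix (Fin n) (Fin n) ℝ) (H : Matrix (Fin k) (Fin n) ℝ)
    (x : Fin k → ℝ) : quadForm (H * G * Hᵀ) x = quadForm G (Hᵀ *ᵥ x) := by
  rw [← quadForm_conj, transpose_transpose]

theorem quadForm_one (x : Fin n → ℝ) : quadForm 1 x = x ⬝ᵥ x := by
  simp [quadForm]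

theorem posSemidef_iff_quadForm {G : Matrix (Fin n) (Fin n) ℝ} :
    G.PosSemidef ↔ Gᵀ = G ∧ ∀ x, 0 ≤ quadForm G x := by
  rw [posSemidef_iff_dotProduct_mulVec]; rfl

theorem posDef_iff_quadForm {G : Matrix (Fin n) (Fin n) ℝ} :
    G.PosDef ↔ Gᵀ = G ∧ ∀ x, x ≠ 0 → 0 < quadForm G x := by
  rw [posDef_iff_dotProduct_mulVec]; rfl

theorem quadForm_nonneg {G : Matrix (Fin n) (Fin n) ℝ} (hG : G.PosSemidef) (x : Fin n → ℝ) :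
    0 ≤ quadForm G x := (posSemidef_iff_quadForm.1 hG).2 x

theorem transpose_eq_of_posSemidef {G : Matrix (Fin n) (Fin n) ℝ} (hG : G.PosSemidef) :
    Gᵀ = G := (posSemidef_iff_quadForm.1 hG).1

/-- Polarization. It carries convergence and equality of quadratic forms over to matrices, entry by
entry. -/
theorem entry_eq_quadForm {G : Matrix (Fin n) (Fin n) ℝ} (hG : Gᵀ = G) (i j : Fin n) :
    G i j = (quadForm G (Pi.single j 1 + Pi.single i 1) - quadForm G (Pi.single i 1)
      - quadForm G (Pi.single j 1)) / 2 := by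
  rw [quadForm_add_vec hG]
  simp

theorem eq_of_quadForm_eq {G H : Matrix (Fin n) (Fin n) ℝ} (hG : Gᵀ = G) (hH : Hᵀ = H)
    (h : ∀ x, quadForm G x = quadForm H x) : G = H := by
  ext i j
  rw [entry_eq_quadForm hG, entry_eq_quadForm hH]
  simp only [h]

theorem continuous_quadForm (G : Matrix (Fin n) (Fin n) ℝ) : Continuous (quadForm G) := by
  unfold quadForm
  fun_prop

theorem measurable_quadForm (G : Matrix (Fin n) (Fin n) ℝ) : Measurable (quadForm G) :=
  (continuous_quadForm G).measurable

theorem continuous_quadForm_left (x : Fin n → ℝ) :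
    Continuous fun G : Matrix (Fin n) (Fin n) ℝ => quadForm G x := by
  unfold quadForm
  fun_prop

theorem dotProduct_self_nonneg' (x : Fin n → ℝ) : 0 ≤ x ⬝ᵥ x :=
  Finset.sum_nonneg fun i _ => mul_self_nonneg (x i)

theorem quadForm_smul_vec (G : Matrix (Fin n) (Fin n) ℝ) (c : ℝ) (x : Fin n → ℝ) :
    quadForm G (c • x) = c ^ 2 * quadForm G x := by
  simp only [quadForm, mulVec_smul, dotProduct_smul, smul_dotProduct, smul_eq_mul]; ring

/-- The norm on `Fin n → ℝ` is the sup norm, so the Euclidean sphere is not a metric sphere here; it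
is closed and lies in the unit box. -/
theorem isCompact_dotProduct_sphere : IsCompact {x : Fin n → ℝ | x ⬝ᵥ x = 1} := by
  refine Metric.isCompact_of_isClosed_isBounded
    (isClosed_eq (by fun_prop) continuous_const) ?_
  refine (Metric.isBounded_closedBall (x := (0 : Fin n → ℝ)) (r := 1)).subset fun x hx => ?_
  rw [mem_closedBall_zero_iff, pi_norm_le_iff_of_nonneg zero_le_one]
  intro i
  have h1 : x i * x i ≤ x ⬝ᵥ x :=
    Finset.single_le_sum (f := fun j => x j * x j) (fun j _ => mul_self_nonneg _)
      (Finset.mem_univ i)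
  rw [Set.mem_ofPred_eq] at hx
  rw [hx] at h1
  rw [Real.norm_eq_abs]
  exact abs_le_one_iff_mul_self_le_one.2 h1

theorem quadForm_eq_normalized (G : Matrix (Fin n) (Fin n) ℝ) {x : Fin n → ℝ} (hx : x ≠ 0) :
    ∃ y : Fin n → ℝ, y ⬝ᵥ y = 1 ∧ quadForm G x = (x ⬝ᵥ x) * quadForm G y := by
  have hpos : 0 < x ⬝ᵥ x :=
    lt_of_le_of_ne (dotProduct_self_nonneg' x) fun h => hx (dotProduct_self_eq_zero.1 h.symm)
  have hs : Real.sqrt (x ⬝ᵥ x) ^ 2 = x ⬝ᵥ x := Real.sq_sqrt hpos.le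
  refine ⟨(Real.sqrt (x ⬝ᵥ x))⁻¹ • x, ?_, ?_⟩
  · rw [← quadForm_one, quadForm_smul_vec, quadForm_one, inv_pow, hs, inv_mul_cancel₀ hpos.ne']
  · rw [quadForm_smul_vec, inv_pow, hs, mul_inv_cancel_left₀ hpos.ne']

theorem exists_quadForm_le (G : Matrix (Fin n) (Fin n) ℝ) :
    ∃ c : ℝ, 0 ≤ c ∧ ∀ x, quadForm G x ≤ c * (x ⬝ᵥ x) := by
  obtain ⟨c, hc⟩ := (isCompact_dotProduct_sphere (n := n)).bddAbove_image
    (continuous_quadForm G).continuousOn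
  refine ⟨max c 0, le_max_right _ _, fun x => ?_⟩
  by_cases hx : x = 0
  · simp [hx, quadForm_zero_vec]
  obtain ⟨y, hy, h⟩ := quadForm_eq_normalized G hx
  rw [h, mul_comm]
  exact mul_le_mul_of_nonneg_right ((hc ⟨y, hy, rfl⟩).trans (le_max_left _ _))
    (dotProduct_self_nonneg' x)

theorem exists_le_quadForm {G : Matrix (Fin n) (Fin n) ℝ} (hG : G.PosDef) :
    ∃ c : ℝ, 0 < c ∧ ∀ x, c * (x ⬝ᵥ x) ≤ quadForm G x := by
  have hG' := (posDef_iff_quadForm.1 hG).2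
  by_cases hne : {x : Fin n → ℝ | x ⬝ᵥ x = 1}.Nonempty
  · obtain ⟨y, hy, hmin⟩ := (isCompact_dotProduct_sphere (n := n)).exists_isMinOn hne
      (continuous_quadForm G).continuousOn
    refine ⟨quadForm G y, hG' y ?_, fun x => ?_⟩
    · rintro rfl
      simp at hy
    by_cases hx : x = 0
    · simp [hx, quadForm_zero_vec]
    obtain ⟨z, hz, h⟩ := quadForm_eq_normalized G hx
    rw [h, mul_comm]
    exact mul_le_mul_of_nonneg_left (hmin hz) (dotProduct_self_nonneg' x)
  -- The sphere is empty only in dimension zero, where every vector is zero and any constant will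
  -- do.
  · refine ⟨1, one_pos, fun x => ?_⟩
    by_cases hx : x = 0
    · simp [hx, quadForm_zero_vec]
    obtain ⟨z, hz, -⟩ := quadForm_eq_normalized G hx
    exact absurd ⟨z, hz⟩ hne

theorem exists_quadForm_le_quadForm (G : Matrix (Fin n) (Fin n) ℝ)
    {H : Matrix (Fin n) (Fin n) ℝ} (hH : H.PosDef) :
    ∃ c : ℝ, 0 ≤ c ∧ ∀ x, quadForm G x ≤ c * quadForm H x := by
  obtain ⟨a, ha, h1⟩ := exists_quadForm_le G
  obtain ⟨b, hb, h2⟩ := exists_le_quadForm hH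
  refine ⟨a / b, by positivity, fun x => (h1 x).trans ?_⟩
  rw [div_mul_eq_mul_div, le_div_iff₀ hb, mul_assoc, mul_comm (x ⬝ᵥ x)]
  exact mul_le_mul_of_nonneg_left (h2 x) ha

-- Factor `H` as `Bᴴ B`; by cyclicity the trace is that of `B G Bᴴ`, which is positive semidefinite.
open scoped MatrixOrder in
theorem trace_mul_nonneg {G H : Matrix (Fin n) (Fin n) ℝ} (hG : G.PosSemidef)
    (hH : H.PosSemidef) : 0 ≤ (G * H).trace := by
  obtain ⟨B, rfl⟩ := CStarAlgebra.nonneg_iff_eq_star_mul_self.1 (Matrix.nonneg_iff_posSemidef.2 hH)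
  rw [← Matrix.mul_assoc, Matrix.trace_mul_comm, ← Matrix.mul_assoc]
  exact (hG.mul_mul_conjTranspose_same B).trace_nonneg

theorem trace_mul_le_of_quadForm_le {G G' H : Matrix (Fin n) (Fin n) ℝ} (hG : Gᵀ = G)
    (hG' : G'ᵀ = G') (h : ∀ x, quadForm G x ≤ quadForm G' x) (hH : H.PosSemidef) :
    (G * H).trace ≤ (G' * H).trace := by
  have := trace_mul_nonneg (G := G' - G) (H := H)
    (posSemidef_iff_quadForm.2 ⟨by rw [transpose_sub, hG, hG'],
      fun x => by rw [quadForm_sub]; linarith [h x]⟩) hH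
  rw [Matrix.sub_mul, trace_sub] at this
  linarith

theorem continuousAt_matrix_inv {G : Matrix (Fin n) (Fin n) ℝ} (hG : G.det ≠ 0) :
    ContinuousAt (fun H : Matrix (Fin n) (Fin n) ℝ => H⁻¹) G := by
  simp only [Matrix.inv_def, Ring.inverse_eq_inv']
  have h1 : ContinuousAt (fun H : Matrix (Fin n) (Fin n) ℝ => (H.det)⁻¹) G :=
    (Continuous.matrix_det continuous_id).continuousAt.inv₀ hG
  exact h1.smul (Continuous.matrix_adjugate continuous_id).continuousAt

end QuadForm

/-! ### The Riccati equation -/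

section Riccati

variable [Fintype S]

/-- The right-hand side of the Riccati equation. -/
noncomputable def Model.riccatiMap (m : Model d du dw S Q) (α : ℝ)
    (P : Matrix (Fin d) (Fin d) ℝ) : Matrix (Fin d) (Fin d) ℝ :=
  m.R + α • (m.Aᵀ * P * m.A) -
    α ^ 2 • (m.Aᵀ * P * m.B * (m.M + α • (m.Bᵀ * P * m.B))⁻¹ * m.Bᵀ * P * m.A)

/-- The weight `M + α Bᵀ P B` of the control. -/
def Model.controlWeight (m : Model d du dw S Q) (α : ℝ)
    (P : Matrix (Fin d) (Fin d) ℝ) : Matrix (Fin du) (Fin du) ℝ :=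
  m.M + α • (m.Bᵀ * P * m.B)

variable (m : Model d du dw S Q) {α : ℝ} {P P' : Matrix (Fin d) (Fin d) ℝ}

theorem Model.controlWeight_posDef (hα : 0 ≤ α) (hP : P.PosSemidef) :
    (m.controlWeight α P).PosDef :=
  m.M_posDef.add_posSemidef ((hP.conjTranspose_mul_mul_same m.B).smul hα)

theorem Model.transpose_R : m.Rᵀ = m.R := (posDef_iff_quadForm.1 m.R_posDef).1

theorem Model.transpose_M : m.Mᵀ = m.M := (posDef_iff_quadForm.1 m.M_posDef).1

theorem Model.riccatiMap_transpose (hP : Pᵀ = P) : (m.riccatiMap α P)ᵀ = m.riccatiMap α P := by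
  simp [Model.riccatiMap, transpose_nonsing_inv, Matrix.mul_assoc, hP, m.transpose_R,
    m.transpose_M]

theorem Model.controlWeight_mul_feedbackGain (hα : 0 ≤ α) (hP : P.PosSemidef) :
    m.controlWeight α P * m.feedbackGain α P = α • (m.Bᵀ * P * m.A) :=
  Matrix.mul_nonsing_inv_cancel_left _ _
    ((Matrix.isUnit_iff_isUnit_det _).1 (m.controlWeight_posDef hα hP).isUnit)

/-- The term subtracted in the Riccati map is a weighted square of the gain. This completes the
square in the one-step problem, and it is also why `errorWeight` is positive semidefinite. -/
theorem Model.feedbackGain_sq (hα : 0 ≤ α) (hP : P.PosSemidef) :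
    (m.feedbackGain α P)ᵀ * m.controlWeight α P * m.feedbackGain α P =
      α ^ 2 • (m.Aᵀ * P * m.B * (m.M + α • (m.Bᵀ * P * m.B))⁻¹ * m.Bᵀ * P * m.A) := by
  have hPt := transpose_eq_of_posSemidef hP
  rw [Matrix.mul_assoc, m.controlWeight_mul_feedbackGain hα hP]
  simp [Model.feedbackGain, transpose_nonsing_inv, Matrix.mul_assoc, hPt, m.transpose_M,
    smul_smul, sq]

/-- Completion of the square in the linear quadratic one-step problem. -/
theorem Model.quadForm_riccatiMap (hα : 0 ≤ α) (hP : P.PosSemidef) (x : Fin d → ℝ)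
    (u : Fin du → ℝ) :
    quadForm m.R x + quadForm m.M u + α * quadForm P (m.A *ᵥ x + m.B *ᵥ u) =
      quadForm (m.riccatiMap α P) x +
        quadForm (m.controlWeight α P) (u + m.feedbackGain α P *ᵥ x) := by
  have hPt := transpose_eq_of_posSemidef hP
  have hN := transpose_eq_of_posSemidef (m.controlWeight_posDef hα hP).posSemidef
  have h1 : quadForm (m.riccatiMap α P) x = quadForm m.R x + α * quadForm P (m.A *ᵥ x) -
      quadForm (m.controlWeight α P) (m.feedbackGain α P *ᵥ x) := by
    rw [← quadForm_conj (m.controlWeight α P), m.feedbackGain_sq hα hP, ← quadForm_conj P,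
      ← quadForm_smul, ← quadForm_add, ← quadForm_sub]
    rfl
  have h2 : quadForm (m.controlWeight α P) u =
      quadForm m.M u + α * quadForm P (m.B *ᵥ u) := by
    rw [← quadForm_conj P, ← quadForm_smul, ← quadForm_add]; rfl
  have h3 : (m.feedbackGain α P *ᵥ x) ⬝ᵥ (m.controlWeight α P *ᵥ u) =
      α * ((m.B *ᵥ u) ⬝ᵥ (P *ᵥ (m.A *ᵥ x))) := by
    rw [dotProduct_mulVec_symm hN, mulVec_mulVec, m.controlWeight_mul_feedbackGain hα hP,
      smul_mulVec, dotProduct_smul, ← mulVec_mulVec, ← mulVec_mulVec,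
      dotProduct_mulVec_transpose, transpose_transpose, smul_eq_mul]
  rw [quadForm_add_vec hPt, quadForm_add_vec hN, h1, h2, h3, dotProduct_mulVec_symm hPt]
  rw [dotProduct_mulVec_symm hPt]
  ring

/-- With `Model.riccatiMap_eq` this is the variational form of the Riccati map, a minimum over
controls. Monotonicity, the lower bound by `R`, boundedness of the iterates and uniqueness all
follow by inserting a suitable control. -/
theorem Model.riccatiMap_le (hα : 0 ≤ α) (hP : P.PosSemidef) (x : Fin d → ℝ)
    (u : Fin du → ℝ) :
    quadForm (m.riccatiMap α P) x ≤
      quadForm m.R x + quadForm m.M u + α * quadForm P (m.A *ᵥ x + m.B *ᵥ u) := by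
  rw [m.quadForm_riccatiMap hα hP]
  linarith [quadForm_nonneg (m.controlWeight_posDef hα hP).posSemidef
    (u + m.feedbackGain α P *ᵥ x)]

theorem Model.riccatiMap_eq (hα : 0 ≤ α) (hP : P.PosSemidef) (x : Fin d → ℝ) :
    quadForm (m.riccatiMap α P) x =
      quadForm m.R x + quadForm m.M (-(m.feedbackGain α P *ᵥ x)) +
        α * quadForm P (m.A *ᵥ x + m.B *ᵥ (-(m.feedbackGain α P *ᵥ x))) := by
  rw [m.quadForm_riccatiMap hα hP, neg_add_cancel, quadForm_zero_vec, add_zero]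

theorem Model.R_le_riccatiMap (hα : 0 ≤ α) (hP : P.PosSemidef) (x : Fin d → ℝ) :
    quadForm m.R x ≤ quadForm (m.riccatiMap α P) x := by
  rw [m.riccatiMap_eq hα hP]
  have h1 := quadForm_nonneg m.M_posDef.posSemidef (-(m.feedbackGain α P *ᵥ x))
  have h2 := mul_nonneg hα
    (quadForm_nonneg hP (m.A *ᵥ x + m.B *ᵥ (-(m.feedbackGain α P *ᵥ x))))
  linarith

theorem Model.riccatiMap_posDef (hα : 0 ≤ α) (hP : P.PosSemidef) :
    (m.riccatiMap α P).PosDef :=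
  posDef_iff_quadForm.2 ⟨m.riccatiMap_transpose (transpose_eq_of_posSemidef hP), fun x hx =>
    ((posDef_iff_quadForm.1 m.R_posDef).2 x hx).trans_le (m.R_le_riccatiMap hα hP x)⟩

theorem Model.riccatiMap_mono (hα : 0 ≤ α) (hP : P.PosSemidef) (hP' : P'.PosSemidef)
    (h : ∀ x, quadForm P x ≤ quadForm P' x) (x : Fin d → ℝ) :
    quadForm (m.riccatiMap α P) x ≤ quadForm (m.riccatiMap α P') x := by
  rw [m.riccatiMap_eq hα hP']
  exact (m.riccatiMap_le hα hP x (-(m.feedbackGain α P' *ᵥ x))).trans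
    (add_le_add_right (mul_le_mul_of_nonneg_left (h _) hα) _)

/-- Iterates of the Riccati map, started at zero. -/
noncomputable def Model.riccatiIter (m : Model d du dw S Q) (α : ℝ) :
    ℕ → Matrix (Fin d) (Fin d) ℝ
  | 0 => 0
  | n + 1 => m.riccatiMap α (m.riccatiIter α n)

theorem Model.riccatiIter_posSemidef (hα : 0 ≤ α) (n : ℕ) : (m.riccatiIter α n).PosSemidef := by
  induction n with
  | zero => exact PosSemidef.zero
  | succ n ih => exact (m.riccatiMap_posDef hα ih).posSemidef

theorem Model.riccatiIter_le_succ (hα : 0 ≤ α) (n : ℕ) (x : Fin d → ℝ) :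
    quadForm (m.riccatiIter α n) x ≤ quadForm (m.riccatiIter α (n + 1)) x := by
  induction n generalizing x with
  | zero =>
    have := quadForm_nonneg (m.riccatiIter_posSemidef hα 1) x
    simpa [Model.riccatiIter, quadForm] using this
  | succ n ih =>
    exact m.riccatiMap_mono hα (m.riccatiIter_posSemidef hα n)
      (m.riccatiIter_posSemidef hα (n + 1)) ih x

/-! ### Powers of a matrix with spectrum in the open unit disc -/

section Powers

attribute [local instance] Matrix.linftyOpNormedRing Matrix.linftyOpNormedAlgebra

/-- Gelfand's formula: the roots of the norms of the powers tend to the spectral radius, which is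
below one, so the norms are eventually at most one. Boundedness suffices, because discounting
provides the summability later. -/
theorem exists_entry_pow_le {n : ℕ} {G : Matrix (Fin n) (Fin n) ℝ}
    (hG : ∀ z ∈ spectrum ℂ (G.map (algebraMap ℝ ℂ)), ‖z‖ < 1) :
    ∃ c : ℝ, ∀ t i j, |(G ^ t) i j| ≤ c := by
  rcases isEmpty_or_nonempty (Fin n) with hn | hn
  · exact ⟨0, fun t i => (IsEmpty.false i).elim⟩
  set H := G.map (algebraMap ℝ ℂ) with hH
  have hr : spectralRadius ℂ H < ((1 : NNReal) : ℝ≥0∞) :=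
    spectrum.spectralRadius_lt_of_forall_lt H fun z hz => by
      rw [← NNReal.coe_lt_coe]; exact hG z hz
  have hev : ∀ᶠ t in atTop, ‖H ^ t‖ ≤ 1 := by
    have h1 := (spectrum.pow_nnnorm_pow_one_div_tendsto_nhds_spectralRadius H).eventually_lt_const hr
    filter_upwards [h1, eventually_gt_atTop 0] with t ht ht0
    by_contra! hlt
    refine absurd ht (not_lt.2 ?_)
    rw [ENNReal.coe_one]
    refine ENNReal.one_le_rpow ?_ (by positivity)
    exact_mod_cast hlt.le
  obtain ⟨N, hN⟩ := eventually_atTop.1 hev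
  refine ⟨1 + ∑ k ∈ Finset.range N, ‖H ^ k‖, fun t i j => ?_⟩
  have hent : |(G ^ t) i j| ≤ ‖H ^ t‖ := by
    have hmap : H ^ t = (G ^ t).map (algebraMap ℝ ℂ) := by
      rw [hH]
      exact ((algebraMap ℝ ℂ).mapMatrix.map_pow G t).symm
    have h2 : |(G ^ t) i j| = ‖(H ^ t) i j‖ := by simp [hmap]
    rw [h2, Matrix.linfty_opNorm_def]
    have h3 : ‖(H ^ t) i j‖₊ ≤ ∑ j, ‖(H ^ t) i j‖₊ :=
      Finset.single_le_sum (f := fun j => ‖(H ^ t) i j‖₊) (fun _ _ => zero_le) (Finset.mem_univ j)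
    have h4 := h3.trans (Finset.le_sup (f := fun i => ∑ j, ‖(H ^ t) i j‖₊) (Finset.mem_univ i))
    exact_mod_cast h4
  refine hent.trans ?_
  have hsum : 0 ≤ ∑ k ∈ Finset.range N, ‖H ^ k‖ := Finset.sum_nonneg fun _ _ => norm_nonneg _
  rcases lt_or_ge t N with h | h
  · have := Finset.single_le_sum (f := fun k => ‖H ^ k‖) (fun _ _ => norm_nonneg _)
      (Finset.mem_range.2 h)
    linarith
  · linarith [hN t h]

end Powers

theorem exists_pow_mulVec_le {n : ℕ} {G : Matrix (Fin n) (Fin n) ℝ}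
    (hG : ∀ z ∈ spectrum ℂ (G.map (algebraMap ℝ ℂ)), ‖z‖ < 1) (x : Fin n → ℝ) :
    ∃ c : ℝ, ∀ t, (G ^ t *ᵥ x) ⬝ᵥ (G ^ t *ᵥ x) ≤ c := by
  obtain ⟨c, hc⟩ := exists_entry_pow_le hG
  refine ⟨∑ i : Fin n, (∑ j, c * |x j|) ^ 2, fun t => Finset.sum_le_sum fun i _ => ?_⟩
  rw [← sq]
  refine sq_le_sq' ?_ ?_ <;> [rw [neg_le]; skip] <;>
  · refine le_trans ?_ ((Finset.abs_sum_le_sum_abs (fun j => (G ^ t) i j * x j) _).trans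
      (Finset.sum_le_sum fun j _ => ?_))
    · first | exact le_abs_self _ | exact neg_le_abs _
    · rw [abs_mul]
      exact mul_le_mul_of_nonneg_right (hc t i j) (abs_nonneg _)

/-- Inserting the stabilizing control `K x` at each stage bounds the `n`-th iterate by an `n`-stage
discounted cost of the closed loop. The closed-loop states are bounded, so a geometric series bounds
this cost uniformly in `n`. -/
theorem Model.riccatiIter_bounded (hAB : IsStabilizable m.A m.B) (hα : α ∈ Set.Ioo (0 : ℝ) 1)
    (x : Fin d → ℝ) : ∃ c, ∀ n, quadForm (m.riccatiIter α n) x ≤ c := by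
  obtain ⟨K, hK⟩ := hAB
  obtain ⟨a, ha, hac⟩ := exists_quadForm_le (m.R + Kᵀ * m.M * K)
  have hstep : ∀ n x, quadForm (m.riccatiIter α n) x ≤
      a * ∑ t ∈ Finset.range n, α ^ t *
        (((m.A + m.B * K) ^ t *ᵥ x) ⬝ᵥ ((m.A + m.B * K) ^ t *ᵥ x)) := by
    intro n
    induction n with
    | zero => intro x; simp [Model.riccatiIter, quadForm]
    | succ n ih =>
      intro x
      refine (m.riccatiMap_le hα.1.le (m.riccatiIter_posSemidef hα.1.le n) x (K *ᵥ x)).trans ?_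
      have h1 : quadForm m.R x + quadForm m.M (K *ᵥ x) ≤ a * (x ⬝ᵥ x) := by
        rw [← quadForm_conj, ← quadForm_add]; exact hac x
      have h2 := mul_le_mul_of_nonneg_left (ih ((m.A + m.B * K) *ᵥ x)) hα.1.le
      rw [show m.A *ᵥ x + m.B *ᵥ (K *ᵥ x) = (m.A + m.B * K) *ᵥ x by
        rw [add_mulVec, mulVec_mulVec]]
      rw [Finset.sum_range_succ']
      simp only [mulVec_mulVec, ← pow_succ, pow_zero, one_mulVec, one_mul] at h2 ⊢
      rw [mul_add, Finset.mul_sum]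
      rw [Finset.mul_sum, Finset.mul_sum] at h2
      refine (add_le_add h1 h2).trans (le_of_eq ?_)
      rw [add_comm]
      congr 1
      exact Finset.sum_congr rfl fun t _ => by ring
  obtain ⟨c, hc⟩ := exists_pow_mulVec_le hK x
  refine ⟨a * (c * (1 - α)⁻¹), fun n => (hstep n x).trans ?_⟩
  refine mul_le_mul_of_nonneg_left ?_ ha
  have hc0 : 0 ≤ c := (dotProduct_self_nonneg' _).trans (hc 0)
  calc _ ≤ ∑ t ∈ Finset.range n, α ^ t * c :=
        Finset.sum_le_sum fun t _ => mul_le_mul_of_nonneg_left (hc t) (pow_nonneg hα.1.le t)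
    _ = c * ∑ t ∈ Finset.range n, α ^ t := by rw [Finset.mul_sum]; simp only [mul_comm]
    _ ≤ c * (1 - α)⁻¹ := by
        refine mul_le_mul_of_nonneg_left ?_ hc0
        rw [← tsum_geometric_of_lt_one hα.1.le hα.2]
        exact (summable_geometric_of_lt_one hα.1.le hα.2).sum_le_tsum _
          fun t _ => pow_nonneg hα.1.le t

/-- Increasing and bounded quadratic forms converge, polarization makes this a limit of matrices,
and continuity of the Riccati map there makes the limit a fixed point. It is positive definite
because every value of the map dominates `R`. -/
theorem Model.exists_riccati_solution (hAB : IsStabilizable m.A m.B)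
    (hα : α ∈ Set.Ioo (0 : ℝ) 1) :
    ∃ P : Matrix (Fin d) (Fin d) ℝ, P.PosDef ∧ m.IsRiccatiSolution α P := by
  have hpsd := m.riccatiIter_posSemidef hα.1.le
  have hlim : ∀ x, ∃ l, Tendsto (fun n => quadForm (m.riccatiIter α n) x) atTop (𝓝 l) := by
    intro x
    obtain ⟨c, hc⟩ := m.riccatiIter_bounded hAB hα x
    exact ⟨_, tendsto_atTop_ciSup (monotone_nat_of_le_succ fun n =>
      m.riccatiIter_le_succ hα.1.le n x) ⟨c, by rintro _ ⟨n, rfl⟩; exact hc n⟩⟩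
  choose l hl using hlim
  let P : Matrix (Fin d) (Fin d) ℝ := Matrix.of fun i j =>
    (l (Pi.single j 1 + Pi.single i 1) - l (Pi.single i 1) - l (Pi.single j 1)) / 2
  have hP : Tendsto (m.riccatiIter α) atTop (𝓝 P) := by
    refine tendsto_pi_nhds.2 fun i => tendsto_pi_nhds.2 fun j => ?_
    simp only [entry_eq_quadForm (transpose_eq_of_posSemidef (hpsd _)) i j]
    exact (((hl _).sub (hl _)).sub (hl _)).div_const 2
  have hPpsd : P.PosSemidef := by
    refine posSemidef_iff_quadForm.2 ⟨?_, fun x => ?_⟩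
    · refine tendsto_nhds_unique
        (((Continuous.matrix_transpose continuous_id).tendsto P).comp hP) ?_
      simp only [Function.comp_def, id]
      simpa only [transpose_eq_of_posSemidef (hpsd _)] using hP
    · exact ge_of_tendsto' (((continuous_quadForm_left x).tendsto P).comp hP)
        fun n => quadForm_nonneg (hpsd n) x
  have hcont : ContinuousAt (m.riccatiMap α) P := by
    have hinv : ContinuousAt (fun P => (m.M + α • (m.Bᵀ * P * m.B))⁻¹) P :=
      ContinuousAt.comp (f := fun P => m.M + α • (m.Bᵀ * P * m.B))
        (continuousAt_matrix_inv ((Matrix.isUnit_iff_isUnit_det _).1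
          (m.controlWeight_posDef hα.1.le hPpsd).isUnit).ne_zero) (by fun_prop)
    have hc : Continuous fun z : Matrix (Fin d) (Fin d) ℝ × Matrix (Fin du) (Fin du) ℝ =>
        m.R + α • (m.Aᵀ * z.1 * m.A) -
          α ^ 2 • (m.Aᵀ * z.1 * m.B * z.2 * m.Bᵀ * z.1 * m.A) := by fun_prop
    exact ContinuousAt.comp (f := fun P => (P, (m.M + α • (m.Bᵀ * P * m.B))⁻¹))
      hc.continuousAt (continuousAt_id.prodMk hinv)
  have hfix : m.IsRiccatiSolution α P :=
    tendsto_nhds_unique ((tendsto_add_atTop_iff_nat 1).2 hP) (hcont.tendsto.comp hP)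
  exact ⟨P, by rw [show P = m.riccatiMap α P from hfix]; exact m.riccatiMap_posDef hα.1.le hPpsd,
    hfix⟩

/-- One half of uniqueness. Under the feedback that is optimal for `P`, the excess of `P'` over `P`
at `x` is at most `α` times the excess at the next state `y`, while `P` itself satisfies `α P(y) ≤
(1 - e) P(x)`. Starting from `P' ≤ c P` and iterating drives the excess to zero. -/
theorem Model.riccati_solution_unique (hα : α ∈ Set.Ioo (0 : ℝ) 1) (hP : P.PosDef)
    (h : m.IsRiccatiSolution α P) (hP' : P'.PosDef) (h' : m.IsRiccatiSolution α P')
    (x : Fin d → ℝ) : quadForm P' x ≤ quadForm P x := by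
  obtain ⟨c, hc, hcP⟩ := exists_quadForm_le_quadForm P' hP
  obtain ⟨b, hb, hbR⟩ := exists_quadForm_le_quadForm P m.R_posDef
  -- From `P ≤ b R` one gets `e P ≤ R`; the extra `1` makes `e` well defined and at most one even if
  -- `b` vanishes.
  set e : ℝ := (b + 1)⁻¹ with he
  have hb1 : 0 < b + 1 := by linarith
  have he0 : 0 < e := inv_pos.2 hb1
  have he1 : e ≤ 1 := inv_le_one_of_one_le₀ (by linarith)
  have heR : ∀ x, e * quadForm P x ≤ quadForm m.R x := by
    intro x
    rw [he, inv_mul_le_iff₀ hb1]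
    nlinarith [hbR x, quadForm_nonneg m.R_posDef.posSemidef x]
  have key : ∀ n x, quadForm P' x - quadForm P x ≤ c * (1 - e) ^ n * quadForm P x := by
    intro n
    induction n with
    | zero => intro x; have := hcP x; have := quadForm_nonneg hP.posSemidef x; simp; linarith
    | succ n ih =>
      intro x
      have h1 := m.riccatiMap_le hα.1.le hP'.posSemidef x (-(m.feedbackGain α P *ᵥ x))
      have h2 := m.riccatiMap_eq hα.1.le hP.posSemidef x
      rw [← show P' = m.riccatiMap α P' from h'] at h1
      rw [← show P = m.riccatiMap α P from h] at h2
      set y := m.A *ᵥ x + m.B *ᵥ (-(m.feedbackGain α P *ᵥ x))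
      have h3 := mul_le_mul_of_nonneg_left (ih y) hα.1.le
      have h4 : α * quadForm P y ≤ (1 - e) * quadForm P x := by
        have := heR x
        have := quadForm_nonneg m.M_posDef.posSemidef (-(m.feedbackGain α P *ᵥ x))
        linarith
      have h5 := mul_le_mul_of_nonneg_left h4
        (mul_nonneg hc (pow_nonneg (sub_nonneg.2 he1) n))
      calc _ ≤ α * (quadForm P' y - quadForm P y) := by linarith
        _ ≤ _ := h3
        _ = c * (1 - e) ^ n * (α * quadForm P y) := by ring
        _ ≤ _ := h5
        _ = _ := by ring
  have hlim : Tendsto (fun n : ℕ => c * (1 - e) ^ n * quadForm P x) atTop (𝓝 0) := by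
    have := ((tendsto_pow_atTop_nhds_zero_of_lt_one (sub_nonneg.2 he1)
      (by linarith : 1 - e < 1)).const_mul c).mul_const (quadForm P x)
    simpa using this
  linarith [ge_of_tendsto' hlim fun n => key n x]

theorem Model.riccati_solution_ext (hα : α ∈ Set.Ioo (0 : ℝ) 1) (hP : P.PosDef)
    (h : m.IsRiccatiSolution α P) (hP' : P'.PosDef) (h' : m.IsRiccatiSolution α P') :
    P' = P :=
  eq_of_quadForm_eq (transpose_eq_of_posSemidef hP'.posSemidef)
    (transpose_eq_of_posSemidef hP.posSemidef) fun x =>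
    le_antisymm (m.riccati_solution_unique hα hP h hP' h' x)
      (m.riccati_solution_unique hα hP' h' hP h x)

theorem Model.errorWeight_eq (hα : 0 ≤ α) (hP : P.PosSemidef) (h : m.IsRiccatiSolution α P) :
    m.errorWeight α P =
      (m.feedbackGain α P)ᵀ * m.controlWeight α P * m.feedbackGain α P := by
  rw [m.feedbackGain_sq hα hP, Model.errorWeight, sub_add_eq_add_sub, sub_eq_iff_eq_add,
    add_comm _ P, ← sub_eq_iff_eq_add]
  exact h.symm

theorem Model.errorWeight_posSemidef (hα : 0 ≤ α) (hP : P.PosSemidef)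
    (h : m.IsRiccatiSolution α P) : (m.errorWeight α P).PosSemidef := by
  rw [m.errorWeight_eq hα hP h]
  exact (m.controlWeight_posDef hα hP).posSemidef.conjTranspose_mul_mul_same _

end Riccati

/-! ### The covariance updates -/

section Covariance

instance instBorelSpaceMatrix {k n : ℕ} : BorelSpace (Matrix (Fin k) (Fin n) ℝ) :=
  inferInstanceAs (BorelSpace (Fin k → Fin n → ℝ))

instance instSecondCountableMatrix {k n : ℕ} :
    SecondCountableTopology (Matrix (Fin k) (Fin n) ℝ) :=
  inferInstanceAs (SecondCountableTopology (Fin k → Fin n → ℝ))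

theorem measurable_matrix_inv {n : ℕ} :
    Measurable fun H : Matrix (Fin n) (Fin n) ℝ => H⁻¹ := by
  have h1 : Measurable fun H : Matrix (Fin n) (Fin n) ℝ => H.det :=
    (Continuous.matrix_det continuous_id).measurable
  have h2 : Measurable fun H : Matrix (Fin n) (Fin n) ℝ => H.adjugate :=
    (Continuous.matrix_adjugate continuous_id).measurable
  have h3 : Measurable fun z : ℝ × Matrix (Fin n) (Fin n) ℝ => z.1 • z.2 :=
    Continuous.measurable (by fun_prop)
  simp only [Matrix.inv_def, Ring.inverse_eq_inv']
  exact h3.comp (h1.inv.prodMk h2)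

theorem measurable_matrix_mul {X : Type*} [MeasurableSpace X] {k l n : ℕ}
    {f : X → Matrix (Fin k) (Fin l) ℝ} {g : X → Matrix (Fin l) (Fin n) ℝ} (hf : Measurable f)
    (hg : Measurable g) : Measurable fun x => f x * g x := by
  have h : Continuous fun z : Matrix (Fin k) (Fin l) ℝ × Matrix (Fin l) (Fin n) ℝ => z.1 * z.2 :=
    continuous_fst.matrix_mul continuous_snd
  exact h.measurable.comp (hf.prodMk hg)

theorem continuousOn_matrix_mul {X : Type*} [TopologicalSpace X] {t : Set X} {k l n : ℕ}
    {f : X → Matrix (Fin k) (Fin l) ℝ} {g : X → Matrix (Fin l) (Fin n) ℝ} (hf : ContinuousOn f t)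
    (hg : ContinuousOn g t) : ContinuousOn (fun x => f x * g x) t := by
  have h : Continuous fun z : Matrix (Fin k) (Fin l) ℝ × Matrix (Fin l) (Fin n) ℝ => z.1 * z.2 :=
    continuous_fst.matrix_mul continuous_snd
  exact h.comp_continuousOn (hf.prodMk hg)

theorem measurable_matrix_sub {X : Type*} [MeasurableSpace X] {k n : ℕ}
    {f g : X → Matrix (Fin k) (Fin n) ℝ} (hf : Measurable f)
    (hg : Measurable g) : Measurable fun x => f x - g x := by
  have h : Continuous fun z : Matrix (Fin k) (Fin n) ℝ × Matrix (Fin k) (Fin n) ℝ => z.1 - z.2 :=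
    continuous_fst.sub continuous_snd
  exact h.measurable.comp (hf.prodMk hg)

theorem convex_psdCone : Convex ℝ (psdCone d) := fun _ hV _ hV' _ _ ha hb _ =>
  (hV.smul ha).add (hV'.smul hb)

theorem isClosed_psdCone : IsClosed (psdCone d) := by
  have h : psdCone d = {V | Vᵀ = V} ∩ ⋂ x, {V | 0 ≤ quadForm V x} := by
    ext V
    simp [psdCone, posSemidef_iff_quadForm]
  rw [h]
  exact (isClosed_eq (by fun_prop) continuous_id).inter (isClosed_iInter fun x =>
    isClosed_le continuous_const (continuous_quadForm_left x))

variable [Fintype S] (m : Model d du dw S Q) {V V' : Matrix (Fin d) (Fin d) ℝ}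

theorem Model.quadForm_Xi (V : Matrix (Fin d) (Fin d) ℝ) (x : Fin d → ℝ) :
    quadForm (m.Xi V) x = (m.Dᵀ *ᵥ x) ⬝ᵥ (m.Dᵀ *ᵥ x) + quadForm V (m.Aᵀ *ᵥ x) := by
  rw [Model.Xi, quadForm_add, quadForm_conj' V, ← quadForm_one (m.Dᵀ *ᵥ x), ← quadForm_conj' 1,
    Matrix.mul_one]

theorem Model.Xi_posSemidef (hV : V.PosSemidef) : (m.Xi V).PosSemidef :=
  (posSemidef_self_mul_conjTranspose m.D).add (hV.mul_mul_conjTranspose_same m.A)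

theorem Model.Xi_mono (h : ∀ x, quadForm V x ≤ quadForm V' x) (x : Fin d → ℝ) :
    quadForm (m.Xi V) x ≤ quadForm (m.Xi V') x := by
  rw [m.quadForm_Xi, m.quadForm_Xi]
  linarith [h (m.Aᵀ *ᵥ x)]

theorem continuous_Xi : Continuous m.Xi := by
  unfold Model.Xi; fun_prop

theorem Model.Xi_combo {a b : ℝ} (hab : a + b = 1) (V V' : Matrix (Fin d) (Fin d) ℝ) :
    m.Xi (a • V + b • V') = a • m.Xi V + b • m.Xi V' := by
  have h : m.D * m.Dᵀ = a • (m.D * m.Dᵀ) + b • (m.D * m.Dᵀ) := by rw [← add_smul, hab, one_smul]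
  unfold Model.Xi
  conv_lhs => rw [h]
  simp only [Matrix.mul_add, Matrix.add_mul, smul_add, Matrix.mul_smul, Matrix.smul_mul]
  abel

/-- Covariance `C Ξ(V) Cᵀ + F Fᵀ` of the innovation. -/
def Model.innovCov (m : Model d du dw S Q) (q : Q) (s : S) (V : Matrix (Fin d) (Fin d) ℝ) :
    Matrix (Fin (m.obsDim q s)) (Fin (m.obsDim q s)) ℝ :=
  m.C q s * m.Xi V * (m.C q s)ᵀ + m.F q s * (m.F q s)ᵀ

theorem Model.innovCov_posDef (q : Q) (s : S) (hV : V.PosSemidef) :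
    (m.innovCov q s V).PosDef :=
  PosDef.posSemidef_add ((m.Xi_posSemidef hV).mul_mul_conjTranspose_same _)
    ((PosSemidef.posDef_iff_det_ne_zero (posSemidef_self_mul_conjTranspose _)).2
      (m.det_F_ne_zero q s))

theorem Model.kalmanGain_mul_innovCov (q : Q) (s : S) (hV : V.PosSemidef) :
    m.kalmanGain q s V * m.innovCov q s V = m.Xi V * (m.C q s)ᵀ :=
  Matrix.nonsing_inv_mul_cancel_right _ _
    ((Matrix.isUnit_iff_isUnit_det _).1 (m.innovCov_posDef q s hV).isUnit)

theorem Model.innovCov_mul_kalmanGain_transpose (q : Q) (s : S) (hV : V.PosSemidef) :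
    m.innovCov q s V * (m.kalmanGain q s V)ᵀ = m.C q s * m.Xi V := by
  have h := congrArg Matrix.transpose (m.kalmanGain_mul_innovCov q s hV)
  rwa [transpose_mul, transpose_mul, transpose_transpose,
    transpose_eq_of_posSemidef (m.innovCov_posDef q s hV).posSemidef,
    transpose_eq_of_posSemidef (m.Xi_posSemidef hV)] at h

theorem Model.covUpdate_eq (q : Q) (s : S) (hV : V.PosSemidef) :
    m.covUpdate q s V =
      m.Xi V - m.kalmanGain q s V * m.innovCov q s V * (m.kalmanGain q s V)ᵀ := by
  rw [Matrix.mul_assoc, m.innovCov_mul_kalmanGain_transpose q s hV, ← Matrix.mul_assoc]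
  rfl

/-- Error covariance after an observation is processed with the gain `L`. -/
def Model.gainCov (m : Model d du dw S Q) (q : Q) (s : S)
    (L : Matrix (Fin d) (Fin (m.obsDim q s)) ℝ) (V : Matrix (Fin d) (Fin d) ℝ) :
    Matrix (Fin d) (Fin d) ℝ :=
  (1 - L * m.C q s) * m.Xi V * (1 - L * m.C q s)ᵀ + L * (m.F q s * (m.F q s)ᵀ) * Lᵀ

/-- Completion of the square in the gain: the Kalman gain minimizes `gainCov` in the Loewner order.
Thus `covUpdate` is a minimum of maps that are affine and monotone in `V`. -/
theorem Model.gainCov_eq (q : Q) (s : S) (L : Matrix (Fin d) (Fin (m.obsDim q s)) ℝ)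
    (hV : V.PosSemidef) :
    m.gainCov q s L V = m.covUpdate q s V +
      (L - m.kalmanGain q s V) * m.innovCov q s V * (L - m.kalmanGain q s V)ᵀ := by
  rw [m.covUpdate_eq q s hV]
  simp only [transpose_sub, Matrix.sub_mul, Matrix.mul_sub]
  rw [m.kalmanGain_mul_innovCov q s hV]
  simp only [Matrix.mul_assoc]
  rw [m.innovCov_mul_kalmanGain_transpose q s hV]
  simp only [Model.gainCov, Model.innovCov, transpose_sub, Matrix.sub_mul, Matrix.mul_sub,
    Matrix.mul_add, Matrix.add_mul, transpose_one, Matrix.one_mul, Matrix.mul_one, transpose_mul,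
    Matrix.mul_assoc]
  abel

theorem Model.covUpdate_le_gainCov (q : Q) (s : S)
    (L : Matrix (Fin d) (Fin (m.obsDim q s)) ℝ) (hV : V.PosSemidef) (x : Fin d → ℝ) :
    quadForm (m.covUpdate q s V) x ≤ quadForm (m.gainCov q s L V) x := by
  rw [m.gainCov_eq q s L hV, quadForm_add, quadForm_conj']
  linarith [quadForm_nonneg (m.innovCov_posDef q s hV).posSemidef
    ((L - m.kalmanGain q s V)ᵀ *ᵥ x)]

theorem Model.gainCov_kalmanGain (q : Q) (s : S) (hV : V.PosSemidef) :
    m.gainCov q s (m.kalmanGain q s V) V = m.covUpdate q s V := by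
  rw [m.gainCov_eq q s _ hV]; simp

theorem Model.quadForm_gainCov (q : Q) (s : S) (L : Matrix (Fin d) (Fin (m.obsDim q s)) ℝ)
    (V : Matrix (Fin d) (Fin d) ℝ) (x : Fin d → ℝ) :
    quadForm (m.gainCov q s L V) x = quadForm (m.Xi V) ((1 - L * m.C q s)ᵀ *ᵥ x) +
      quadForm (m.F q s * (m.F q s)ᵀ) (Lᵀ *ᵥ x) := by
  rw [Model.gainCov, quadForm_add, quadForm_conj', quadForm_conj']

theorem Model.covUpdate_posSemidef (q : Q) (s : S) (hV : V.PosSemidef) :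
    (m.covUpdate q s V).PosSemidef := by
  rw [← m.gainCov_kalmanGain q s hV]
  exact ((m.Xi_posSemidef hV).mul_mul_conjTranspose_same _).add
    ((posSemidef_self_mul_conjTranspose _).mul_mul_conjTranspose_same _)

/-- Use the gain that is optimal for `V'` at `V` as well; for a fixed gain the error covariance is
monotone. -/
theorem Model.covUpdate_mono (q : Q) (s : S) (hV : V.PosSemidef) (hV' : V'.PosSemidef)
    (h : ∀ x, quadForm V x ≤ quadForm V' x) (x : Fin d → ℝ) :
    quadForm (m.covUpdate q s V) x ≤ quadForm (m.covUpdate q s V') x := by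
  refine (m.covUpdate_le_gainCov q s (m.kalmanGain q s V') hV x).trans ?_
  rw [← m.gainCov_kalmanGain q s hV', m.quadForm_gainCov, m.quadForm_gainCov]
  linarith [m.Xi_mono h ((1 - m.kalmanGain q s V' * m.C q s)ᵀ *ᵥ x)]

/-- A minimum of affine maps is concave: freeze the gain that is optimal at the mixture. -/
theorem Model.covUpdate_concave (q : Q) (s : S) (hV : V.PosSemidef) (hV' : V'.PosSemidef)
    {a b : ℝ} (ha : 0 ≤ a) (hb : 0 ≤ b) (hab : a + b = 1) (x : Fin d → ℝ) :
    quadForm (a • m.covUpdate q s V + b • m.covUpdate q s V') x ≤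
      quadForm (m.covUpdate q s (a • V + b • V')) x := by
  set L := m.kalmanGain q s (a • V + b • V') with hL
  have hW : (a • V + b • V').PosSemidef := convex_psdCone hV hV' ha hb hab
  rw [← m.gainCov_kalmanGain q s hW, ← hL, m.quadForm_gainCov, m.Xi_combo hab]
  have h1 := mul_le_mul_of_nonneg_left (m.covUpdate_le_gainCov q s L hV x) ha
  have h2 := mul_le_mul_of_nonneg_left (m.covUpdate_le_gainCov q s L hV' x) hb
  rw [m.quadForm_gainCov] at h1 h2
  simp only [quadForm_add, quadForm_smul]
  set r := quadForm (m.F q s * (m.F q s)ᵀ) (Lᵀ *ᵥ x)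
  have hr : r = a * r + b * r := by rw [← add_mul, hab, one_mul]
  linarith

/-- The gain zero ignores the observation, so an observation can only help. -/
theorem Model.covUpdate_le_Xi (q : Q) (s : S) (hV : V.PosSemidef) (x : Fin d → ℝ) :
    quadForm (m.covUpdate q s V) x ≤ quadForm (m.Xi V) x := by
  refine (m.covUpdate_le_gainCov q s 0 hV x).trans (le_of_eq ?_)
  simp [Model.gainCov]

theorem continuous_innovCov (q : Q) (s : S) : Continuous (m.innovCov q s) := by
  have := continuous_Xi m
  unfold Model.innovCov; fun_prop

theorem Model.measurable_Xi : Measurable m.Xi := (continuous_Xi m).measurable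

theorem Model.kalmanGain_def (q : Q) (s : S) (V : Matrix (Fin d) (Fin d) ℝ) :
    m.kalmanGain q s V = m.Xi V * (m.C q s)ᵀ * (m.innovCov q s V)⁻¹ := rfl

theorem Model.measurable_kalmanGain (q : Q) (s : S) : Measurable (m.kalmanGain q s) := by
  simp only [funext (m.kalmanGain_def q s)]
  exact measurable_matrix_mul (measurable_matrix_mul m.measurable_Xi measurable_const)
    (measurable_matrix_inv.comp (continuous_innovCov m q s).measurable)

theorem Model.continuousOn_kalmanGain (q : Q) (s : S) :
    ContinuousOn (m.kalmanGain q s) (psdCone d) := by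
  have h : ContinuousOn (fun V => (m.innovCov q s V)⁻¹) (psdCone d) := fun V hV =>
    (ContinuousAt.comp (f := m.innovCov q s) (g := fun H => H⁻¹) (continuousAt_matrix_inv
      ((Matrix.isUnit_iff_isUnit_det _).1 (m.innovCov_posDef q s hV).isUnit).ne_zero)
      (continuous_innovCov m q s).continuousAt).continuousWithinAt
  simp only [funext (m.kalmanGain_def q s)]
  exact continuousOn_matrix_mul
    (continuousOn_matrix_mul (continuous_Xi m).continuousOn continuousOn_const) h

theorem Model.measurable_covUpdate (q : Q) (s : S) : Measurable (m.covUpdate q s) :=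
  measurable_matrix_sub m.measurable_Xi (measurable_matrix_mul
    (measurable_matrix_mul (m.measurable_kalmanGain q s) measurable_const) m.measurable_Xi)

theorem Model.continuousOn_covUpdate (q : Q) (s : S) :
    ContinuousOn (m.covUpdate q s) (psdCone d) :=
  (continuous_Xi m).continuousOn.sub (continuousOn_matrix_mul
    (continuousOn_matrix_mul (m.continuousOn_kalmanGain q s) continuousOn_const)
    (continuous_Xi m).continuousOn)

end Covariance

/-! ### The dynamic programming operator -/

section Transition

variable [Fintype S] (m : Model d du dw S Q) {α : ℝ} {P V V' : Matrix (Fin d) (Fin d) ℝ}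
  {f g : S → Matrix (Fin d) (Fin d) ℝ → ℝ}

theorem Model.transition_mono (q : Q) (s : S) (hV : V ∈ psdCone d)
    (h : ∀ s, ∀ V ∈ psdCone d, f s V ≤ g s V) :
    m.transition q f s V ≤ m.transition q g s V :=
  Finset.sum_le_sum fun s' _ => mul_le_mul_of_nonneg_left
    (add_le_add
      (mul_le_mul_of_nonneg_left (h s' _ (m.covUpdate_posSemidef q s hV))
        (sub_nonneg.2 (m.loss_lt_one s q).le))
      (mul_le_mul_of_nonneg_left (h s' _ (m.Xi_posSemidef hV)) (m.loss_nonneg s q)))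
    (m.p_nonneg q s s')

theorem Model.transition_nonneg (q : Q) (s : S) (hV : V ∈ psdCone d)
    (h : ∀ s, ∀ V ∈ psdCone d, 0 ≤ f s V) : 0 ≤ m.transition q f s V := by
  have := m.transition_mono q s hV (f := fun _ _ => 0) h
  simpa [Model.transition] using this

theorem Model.transition_const (q : Q) (s : S) (c : ℝ) :
    m.transition q (fun _ _ => c) s V = c := by
  simp only [Model.transition, ← add_mul, sub_add_cancel, one_mul]
  rw [← Finset.sum_mul, m.p_sum, one_mul]

theorem Model.transition_add (q : Q) (s : S) :
    m.transition q (fun s V => f s V + g s V) s V =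
      m.transition q f s V + m.transition q g s V := by
  simp only [Model.transition, ← Finset.sum_add_distrib]
  exact Finset.sum_congr rfl fun _ _ => by ring

theorem Model.transition_smul (q : Q) (s : S) (c : ℝ) :
    m.transition q (fun s V => c * f s V) s V = c * m.transition q f s V := by
  simp only [Model.transition, Finset.mul_sum]
  exact Finset.sum_congr rfl fun _ _ => by ring

theorem Model.transition_sub (q : Q) (s : S) :
    m.transition q (fun s V => f s V - g s V) s V =
      m.transition q f s V - m.transition q g s V := by
  simp only [Model.transition, ← Finset.sum_sub_distrib]
  exact Finset.sum_congr rfl fun _ _ => by ring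

theorem Model.bellmanTerm_mono (hα : 0 ≤ α) (q : Q) (s : S) (hV : V ∈ psdCone d)
    (h : ∀ s, ∀ V ∈ psdCone d, f s V ≤ g s V) :
    m.bellmanTerm α P f q s V ≤ m.bellmanTerm α P g q s V :=
  add_le_add_right (mul_le_mul_of_nonneg_left (m.transition_mono q s hV h) hα) _

/-- Nonnegativity, monotonicity, concavity and continuity on the cone of positive semidefinite
matrices. -/
structure IsRegularOnCone (f : Matrix (Fin d) (Fin d) ℝ → ℝ) : Prop where
  nonneg : ∀ V ∈ psdCone d, 0 ≤ f V
  mono : ∀ V ∈ psdCone d, ∀ V' ∈ psdCone d, (∀ x, quadForm V x ≤ quadForm V' x) → f V ≤ f V'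
  concave : ConcaveOn ℝ (psdCone d) f
  cont : ContinuousOn f (psdCone d)

theorem isRegularOnCone_const {c : ℝ} (hc : 0 ≤ c) :
    IsRegularOnCone fun _ : Matrix (Fin d) (Fin d) ℝ => c :=
  ⟨fun _ _ => hc, fun _ _ _ _ _ => le_rfl, concaveOn_const _ convex_psdCone,
    continuousOn_const⟩

theorem IsRegularOnCone.add {f g : Matrix (Fin d) (Fin d) ℝ → ℝ} (hf : IsRegularOnCone f)
    (hg : IsRegularOnCone g) : IsRegularOnCone fun V => f V + g V :=
  ⟨fun V hV => add_nonneg (hf.nonneg V hV) (hg.nonneg V hV),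
    fun V hV V' hV' h => add_le_add (hf.mono V hV V' hV' h) (hg.mono V hV V' hV' h),
    hf.concave.add hg.concave, hf.cont.add hg.cont⟩

theorem IsRegularOnCone.const_mul {f : Matrix (Fin d) (Fin d) ℝ → ℝ} (hf : IsRegularOnCone f)
    {c : ℝ} (hc : 0 ≤ c) : IsRegularOnCone fun V => c * f V :=
  ⟨fun V hV => mul_nonneg hc (hf.nonneg V hV),
    fun V hV V' hV' h => mul_le_mul_of_nonneg_left (hf.mono V hV V' hV' h) hc,
    hf.concave.smul hc, hf.cont.const_smul c⟩

theorem isRegularOnCone_sum {ι : Type*} (t : Finset ι)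
    {f : ι → Matrix (Fin d) (Fin d) ℝ → ℝ} (hf : ∀ i, IsRegularOnCone (f i)) :
    IsRegularOnCone fun V => ∑ i ∈ t, f i V := by
  classical
  induction t using Finset.induction_on with
  | empty => simpa using isRegularOnCone_const le_rfl
  | insert i t hi ih => simpa only [Finset.sum_insert hi] using (hf i).add ih

/-- Concavity of the composition with a Loewner-concave map needs the outer function to be monotone
too. This is why `IsRegularOnCone` carries monotonicity along with concavity. -/
theorem IsRegularOnCone.comp {f : Matrix (Fin d) (Fin d) ℝ → ℝ} (hf : IsRegularOnCone f)
    {T : Matrix (Fin d) (Fin d) ℝ → Matrix (Fin d) (Fin d) ℝ}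
    (hT : ∀ V ∈ psdCone d, T V ∈ psdCone d)
    (hmono : ∀ V ∈ psdCone d, ∀ V' ∈ psdCone d, (∀ x, quadForm V x ≤ quadForm V' x) →
      ∀ x, quadForm (T V) x ≤ quadForm (T V') x)
    (hconc : ∀ V ∈ psdCone d, ∀ V' ∈ psdCone d, ∀ a b : ℝ, 0 ≤ a → 0 ≤ b → a + b = 1 →
      ∀ x, quadForm (a • T V + b • T V') x ≤ quadForm (T (a • V + b • V')) x)
    (hcont : ContinuousOn T (psdCone d)) : IsRegularOnCone fun V => f (T V) :=
  ⟨fun V hV => hf.nonneg _ (hT V hV),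
    fun V hV V' hV' h => hf.mono _ (hT V hV) _ (hT V' hV') (hmono V hV V' hV' h),
    ⟨convex_psdCone, fun V hV V' hV' a b ha hb hab =>
      (hf.concave.2 (hT V hV) (hT V' hV') ha hb hab).trans
        (hf.mono _ (convex_psdCone (hT V hV) (hT V' hV') ha hb hab) _
          (hT _ (convex_psdCone hV hV' ha hb hab)) (hconc V hV V' hV' a b ha hb hab))⟩,
    hf.cont.comp hcont hT⟩

theorem isRegularOnCone_inf' {ι : Type*} (t : Finset ι) (ht : t.Nonempty)
    {f : ι → Matrix (Fin d) (Fin d) ℝ → ℝ} (hf : ∀ i, IsRegularOnCone (f i)) :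
    IsRegularOnCone fun V => t.inf' ht fun i => f i V := by
  refine ⟨fun V hV => Finset.le_inf' _ _ fun i _ => (hf i).nonneg V hV,
    fun V hV V' hV' h => Finset.le_inf' _ _ fun i hi =>
      (Finset.inf'_le _ hi).trans ((hf i).mono V hV V' hV' h),
    ⟨convex_psdCone, fun V hV V' hV' a b ha hb hab => Finset.le_inf' _ _ fun i hi =>
      le_trans (add_le_add ?_ ?_) ((hf i).concave.2 hV hV' ha hb hab)⟩,
    fun V hV => ContinuousWithinAt.finset_inf'_apply ht fun i _ => (hf i).cont V hV⟩
  · exact mul_le_mul_of_nonneg_left (Finset.inf'_le (f := fun i => f i V) hi) ha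
  · exact mul_le_mul_of_nonneg_left (Finset.inf'_le (f := fun i => f i V') hi) hb

theorem isRegularOnCone_trace_mul {G : Matrix (Fin d) (Fin d) ℝ} (hG : G.PosSemidef) :
    IsRegularOnCone fun V => (G * V).trace := by
  refine ⟨fun V hV => trace_mul_nonneg hG hV, fun V hV V' hV' h => ?_,
    ⟨convex_psdCone, fun V _ V' _ a b _ _ _ => ?_⟩, Continuous.continuousOn (by fun_prop)⟩
  · rw [Matrix.trace_mul_comm, Matrix.trace_mul_comm G]
    exact trace_mul_le_of_quadForm_le (transpose_eq_of_posSemidef hV)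
      (transpose_eq_of_posSemidef hV') h hG
  · simp [Matrix.mul_add, trace_add, trace_smul]

theorem Model.isRegularOnCone_transition (q : Q) (s : S) (hf : ∀ s, IsRegularOnCone (f s)) :
    IsRegularOnCone fun V => m.transition q f s V := by
  refine isRegularOnCone_sum _ fun s' => IsRegularOnCone.const_mul
    (IsRegularOnCone.add (IsRegularOnCone.const_mul ?_ (sub_nonneg.2 (m.loss_lt_one s q).le))
      (IsRegularOnCone.const_mul ?_ (m.loss_nonneg s q))) (m.p_nonneg q s s')
  · exact (hf s').comp (fun V hV => m.covUpdate_posSemidef q s hV)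
      (fun V hV V' hV' => m.covUpdate_mono q s hV hV')
      (fun V hV V' hV' a b ha hb hab => m.covUpdate_concave q s hV hV' ha hb hab)
      (m.continuousOn_covUpdate q s)
  · exact (hf s').comp (fun V hV => m.Xi_posSemidef hV) (fun V _ V' _ h => m.Xi_mono h)
      (fun V _ V' _ a b _ _ hab x => le_of_eq (by rw [m.Xi_combo hab]))
      (continuous_Xi m).continuousOn

theorem Model.isRegularOnCone_bellmanTerm (hα : 0 ≤ α) (hW : (m.errorWeight α P).PosSemidef)
    (q : Q) (s : S) (hf : ∀ s, IsRegularOnCone (f s)) :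
    IsRegularOnCone fun V => m.bellmanTerm α P f q s V :=
  ((isRegularOnCone_const (m.netCost_nonneg s q)).add (isRegularOnCone_trace_mul hW)).add
    ((m.isRegularOnCone_transition q s hf).const_mul hα)

theorem Model.measurable_transition (q : Q) (s : S) (hf : ∀ s, Measurable (f s)) :
    Measurable fun V => m.transition q f s V :=
  Finset.measurable_sum _ fun s' _ => measurable_const.mul
    ((measurable_const.mul ((hf s').comp (m.measurable_covUpdate q s))).add
      (measurable_const.mul ((hf s').comp m.measurable_Xi)))

theorem Model.measurable_bellmanTerm (q : Q) (s : S) (hf : ∀ s, Measurable (f s)) :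
    Measurable fun V => m.bellmanTerm α P f q s V :=
  (measurable_const.add (Continuous.measurable (by fun_prop))).add
    (measurable_const.mul (m.measurable_transition q s hf))

end Transition

/-! ### Value iteration and measurable minimizers -/

section Iteration

variable [Fintype S] [Fintype Q] [Nonempty Q] (m : Model d du dw S Q) {α : ℝ}
  {P V V' : Matrix (Fin d) (Fin d) ℝ} {f g : S → Matrix (Fin d) (Fin d) ℝ → ℝ}

/-- The minimum over queries in the dynamic programming equation. -/
noncomputable def Model.bellmanMin (m : Model d du dw S Q) (α : ℝ)
    (P : Matrix (Fin d) (Fin d) ℝ) (f : S → Matrix (Fin d) (Fin d) ℝ → ℝ) (s : S)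
    (V : Matrix (Fin d) (Fin d) ℝ) : ℝ :=
  Finset.univ.inf' Finset.univ_nonempty fun q => m.bellmanTerm α P f q s V

theorem Model.bellmanMin_le (q : Q) (s : S) :
    m.bellmanMin α P f s V ≤ m.bellmanTerm α P f q s V :=
  Finset.inf'_le _ (Finset.mem_univ q)

theorem Model.exists_bellmanMin_eq (s : S) (V : Matrix (Fin d) (Fin d) ℝ) :
    ∃ q, m.bellmanMin α P f s V = m.bellmanTerm α P f q s V := by
  obtain ⟨q, -, h⟩ := Finset.exists_mem_eq_inf' (Finset.univ_nonempty (α := Q))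
    fun q => m.bellmanTerm α P f q s V
  exact ⟨q, h⟩

theorem Model.bellmanMin_mono (hα : 0 ≤ α) (s : S) (hV : V ∈ psdCone d)
    (h : ∀ s, ∀ V ∈ psdCone d, f s V ≤ g s V) :
    m.bellmanMin α P f s V ≤ m.bellmanMin α P g s V :=
  Finset.le_inf' _ _ fun q _ => (m.bellmanMin_le q s).trans (m.bellmanTerm_mono hα q s hV h)

/-- Value iteration, started at zero. -/
noncomputable def Model.dpIter (m : Model d du dw S Q) (α : ℝ) (P : Matrix (Fin d) (Fin d) ℝ) :
    ℕ → S → Matrix (Fin d) (Fin d) ℝ → ℝ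
  | 0 => fun _ _ => 0
  | n + 1 => m.bellmanMin α P (m.dpIter α P n)

/-- The limit of value iteration. -/
noncomputable def Model.dpValue (m : Model d du dw S Q) (α : ℝ) (P : Matrix (Fin d) (Fin d) ℝ)
    (s : S) (V : Matrix (Fin d) (Fin d) ℝ) : ℝ :=
  ⨆ n, m.dpIter α P n s V

theorem Model.isRegularOnCone_dpIter (hα : 0 ≤ α) (hW : (m.errorWeight α P).PosSemidef) (n : ℕ)
    (s : S) : IsRegularOnCone (m.dpIter α P n s) := by
  induction n generalizing s with
  | zero => exact isRegularOnCone_const le_rfl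
  | succ n ih =>
    exact isRegularOnCone_inf' _ Finset.univ_nonempty fun q => m.isRegularOnCone_bellmanTerm hα hW q s ih

theorem Model.measurable_dpIter (n : ℕ) (s : S) : Measurable (m.dpIter α P n s) := by
  induction n generalizing s with
  | zero => exact measurable_const
  | succ n ih =>
    have : Measurable (Finset.univ.inf' (Finset.univ_nonempty (α := Q))
        fun q V => m.bellmanTerm α P (m.dpIter α P n) q s V) :=
      Finset.inf'_induction _ _ (fun _ h _ h' => h.inf h')
        fun q _ => m.measurable_bellmanTerm q s ih
    convert this using 1
    ext V
    simp [Model.dpIter, Model.bellmanMin, Finset.inf'_apply]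

/-- Measurability is on the space of all matrices, including those off the cone where the supremum
may be a default value. -/
theorem Model.measurable_dpValue (s : S) : Measurable (m.dpValue α P s) :=
  Measurable.iSup fun n => m.measurable_dpIter n s

theorem Model.dpIter_le_succ (hα : 0 ≤ α) (hW : (m.errorWeight α P).PosSemidef) (n : ℕ) (s : S)
    (V : Matrix (Fin d) (Fin d) ℝ) (hV : V ∈ psdCone d) :
    m.dpIter α P n s V ≤ m.dpIter α P (n + 1) s V := by
  induction n generalizing s V with
  | zero => exact (m.isRegularOnCone_dpIter hα hW 1 s).nonneg V hV
  | succ n ih => exact m.bellmanMin_mono hα s hV ih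

theorem Model.dpIter_le_dpValue
    (hbdd : ∀ s, ∀ V ∈ psdCone d, BddAbove (Set.range fun n => m.dpIter α P n s V))
    (n : ℕ) (s : S) (hV : V ∈ psdCone d) : m.dpIter α P n s V ≤ m.dpValue α P s V :=
  le_ciSup (hbdd s V hV) n

theorem Model.tendsto_dpIter (hα : 0 ≤ α) (hW : (m.errorWeight α P).PosSemidef)
    (hbdd : ∀ s, ∀ V ∈ psdCone d, BddAbove (Set.range fun n => m.dpIter α P n s V))
    (s : S) (hV : V ∈ psdCone d) :
    Tendsto (fun n => m.dpIter α P n s V) atTop (𝓝 (m.dpValue α P s V)) :=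
  tendsto_atTop_ciSup (monotone_nat_of_le_succ fun n => m.dpIter_le_succ hα hW n s V hV)
    (hbdd s V hV)

theorem Model.dpValue_nonneg
    (hbdd : ∀ s, ∀ V ∈ psdCone d, BddAbove (Set.range fun n => m.dpIter α P n s V))
    (s : S) (hV : V ∈ psdCone d) : 0 ≤ m.dpValue α P s V :=
  m.dpIter_le_dpValue hbdd 0 s hV

/-- Transition is a finite sum and the minimum is over finitely many queries, so both commute with
the pointwise limit of the recursion. -/
theorem Model.dpValue_eq_bellmanMin (hα : 0 ≤ α) (hW : (m.errorWeight α P).PosSemidef)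
    (hbdd : ∀ s, ∀ V ∈ psdCone d, BddAbove (Set.range fun n => m.dpIter α P n s V))
    (s : S) (hV : V ∈ psdCone d) :
    m.dpValue α P s V = m.bellmanMin α P (m.dpValue α P) s V := by
  refine tendsto_nhds_unique
    ((tendsto_add_atTop_iff_nat 1).2 (m.tendsto_dpIter hα hW hbdd s hV)) ?_
  refine Tendsto.finset_inf'_nhds_apply _ fun q _ => tendsto_const_nhds.add
    (Tendsto.const_mul _ (tendsto_finsetSum _ fun s' _ => Tendsto.const_mul _
      (Tendsto.add (Tendsto.const_mul _ ?_) (Tendsto.const_mul _ ?_))))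
  · exact m.tendsto_dpIter hα hW hbdd s' (m.covUpdate_posSemidef q s hV)
  · exact m.tendsto_dpIter hα hW hbdd s' (m.Xi_posSemidef hV)

theorem Model.dpValue_isLeast (hα : 0 ≤ α) (hW : (m.errorWeight α P).PosSemidef)
    (hbdd : ∀ s, ∀ V ∈ psdCone d, BddAbove (Set.range fun n => m.dpIter α P n s V))
    (s : S) (hV : V ∈ psdCone d) :
    IsLeast (Set.range fun q => m.bellmanTerm α P (m.dpValue α P) q s V) (m.dpValue α P s V) := by
  rw [m.dpValue_eq_bellmanMin hα hW hbdd s hV]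
  refine ⟨?_, by rintro _ ⟨q, rfl⟩; exact m.bellmanMin_le q s⟩
  obtain ⟨q, hq⟩ := m.exists_bellmanMin_eq (α := α) (P := P) (f := m.dpValue α P) s V
  exact ⟨q, hq.symm⟩

theorem Model.dpValue_concave (hα : 0 ≤ α) (hW : (m.errorWeight α P).PosSemidef)
    (hbdd : ∀ s, ∀ V ∈ psdCone d, BddAbove (Set.range fun n => m.dpIter α P n s V))
    (s : S) : ConcaveOn ℝ (psdCone d) (m.dpValue α P s) := by
  refine ⟨convex_psdCone, fun V hV V' hV' a b ha hb hab => ?_⟩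
  refine le_of_tendsto_of_tendsto'
    (((m.tendsto_dpIter hα hW hbdd s hV).const_smul a).add
      ((m.tendsto_dpIter hα hW hbdd s hV').const_smul b))
    (m.tendsto_dpIter hα hW hbdd s (convex_psdCone hV hV' ha hb hab)) fun n =>
      (m.isRegularOnCone_dpIter hα hW n s).concave.2 hV hV' ha hb hab

theorem Model.dpValue_lsc (hα : 0 ≤ α) (hW : (m.errorWeight α P).PosSemidef)
    (hbdd : ∀ s, ∀ V ∈ psdCone d, BddAbove (Set.range fun n => m.dpIter α P n s V))
    (s : S) : LowerSemicontinuousOn (m.dpValue α P s) (psdCone d) :=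
  lowerSemicontinuousOn_ciSup (hbdd s) fun n =>
    (m.isRegularOnCone_dpIter hα hW n s).cont.lowerSemicontinuousOn

/-- Choose the first minimizer in a fixed enumeration of `Q`; the event that a given index minimizes
is a finite intersection of comparisons of measurable functions. -/
theorem Model.exists_measurable_minSelector [MeasurableSpace S] [MeasurableSingletonClass S]
    [MeasurableSpace Q] (hf : ∀ s, Measurable (f s)) :
    ∃ q, m.IsMinSelector α P f q := by
  classical
  let e := Fintype.equivFin Q
  have hex : ∀ z : S × Matrix (Fin d) (Fin d) ℝ, ∃ n : ℕ, ∃ h : n < Fintype.card Q,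
      ∀ q', m.bellmanTerm α P f (e.symm ⟨n, h⟩) z.1 z.2 ≤ m.bellmanTerm α P f q' z.1 z.2 := by
    intro z
    obtain ⟨q, hq⟩ := m.exists_bellmanMin_eq (α := α) (P := P) (f := f) z.1 z.2
    refine ⟨e q, (e q).2, fun q' => ?_⟩
    rw [Fin.eta, Equiv.symm_apply_apply, ← hq]
    exact m.bellmanMin_le q' z.1
  have hmeas : ∀ q, Measurable fun z : S × Matrix (Fin d) (Fin d) ℝ =>
      m.bellmanTerm α P f q z.1 z.2 := fun q =>
    measurable_from_prod_countable_right fun s => m.measurable_bellmanTerm q s hf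
  have hfind : Measurable fun z => Nat.find (hex z) := by
    refine measurable_find hex fun n => ?_
    by_cases hn : n < Fintype.card Q
    · simp only [hn, exists_true_left, Set.ofPred_forall]
      exact MeasurableSet.iInter fun q' => measurableSet_le (hmeas _) (hmeas q')
    · simp [hn]
  -- A filler for indices outside the enumeration; `Nat.find` never returns such an index.
  let q₀ : Q := Classical.arbitrary Q
  let φ : ℕ → Q := fun n => if h : n < Fintype.card Q then e.symm ⟨n, h⟩ else q₀
  refine ⟨fun z => φ (Nat.find (hex z)), (measurable_from_top (f := φ)).comp hfind, fun s V _ q' => ?_⟩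
  obtain ⟨h, hmin⟩ := Nat.find_spec (hex (s, V))
  simp only [φ, h, dif_pos]
  exact hmin q'

end Iteration

/-! ### Linear growth and uniqueness -/

section Growth

theorem quadForm_single {n : ℕ} (V : Matrix (Fin n) (Fin n) ℝ) (i : Fin n) :
    quadForm V (Pi.single i 1) = V i i := by
  simp [quadForm]

/-- Testing `V` on the sum and the difference of two basis vectors bounds `|V i j|` by the mean of
two diagonal entries. -/
theorem abs_entry_le_trace {n : ℕ} {V : Matrix (Fin n) (Fin n) ℝ} (hV : V.PosSemidef)
    (i j : Fin n) : |V i j| ≤ V.trace := by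
  have hVt := transpose_eq_of_posSemidef hV
  have hdiag : ∀ k, 0 ≤ V k k := fun k => hV.diag_nonneg
  have hle : ∀ k, V k k ≤ V.trace := fun k =>
    Finset.single_le_sum (f := fun k => V k k) (fun k _ => hdiag k) (Finset.mem_univ k)
  have h1 := quadForm_nonneg hV (Pi.single j 1 + Pi.single i 1)
  have h2 := quadForm_nonneg hV (Pi.single j 1 + -Pi.single i 1)
  rw [quadForm_add_vec hVt, quadForm_single, quadForm_single] at h1
  rw [quadForm_add_vec hVt, quadForm_neg_vec, quadForm_single, quadForm_single] at h2
  simp only [mulVec_single, MulOpposite.op_one, one_smul, neg_dotProduct, single_dotProduct,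
    one_mul, col_apply] at h1 h2
  rw [abs_le]
  constructor <;> linarith [hle i, hle j]

theorem isCompact_psdCone_trace_le (n : ℕ) :
    IsCompact {V : Matrix (Fin n) (Fin n) ℝ | V ∈ psdCone n ∧ V.trace ≤ 1} := by
  have hcl : IsClosed {V : Matrix (Fin n) (Fin n) ℝ | V ∈ psdCone n ∧ V.trace ≤ 1} :=
    isClosed_psdCone.inter (isClosed_le (Continuous.matrix_trace continuous_id) continuous_const)
  have hbox : IsCompact (Set.univ.pi fun _ : Fin n => Set.univ.pi fun _ : Fin n =>
      Set.Icc (-1 : ℝ) 1) :=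
    isCompact_univ_pi fun _ => isCompact_univ_pi fun _ => isCompact_Icc
  refine IsCompact.of_isClosed_subset hbox hcl fun V hV i _ j _ => ?_
  exact abs_le.1 ((abs_entry_le_trace hV.1 i j).trans hV.2)

/-- A nonnegative concave function on the cone of positive semidefinite matrices which is locally
bounded has at most linear growth. -/
theorem exists_linear_growth {f : Matrix (Fin d) (Fin d) ℝ → ℝ}
    (hpos : ∀ V ∈ psdCone d, 0 ≤ f V) (hconc : ConcaveOn ℝ (psdCone d) f)
    (hloc : ∀ V ∈ psdCone d, ∃ c, ∀ᶠ V' in 𝓝[psdCone d] V, f V' ≤ c) :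
    ∃ κ : ℝ, 0 ≤ κ ∧ ∀ V ∈ psdCone d, f V ≤ κ * (1 + V.trace) := by
  obtain ⟨c, hc⟩ : ∃ c, ∀ V ∈ {V : Matrix (Fin d) (Fin d) ℝ | V ∈ psdCone d ∧ V.trace ≤ 1},
      f V ≤ c := by
    refine (isCompact_psdCone_trace_le d).induction_on
      (p := fun s => ∃ c, ∀ V ∈ s, f V ≤ c) ⟨0, by simp⟩
      (fun s t hst ⟨c, hc⟩ => ⟨c, fun V hV => hc V (hst hV)⟩)
      (fun s t ⟨c, hc⟩ ⟨c', hc'⟩ => ⟨max c c', fun V hV => hV.elim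
        (fun h => (hc V h).trans (le_max_left _ _))
        fun h => (hc' V h).trans (le_max_right _ _)⟩) fun V hV => ?_
    obtain ⟨c, hc⟩ := hloc V hV.1
    exact ⟨_, nhdsWithin_mono V (fun _ h => h.1) hc, c, fun V' hV' => hV'⟩
  have h0 : (0 : Matrix (Fin d) (Fin d) ℝ) ∈ psdCone d := PosSemidef.zero
  have hc0 : 0 ≤ c := (hpos 0 h0).trans (hc 0 ⟨h0, by simp⟩)
  refine ⟨c, hc0, fun V hV => ?_⟩
  have htr : 0 ≤ V.trace := PosSemidef.trace_nonneg hV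
  rcases le_total V.trace 1 with h | h
  · nlinarith [hc V ⟨hV, h⟩]
  -- The normalized matrix `V / tr V` lies in the compact slice and is a convex combination of `V`
  -- and `0`. Concavity and `f 0 ≥ 0` give `f V / tr V ≤ c`.
  · have hτ : 0 < V.trace := by linarith
    have hi : V.trace⁻¹ ≤ 1 := inv_le_one_of_one_le₀ h
    have h1 := hconc.2 hV h0 (inv_nonneg.2 htr) (sub_nonneg.2 hi) (by ring)
    rw [smul_zero, add_zero, smul_eq_mul, smul_eq_mul] at h1
    have h2 := hc (V.trace⁻¹ • V) ⟨hV.smul (inv_nonneg.2 htr), by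
      rw [trace_smul, smul_eq_mul, inv_mul_cancel₀ hτ.ne']⟩
    have h3 := mul_nonneg (sub_nonneg.2 hi) (hpos 0 h0)
    have h4 : V.trace⁻¹ * f V ≤ c := by linarith
    rw [inv_mul_le_iff₀ hτ] at h4
    linarith

theorem exists_trace_le {G : Matrix (Fin d) (Fin d) ℝ} (hG : G.PosDef) :
    ∃ c : ℝ, 0 < c ∧ ∀ V ∈ psdCone d, c * V.trace ≤ (G * V).trace := by
  obtain ⟨c, hc, h⟩ := exists_le_quadForm hG
  refine ⟨c, hc, fun V hV => ?_⟩
  have := trace_mul_le_of_quadForm_le (G := c • (1 : Matrix (Fin d) (Fin d) ℝ)) (G' := G)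
    (by simp) (transpose_eq_of_posSemidef hG.posSemidef)
    (fun x => by rw [quadForm_smul, quadForm_one]; exact h x) hV
  simpa [trace_smul] using this

theorem exists_trace_mul_le (G : Matrix (Fin d) (Fin d) ℝ) (hG : Gᵀ = G) :
    ∃ c : ℝ, 0 ≤ c ∧ ∀ V ∈ psdCone d, (G * V).trace ≤ c * V.trace := by
  obtain ⟨c, hc, h⟩ := exists_quadForm_le G
  refine ⟨c, hc, fun V hV => ?_⟩
  have := trace_mul_le_of_quadForm_le (G := G) (G' := c • (1 : Matrix (Fin d) (Fin d) ℝ))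
    hG (by simp) (fun x => by rw [quadForm_smul, quadForm_one]; exact h x) hV
  simpa [trace_smul] using this

end Growth

section Uniqueness

variable [Fintype S] (m : Model d du dw S Q) {α : ℝ} {P : Matrix (Fin d) (Fin d) ℝ}
  {f g : S → Matrix (Fin d) (Fin d) ℝ → ℝ}

/-- The value `tr(P V) + α / (1 - α) tr(P D Dᵀ) + f(s, V)` of the problem with zero initial
mean. -/
noncomputable def Model.centeredValue (m : Model d du dw S Q) (α : ℝ)
    (P : Matrix (Fin d) (Fin d) ℝ) (f : S → Matrix (Fin d) (Fin d) ℝ → ℝ) (s : S)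
    (V : Matrix (Fin d) (Fin d) ℝ) : ℝ :=
  (P * V).trace + (α / (1 - α) * (P * (m.D * m.Dᵀ)).trace + f s V)

theorem Model.trace_mul_Xi (P V : Matrix (Fin d) (Fin d) ℝ) :
    (P * m.Xi V).trace = (P * (m.D * m.Dᵀ)).trace + (m.Aᵀ * P * m.A * V).trace := by
  rw [Model.Xi, Matrix.mul_add, trace_add, ← Matrix.mul_assoc P (m.A * V) m.Aᵀ,
    Matrix.trace_mul_comm (P * (m.A * V))]
  simp only [Matrix.mul_assoc]

/-- Drift estimate behind uniqueness. The equation for `f` at a minimizing query cancels all terms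
in `P`, and the constant absorbs the new noise `α tr(P D Dᵀ)`. The network cost and the gain from
observing, `covUpdate ≤ Xi`, only help, so the discounted value falls by at least `tr(R V)`. -/
theorem Model.transition_centeredValue_le (hα : α ∈ Set.Ioo (0 : ℝ) 1) (hP : P.PosSemidef)
    {q : Q} {s : S} {V : Matrix (Fin d) (Fin d) ℝ} (hV : V ∈ psdCone d)
    (hq : m.bellmanTerm α P f q s V = f s V) :
    α * m.transition q (m.centeredValue α P f) s V ≤
      m.centeredValue α P f s V - (m.R * V).trace := by
  have h1 : m.transition q (fun _ V => (P * V).trace) s V ≤ (P * m.Xi V).trace := by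
    have hle : (P * m.covUpdate q s V).trace ≤ (P * m.Xi V).trace :=
      (isRegularOnCone_trace_mul hP).mono _ (m.covUpdate_posSemidef q s hV) _
        (m.Xi_posSemidef hV) (m.covUpdate_le_Xi q s hV)
    calc _ ≤ ∑ s', m.p q s s' * (P * m.Xi V).trace :=
          Finset.sum_le_sum fun s' _ => mul_le_mul_of_nonneg_left
            (by nlinarith [m.loss_lt_one s q]) (m.p_nonneg q s s')
      _ = _ := by rw [← Finset.sum_mul, m.p_sum, one_mul]
  have h2 : m.transition q (m.centeredValue α P f) s V =
      m.transition q (fun _ V => (P * V).trace) s V +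
        (α / (1 - α) * (P * (m.D * m.Dᵀ)).trace + m.transition q f s V) := by
    rw [show m.centeredValue α P f = fun s V => (P * V).trace +
      (α / (1 - α) * (P * (m.D * m.Dᵀ)).trace + f s V) from rfl, m.transition_add q s
      (f := fun _ V => (P * V).trace), m.transition_add q s
      (f := fun _ _ => α / (1 - α) * (P * (m.D * m.Dᵀ)).trace), m.transition_const]
  have h3 : (m.errorWeight α P * V).trace =
      (m.R * V).trace - (P * V).trace + α * (m.Aᵀ * P * m.A * V).trace := by
    simp [Model.errorWeight, Matrix.add_mul, Matrix.sub_mul, trace_add, trace_sub]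
  have h4 : α * (P * (m.D * m.Dᵀ)).trace + α * (α / (1 - α) * (P * (m.D * m.Dᵀ)).trace) =
      α / (1 - α) * (P * (m.D * m.Dᵀ)).trace := by
    have : 1 - α ≠ 0 := by linarith [hα.2]
    field_simp
    ring
  rw [m.trace_mul_Xi] at h1
  have h5 := mul_le_mul_of_nonneg_left h1 hα.1.le
  have h6 := m.netCost_nonneg s q
  rw [Model.bellmanTerm, h3] at hq
  rw [h2, Model.centeredValue]
  linarith

/-- Along queries minimizing for `f`, the difference `g - f` is at most its discounted transition.
Linear growth by itself does not beat the discount, since `A` may be unstable; measured against the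
Lyapunov function `Φ`, however, the discounted transition contracts by `1 - e`, and iteration gives
`g - f ≤ 0`. -/
theorem Model.le_of_isDPSolution (hα : α ∈ Set.Ioo (0 : ℝ) 1) (hP : P.PosDef)
    (hf : m.IsDPSolution α P f) (hg : m.IsDPSolution α P g) (s : S)
    {V : Matrix (Fin d) (Fin d) ℝ} (hV : V ∈ psdCone d) : g s V ≤ f s V := by
  obtain ⟨κ, hκ⟩ := hf.growth
  obtain ⟨κ', hκ'⟩ := hg.growth
  obtain ⟨a, ha, haP⟩ := exists_trace_mul_le P (transpose_eq_of_posSemidef hP.posSemidef)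
  obtain ⟨b, hb, hbP⟩ := exists_trace_le hP
  obtain ⟨r, hr, hrR⟩ := exists_trace_le m.R_posDef
  set c₀ := α / (1 - α) * (P * (m.D * m.Dᵀ)).trace with hc₀
  have h1α : 0 < 1 - α := sub_pos.2 hα.2
  have hc₀0 : 0 ≤ c₀ := mul_nonneg (div_nonneg hα.1.le h1α.le)
    (trace_mul_nonneg hP.posSemidef (posSemidef_self_mul_conjTranspose m.D))
  have htr : ∀ V ∈ psdCone d, 0 ≤ V.trace := fun V hV => PosSemidef.trace_nonneg hV
  -- the Lyapunov function `Φ`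
  set Φ : S → Matrix (Fin d) (Fin d) ℝ → ℝ := fun s V => 1 + m.centeredValue α P f s V with hΦ
  -- The summands account for the shift by one, the bound on `tr(P V)`, the noise constant and the
  -- growth of `f`.
  set k := 1 + a + c₀ + |κ| with hk
  have hk0 : 0 < k := by positivity
  have hΦle : ∀ s, ∀ V ∈ psdCone d, Φ s V ≤ k * (1 + V.trace) := by
    intro s V hV
    have h1 := htr V hV
    have h2 := mul_le_mul_of_nonneg_right (le_abs_self κ) (by linarith : 0 ≤ 1 + V.trace)
    have h3 := haP V hV
    have h4 := hκ s V hV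
    have h5 := mul_nonneg hc₀0 h1
    simp only [hΦ, Model.centeredValue, ← hc₀, hk]
    linarith
  have hΦge : ∀ s, ∀ V ∈ psdCone d, 1 + b * V.trace ≤ Φ s V := by
    intro s V hV
    have h3 := hbP V hV
    have h4 := hf.nonneg s V hV
    simp only [hΦ, Model.centeredValue, ← hc₀]
    linarith
  -- The drift of `Φ` is at least `(1 - α) + r tr V`: the first part comes from discounting the
  -- constant one, the second from `tr(R V)`. Dividing by `k` turns it into a fraction of `Φ`.
  set e := min r (1 - α) / k with he
  have hmin : 0 < min r (1 - α) := lt_min hr h1α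
  have he0 : 0 < e := div_pos hmin hk0
  have he1 : e ≤ 1 := by
    rw [he, div_le_one hk0]
    have h1 : min r (1 - α) ≤ 1 - α := min_le_right _ _
    have h2 := hα.1
    have h3 := abs_nonneg κ
    linarith
  have hstep : ∀ s, ∀ V ∈ psdCone d, ∀ q, m.bellmanTerm α P f q s V = f s V →
      α * m.transition q Φ s V ≤ (1 - e) * Φ s V := by
    intro s V hV q hq
    have h1 := m.transition_centeredValue_le hα hP.posSemidef hV hq
    have h2 : m.transition q Φ s V = 1 + m.transition q (m.centeredValue α P f) s V := by
      rw [hΦ, m.transition_add q s (f := fun _ _ => 1), m.transition_const]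
    have h3 : e * Φ s V ≤ min r (1 - α) * (1 + V.trace) := by
      have := mul_le_mul_of_nonneg_left (hΦle s V hV) he0.le
      rwa [← mul_assoc, he, div_mul_cancel₀ _ hk0.ne'] at this
    have h4 : min r (1 - α) * (1 + V.trace) ≤ (1 - α) + r * V.trace := by
      have := mul_le_mul_of_nonneg_right (min_le_left r (1 - α)) (htr V hV)
      have := min_le_right r (1 - α)
      linarith
    have h5 := hrR V hV
    have h6 : Φ s V = 1 + m.centeredValue α P f s V := rfl
    rw [h2]
    linarith
  -- This converts the linear growth of `g` into a multiple of `Φ`, using `Φ ≥ 1 + b tr V`; it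
  -- starts the induction.
  set C := |κ'| * (1 + b⁻¹) with hC
  have hC0 : 0 ≤ C := by positivity
  have key : ∀ n : ℕ, ∀ s, ∀ V ∈ psdCone d, g s V - f s V ≤ C * (1 - e) ^ n * Φ s V := by
    intro n
    induction n with
    | zero =>
      intro s V hV
      have h1 := hκ' s V hV
      have h2 := mul_le_mul_of_nonneg_right (le_abs_self κ')
        (by linarith [htr V hV] : 0 ≤ 1 + V.trace)
      have h3 := mul_le_mul_of_nonneg_left (hΦge s V hV) hC0
      have h4 : (1 + V.trace) ≤ (1 + b⁻¹) * (1 + b * V.trace) := by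
        have : b⁻¹ * (b * V.trace) = V.trace := inv_mul_cancel_left₀ hb.ne' _
        have h5 : 0 ≤ b * V.trace := mul_nonneg hb.le (htr V hV)
        have h6 : 0 ≤ b⁻¹ := (inv_pos.2 hb).le
        linarith
      have h5 := mul_le_mul_of_nonneg_left h4 (abs_nonneg κ')
      rw [← mul_assoc, ← hC] at h5
      have h6 := hf.nonneg s V hV
      rw [pow_zero, mul_one]
      linarith
    | succ n ih =>
      intro s V hV
      obtain ⟨q, hq⟩ := (hf.equation s V hV).1
      have h1 := (hg.equation s V hV).2 ⟨q, rfl⟩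
      have h2 := m.transition_mono q s hV
        (f := fun s V => g s V - f s V) (g := fun s V => C * (1 - e) ^ n * Φ s V) ih
      rw [m.transition_sub, m.transition_smul] at h2
      have h3 := mul_le_mul_of_nonneg_left (hstep s V hV q hq)
        (mul_nonneg hC0 (pow_nonneg (sub_nonneg.2 he1) n))
      have h4 := mul_le_mul_of_nonneg_left h2 hα.1.le
      simp only [Model.bellmanTerm] at h1 hq
      calc g s V - f s V ≤ α * (m.transition q g s V - m.transition q f s V) := by linarith
        _ ≤ _ := h4
        _ = C * (1 - e) ^ n * (α * m.transition q Φ s V) := by ring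
        _ ≤ _ := h3
        _ = _ := by ring
  have hlim : Tendsto (fun n : ℕ => C * (1 - e) ^ n * Φ s V) atTop (𝓝 0) := by
    have := ((tendsto_pow_atTop_nhds_zero_of_lt_one (sub_nonneg.2 he1)
      (by linarith : 1 - e < 1)).const_mul C).mul_const (Φ s V)
    simpa using this
  linarith [ge_of_tendsto' hlim fun n => key n s V hV]

end Uniqueness

/-! ### Gaussian laws -/

section Gaussian

variable {n k l : ℕ}

theorem noiseLaw_eq : noiseLaw n = initialPlantLaw 0 1 := by
  unfold noiseLaw initialPlantLaw
  rw [WithLp.toLp_zero, multivariateGaussian_zero_one, ← map_pi_eq_stdGaussian,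
    Measure.map_map (by fun_prop) (by fun_prop)]
  exact Measure.map_id.symm

/-- Splitting off the mean as a translation leaves a centred law that depends on the covariance
only. Measurability of the conditional law and the measurement update both rest on this. -/
theorem initialPlantLaw_eq_map (x : Fin n → ℝ) (V : Matrix (Fin n) (Fin n) ℝ) :
    initialPlantLaw x V = (initialPlantLaw 0 V).map (fun e => x + e) := by
  unfold initialPlantLaw multivariateGaussian
  rw [Measure.map_map (by fun_prop) (by fun_prop), Measure.map_map (by fun_prop) (by fun_prop),
    Measure.map_map (by fun_prop) (by fun_prop)]
  congr 1
  ext y i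
  simp

theorem integral_exp_initialPlantLaw (x : Fin n → ℝ) {V : Matrix (Fin n) (Fin n) ℝ}
    (hV : V.PosSemidef) (ξ : Fin n → ℝ) :
    ∫ y, Complex.exp (((ξ ⬝ᵥ y : ℝ) : ℂ) * Complex.I) ∂(initialPlantLaw x V) =
      Complex.exp (((ξ ⬝ᵥ x : ℝ) : ℂ) * Complex.I - ((quadForm V ξ : ℝ) : ℂ) / 2) := by
  have h := charFun_multivariateGaussian (μ := WithLp.toLp 2 x) hV (WithLp.toLp 2 ξ)
  rw [charFun_apply] at h
  unfold initialPlantLaw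
  rw [integral_map (by fun_prop) (Continuous.aestronglyMeasurable (by fun_prop))]
  have h1 : ∀ y : EuclideanSpace ℝ (Fin n), inner ℝ y (WithLp.toLp 2 ξ) = ξ ⬝ᵥ WithLp.ofLp y :=
    fun y => rfl
  have h2 : inner ℝ (WithLp.toLp 2 ξ) (WithLp.toLp 2 x) = ξ ⬝ᵥ x := by
    rw [real_inner_comm]; rfl
  simp only [h1, h2] at h
  exact h

theorem integral_exp_noiseLaw (ξ : Fin n → ℝ) :
    ∫ y, Complex.exp (((ξ ⬝ᵥ y : ℝ) : ℂ) * Complex.I) ∂(noiseLaw n) =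
      Complex.exp (-((ξ ⬝ᵥ ξ : ℝ) : ℂ) / 2) := by
  rw [noiseLaw_eq, integral_exp_initialPlantLaw 0 PosSemidef.one, quadForm_one]
  simp [neg_div]

theorem integral_exp_prod {X Y : Type*} [MeasurableSpace X] [MeasurableSpace Y] (μ : Measure X)
    (ν : Measure Y) [SFinite μ] [SFinite ν] (f : X → ℝ) (g : Y → ℝ) :
    ∫ z, Complex.exp (((f z.1 + g z.2 : ℝ) : ℂ) * Complex.I) ∂(μ.prod ν) =
      (∫ x, Complex.exp ((f x : ℂ) * Complex.I) ∂μ) *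
        ∫ y, Complex.exp ((g y : ℂ) * Complex.I) ∂ν := by
  rw [← integral_prod_mul]
  simp only [Complex.ofReal_add, add_mul, Complex.exp_add]

theorem dual_eq_dotProduct (L : StrongDual ℝ (Fin n → ℝ)) :
    ∃ ξ : Fin n → ℝ, ∀ x, L x = ξ ⬝ᵥ x := by
  refine ⟨fun i => L (Pi.single i 1), fun x => ?_⟩
  conv_lhs => rw [pi_eq_sum_univ' x]
  rw [map_sum]
  refine Finset.sum_congr rfl fun i _ => ?_
  rw [map_smul, smul_eq_mul, mul_comm]

theorem measure_ext_of_exp {μ ν : Measure (Fin n → ℝ)} [IsFiniteMeasure μ] [IsFiniteMeasure ν]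
    (h : ∀ ξ : Fin n → ℝ, ∫ y, Complex.exp (((ξ ⬝ᵥ y : ℝ) : ℂ) * Complex.I) ∂μ =
      ∫ y, Complex.exp (((ξ ⬝ᵥ y : ℝ) : ℂ) * Complex.I) ∂ν) : μ = ν := by
  refine Measure.ext_of_charFunDual ?_
  ext L
  obtain ⟨ξ, hξ⟩ := dual_eq_dotProduct L
  simp only [charFunDual_apply, hξ]
  exact h ξ

theorem measure_ext_of_exp_prod {μ ν : Measure ((Fin k → ℝ) × (Fin n → ℝ) × (Fin l → ℝ))}
    [IsFiniteMeasure μ] [IsFiniteMeasure ν]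
    (h : ∀ (a : Fin k → ℝ) (b : Fin n → ℝ) (c : Fin l → ℝ),
      ∫ y, Complex.exp (((a ⬝ᵥ y.1 + (b ⬝ᵥ y.2.1 + c ⬝ᵥ y.2.2) : ℝ) : ℂ) * Complex.I) ∂μ =
      ∫ y, Complex.exp (((a ⬝ᵥ y.1 + (b ⬝ᵥ y.2.1 + c ⬝ᵥ y.2.2) : ℝ) : ℂ) * Complex.I) ∂ν) :
    μ = ν := by
  refine Measure.ext_of_charFunDual ?_
  ext L
  obtain ⟨a, ha⟩ := dual_eq_dotProduct (L.comp (ContinuousLinearMap.inl ℝ _ _))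
  obtain ⟨b, hb⟩ := dual_eq_dotProduct
    (L.comp ((ContinuousLinearMap.inr ℝ _ _).comp (ContinuousLinearMap.inl ℝ _ _)))
  obtain ⟨c, hc⟩ := dual_eq_dotProduct
    (L.comp ((ContinuousLinearMap.inr ℝ _ _).comp (ContinuousLinearMap.inr ℝ _ _)))
  have hL : ∀ y, L y = a ⬝ᵥ y.1 + (b ⬝ᵥ y.2.1 + c ⬝ᵥ y.2.2) := by
    intro y
    rw [← ha, ← hb, ← hc]
    simp only [ContinuousLinearMap.comp_apply, ← map_add, ContinuousLinearMap.inl_apply,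
      ContinuousLinearMap.inr_apply]
    congr 1
    simp
  simp only [charFunDual_apply, hL]
  exact h a b c

/-- Time update: the law of `A X + b + D W` for independent `X ∼ N(x, V)` and `W ∼ N(0, I)`. -/
theorem map_prediction (A : Matrix (Fin k) (Fin n) ℝ) (D : Matrix (Fin k) (Fin l) ℝ)
    (b : Fin k → ℝ) (x : Fin n → ℝ) {V : Matrix (Fin n) (Fin n) ℝ} (hV : V.PosSemidef) :
    ((initialPlantLaw x V).prod (noiseLaw l)).map (fun z => A *ᵥ z.1 + b + D *ᵥ z.2) =
      initialPlantLaw (A *ᵥ x + b) (D * Dᵀ + A * V * Aᵀ) := by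
  have hm : Measurable fun z : (Fin n → ℝ) × (Fin l → ℝ) => A *ᵥ z.1 + b + D *ᵥ z.2 :=
    Continuous.measurable (by fun_prop)
  have : IsProbabilityMeasure (((initialPlantLaw x V).prod (noiseLaw l)).map
    fun z => A *ᵥ z.1 + b + D *ᵥ z.2) := Measure.isProbabilityMeasure_map hm.aemeasurable
  refine measure_ext_of_exp fun ξ => ?_
  have hS : (D * Dᵀ + A * V * Aᵀ).PosSemidef := (posSemidef_self_mul_conjTranspose D).add
    (hV.mul_mul_conjTranspose_same A)
  rw [integral_map hm.aemeasurable (Continuous.aestronglyMeasurable (by fun_prop)),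
    integral_exp_initialPlantLaw _ hS]
  have h1 : ∀ z : (Fin n → ℝ) × (Fin l → ℝ), ξ ⬝ᵥ (A *ᵥ z.1 + b + D *ᵥ z.2) =
      ((Aᵀ *ᵥ ξ) ⬝ᵥ z.1 + ξ ⬝ᵥ b) + (Dᵀ *ᵥ ξ) ⬝ᵥ z.2 := fun z => by
    rw [dotProduct_add, dotProduct_add, dotProduct_mulVec_transpose, dotProduct_mulVec_transpose]
  simp only [h1]
  rw [integral_exp_prod _ _ (fun x => (Aᵀ *ᵥ ξ) ⬝ᵥ x + ξ ⬝ᵥ b)]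
  simp only [Complex.ofReal_add, add_mul, Complex.exp_add]
  rw [integral_mul_const, integral_exp_initialPlantLaw x hV, integral_exp_noiseLaw,
    ← Complex.exp_add, ← Complex.exp_add]
  have h2 : quadForm (D * Dᵀ + A * V * Aᵀ) ξ =
      (Dᵀ *ᵥ ξ) ⬝ᵥ (Dᵀ *ᵥ ξ) + quadForm V (Aᵀ *ᵥ ξ) := by
    rw [quadForm_add, quadForm_conj' V, ← quadForm_one (Dᵀ *ᵥ ξ), ← quadForm_conj' 1,
      Matrix.mul_one]
  rw [h2, dotProduct_add, dotProduct_mulVec_transpose A]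
  congr 1
  push_cast
  ring

/-- Measurement update: conditionally on the observation `Y = C X + F W`, the state `X` is
Gaussian with the mean and covariance of the Kalman filter, and independent of `D W`. -/
theorem map_filtering (C : Matrix (Fin k) (Fin n) ℝ) (F : Matrix (Fin k) (Fin l) ℝ)
    (D : Matrix (Fin n) (Fin l) ℝ) (hDF : D * Fᵀ = 0) (x : Fin n → ℝ)
    {X : Matrix (Fin n) (Fin n) ℝ} (hX : X.PosSemidef) (K : Matrix (Fin n) (Fin k) ℝ)
    (hK : K * (C * X * Cᵀ + F * Fᵀ) = X * Cᵀ)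
    (hT : (X - K * (C * X * Cᵀ + F * Fᵀ) * Kᵀ).PosSemidef) :
    ((initialPlantLaw x X).prod (noiseLaw l)).map
        (fun z => (C *ᵥ z.1 + F *ᵥ z.2, z.1, D *ᵥ z.2)) =
      (((initialPlantLaw x X).prod (noiseLaw l)).prod
        ((initialPlantLaw 0 (X - K * (C * X * Cᵀ + F * Fᵀ) * Kᵀ)).prod (noiseLaw l))).map
        (fun z => (C *ᵥ z.1.1 + F *ᵥ z.1.2,
          x + K *ᵥ (C *ᵥ z.1.1 + F *ᵥ z.1.2 - C *ᵥ x) + z.2.1, D *ᵥ z.2.2)) := by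
  have hm1 : Measurable fun z : (Fin n → ℝ) × (Fin l → ℝ) =>
      (C *ᵥ z.1 + F *ᵥ z.2, z.1, D *ᵥ z.2) := Continuous.measurable (by fun_prop)
  have hm2 : Measurable fun z : ((Fin n → ℝ) × (Fin l → ℝ)) × (Fin n → ℝ) × (Fin l → ℝ) =>
      (C *ᵥ z.1.1 + F *ᵥ z.1.2,
          x + K *ᵥ (C *ᵥ z.1.1 + F *ᵥ z.1.2 - C *ᵥ x) + z.2.1, D *ᵥ z.2.2) :=
    Continuous.measurable (by fun_prop)
  have := Measure.isProbabilityMeasure_map (μ := (initialPlantLaw x X).prod (noiseLaw l))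
    hm1.aemeasurable
  have := Measure.isProbabilityMeasure_map (μ := ((initialPlantLaw x X).prod (noiseLaw l)).prod
    ((initialPlantLaw 0 (X - K * (C * X * Cᵀ + F * Fᵀ) * Kᵀ)).prod (noiseLaw l)))
    hm2.aemeasurable
  refine measure_ext_of_exp_prod fun a b c => ?_
  rw [integral_map hm1.aemeasurable (Continuous.aestronglyMeasurable (by fun_prop)),
    integral_map hm2.aemeasurable (Continuous.aestronglyMeasurable (by fun_prop))]
  -- The observation on the right-hand side is tested by `a` directly and by `b` through the gain;
  -- `ξ` is the combined frequency.
  set ξ := a + Kᵀ *ᵥ b with hξ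
  have h1 : ∀ z : (Fin n → ℝ) × (Fin l → ℝ),
      a ⬝ᵥ (C *ᵥ z.1 + F *ᵥ z.2) + (b ⬝ᵥ z.1 + c ⬝ᵥ (D *ᵥ z.2)) =
        (Cᵀ *ᵥ a + b) ⬝ᵥ z.1 + (Fᵀ *ᵥ a + Dᵀ *ᵥ c) ⬝ᵥ z.2 := fun z => by
    simp only [dotProduct_add, add_dotProduct, dotProduct_mulVec_transpose]
    ring
  have h2 : ∀ z : ((Fin n → ℝ) × (Fin l → ℝ)) × (Fin n → ℝ) × (Fin l → ℝ),
      a ⬝ᵥ (C *ᵥ z.1.1 + F *ᵥ z.1.2) +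
        (b ⬝ᵥ (x + K *ᵥ (C *ᵥ z.1.1 + F *ᵥ z.1.2 - C *ᵥ x) + z.2.1) + c ⬝ᵥ (D *ᵥ z.2.2)) =
        ((Cᵀ *ᵥ ξ) ⬝ᵥ z.1.1 + (Fᵀ *ᵥ ξ) ⬝ᵥ z.1.2) +
          ((b ⬝ᵥ z.2.1 + (b ⬝ᵥ x - (Kᵀ *ᵥ b) ⬝ᵥ (C *ᵥ x))) + (Dᵀ *ᵥ c) ⬝ᵥ z.2.2) := fun z => by
    rw [← dotProduct_mulVec_transpose C, ← dotProduct_mulVec_transpose F, hξ]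
    simp only [dotProduct_add, dotProduct_sub, add_dotProduct, dotProduct_mulVec_transpose K,
      dotProduct_mulVec_transpose D]
    ring
  simp only [h1, h2]
  rw [integral_exp_prod _ _ (fun z => (Cᵀ *ᵥ a + b) ⬝ᵥ z)]
  have h3 := integral_exp_prod ((initialPlantLaw x X).prod (noiseLaw l))
      ((initialPlantLaw 0 (X - K * (C * X * Cᵀ + F * Fᵀ) * Kᵀ)).prod (noiseLaw l))
      (fun z => (Cᵀ *ᵥ ξ) ⬝ᵥ z.1 + (Fᵀ *ᵥ ξ) ⬝ᵥ z.2)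
      (fun z => (b ⬝ᵥ z.1 + (b ⬝ᵥ x - (Kᵀ *ᵥ b) ⬝ᵥ (C *ᵥ x))) + (Dᵀ *ᵥ c) ⬝ᵥ z.2)
  rw [h3, integral_exp_prod _ _ (fun z => (Cᵀ *ᵥ ξ) ⬝ᵥ z) (fun z => (Fᵀ *ᵥ ξ) ⬝ᵥ z),
    integral_exp_prod _ _ (fun z => b ⬝ᵥ z + (b ⬝ᵥ x - (Kᵀ *ᵥ b) ⬝ᵥ (C *ᵥ x)))
      (fun z => (Dᵀ *ᵥ c) ⬝ᵥ z)]
  simp only [Complex.ofReal_add (_ ⬝ᵥ _) (_ - _), add_mul, Complex.exp_add]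
  rw [integral_mul_const]
  simp only [integral_exp_noiseLaw, integral_exp_initialPlantLaw _ hX,
    integral_exp_initialPlantLaw _ hT, ← Complex.exp_add]
  congr 1
  have hXt := transpose_eq_of_posSemidef hX
  set Y := C * X * Cᵀ + F * Fᵀ with hY
  have hYt : Yᵀ = Y := by
    simp [hY, transpose_mul, Matrix.mul_assoc, hXt]
  have hK' : Y * Kᵀ = C * X := by
    have h := congrArg Matrix.transpose hK
    rwa [transpose_mul, transpose_mul, transpose_transpose, hYt, hXt] at h
  -- The cross term vanishes because `D Fᵀ = 0`: observing `F W` reveals nothing about `D W`, so an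
  -- independent copy may replace it on the right.
  have e0 : (Fᵀ *ᵥ a + Dᵀ *ᵥ c) ⬝ᵥ (Fᵀ *ᵥ a + Dᵀ *ᵥ c) =
      (Fᵀ *ᵥ a) ⬝ᵥ (Fᵀ *ᵥ a) + (Dᵀ *ᵥ c) ⬝ᵥ (Dᵀ *ᵥ c) := by
    have : (Dᵀ *ᵥ c) ⬝ᵥ (Fᵀ *ᵥ a) = 0 := by
      rw [← dotProduct_mulVec_transpose, mulVec_mulVec, hDF, zero_mulVec, dotProduct_zero]
    rw [dotProduct_add, add_dotProduct, add_dotProduct, dotProduct_comm (Fᵀ *ᵥ a) (Dᵀ *ᵥ c),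
      this]
    ring
  have e1 : ∀ η, quadForm Y η = quadForm X (Cᵀ *ᵥ η) + (Fᵀ *ᵥ η) ⬝ᵥ (Fᵀ *ᵥ η) := fun η => by
    rw [hY, quadForm_add, quadForm_conj' X, ← quadForm_one (Fᵀ *ᵥ η), ← quadForm_conj' 1,
      Matrix.mul_one]
  have e2 : quadForm X (Cᵀ *ᵥ a + b) = quadForm X (Cᵀ *ᵥ a) + 2 * (b ⬝ᵥ (X *ᵥ (Cᵀ *ᵥ a))) +
      quadForm X b := quadForm_add_vec hXt _ _
  -- The gain equation `K Y = X Cᵀ` matches the cross term with that of `e2`; the remaining `K Y Kᵀ`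
  -- is exactly what the posterior covariance lacks.
  have e3 : quadForm Y ξ = quadForm Y a + 2 * (b ⬝ᵥ (X *ᵥ (Cᵀ *ᵥ a))) +
      quadForm (K * Y * Kᵀ) b := by
    rw [hξ, quadForm_add_vec hYt, quadForm_conj' Y, ← dotProduct_mulVec_transpose, mulVec_mulVec,
      hK, mulVec_mulVec]
  have e4 := quadForm_sub X (K * Y * Kᵀ) b
  have e5 : (Cᵀ *ᵥ ξ) ⬝ᵥ x = (Cᵀ *ᵥ a) ⬝ᵥ x + (Kᵀ *ᵥ b) ⬝ᵥ (C *ᵥ x) := by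
    rw [← dotProduct_mulVec_transpose, hξ, add_dotProduct, dotProduct_mulVec_transpose C a]
  have e6 := e1 a
  have e7 := e1 ξ
  have e8 : quadForm X (Cᵀ *ᵥ ξ) = quadForm X (Cᵀ *ᵥ a) + (Fᵀ *ᵥ a) ⬝ᵥ (Fᵀ *ᵥ a) +
      2 * (b ⬝ᵥ (X *ᵥ (Cᵀ *ᵥ a))) + quadForm (K * Y * Kᵀ) b - (Fᵀ *ᵥ ξ) ⬝ᵥ (Fᵀ *ᵥ ξ) := by
    linarith
  rw [e0, e2, e4, e5, e8, add_dotProduct, dotProduct_zero]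
  push_cast
  ring

theorem memLp_eval_multivariateGaussian (x : EuclideanSpace ℝ (Fin n))
    (V : Matrix (Fin n) (Fin n) ℝ) (i : Fin n) :
    MemLp (fun y : EuclideanSpace ℝ (Fin n) => y i) 2 (multivariateGaussian x V) :=
  (EuclideanSpace.proj (𝕜 := ℝ) i).comp_memLp' IsGaussian.memLp_two_id

theorem integral_eval_mul_eval (x : Fin n → ℝ) {V : Matrix (Fin n) (Fin n) ℝ}
    (hV : V.PosSemidef) (i j : Fin n) :
    Integrable (fun y : Fin n → ℝ => y i * y j) (initialPlantLaw x V) ∧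
      ∫ y, y i * y j ∂(initialPlantLaw x V) = x i * x j + V i j := by
  have hi := memLp_eval_multivariateGaussian (WithLp.toLp 2 x) V
  have hint := (hi i).integrable_mul (hi j)
  have hmean : ∀ i, ∫ y, y i ∂(multivariateGaussian (WithLp.toLp 2 x) V) = x i := fun i => by
    have h := (EuclideanSpace.proj (𝕜 := ℝ) i).integral_comp_comm
      (IsGaussian.integrable_id (μ := multivariateGaussian (WithLp.toLp 2 x) V))
    simpa using h
  unfold initialPlantLaw
  rw [integrable_map_measure (Measurable.aestronglyMeasurable (by fun_prop)) (by fun_prop),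
    integral_map (by fun_prop) (Measurable.aestronglyMeasurable (by fun_prop))]
  refine ⟨hint, ?_⟩
  have hcov := covariance_eval_multivariateGaussian (μ := WithLp.toLp 2 x) hV i j
  rw [covariance_eq_sub (hi i) (hi j), hmean, hmean] at hcov
  rw [← hcov]
  simp

/-- Second moments of Gaussian laws. -/
theorem integral_quadForm_initialPlantLaw (G : Matrix (Fin n) (Fin n) ℝ) (x : Fin n → ℝ)
    {V : Matrix (Fin n) (Fin n) ℝ} (hV : V.PosSemidef) :
    Integrable (quadForm G) (initialPlantLaw x V) ∧
      ∫ y, quadForm G y ∂(initialPlantLaw x V) = quadForm G x + (G * V).trace := by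
  have hq : ∀ y, quadForm G y = ∑ i, ∑ j, G i j * (y i * y j) := fun y => by
    simp only [quadForm, dotProduct, mulVec, Finset.mul_sum]
    exact Finset.sum_congr rfl fun i _ => Finset.sum_congr rfl fun j _ => by ring
  have h := integral_eval_mul_eval x hV
  have hint : ∀ i j, Integrable (fun y : Fin n → ℝ => G i j * (y i * y j))
      (initialPlantLaw x V) := fun i j => (h i j).1.const_mul _
  refine ⟨?_, ?_⟩
  · rw [funext hq]
    exact integrable_finsetSum _ fun i _ => integrable_finsetSum _ fun j _ => hint i j
  · simp only [hq]
    rw [integral_finsetSum _ fun i _ => integrable_finsetSum _ fun j _ => hint i j]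
    have hVt := transpose_eq_of_posSemidef hV
    have htr : (G * V).trace = ∑ i, ∑ j, G i j * V i j := by
      simp only [Matrix.trace, Matrix.diag, Matrix.mul_apply]
      refine Finset.sum_congr rfl fun i _ => Finset.sum_congr rfl fun j _ => ?_
      rw [← congrFun (congrFun hVt j) i, transpose_apply]
    rw [htr, ← Finset.sum_add_distrib]
    refine Finset.sum_congr rfl fun i _ => ?_
    rw [integral_finsetSum _ fun j _ => hint i j, ← Finset.sum_add_distrib]
    refine Finset.sum_congr rfl fun j _ => ?_
    rw [integral_const_mul, (h i j).2, mul_add]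

theorem lintegral_quadForm_initialPlantLaw {G : Matrix (Fin n) (Fin n) ℝ} (hG : G.PosSemidef)
    (x : Fin n → ℝ) {V : Matrix (Fin n) (Fin n) ℝ} (hV : V.PosSemidef) {c : ℝ} (hc : 0 ≤ c) :
    ∫⁻ y, ENNReal.ofReal (quadForm G y + c) ∂(initialPlantLaw x V) =
      ENNReal.ofReal (quadForm G x + (G * V).trace + c) := by
  obtain ⟨h1, h2⟩ := integral_quadForm_initialPlantLaw G x hV
  have h3 : Integrable (fun y => quadForm G y + c) (initialPlantLaw x V) :=
    h1.add (integrable_const c)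
  rw [← ofReal_integral_eq_lintegral_ofReal h3
    (Eventually.of_forall fun y => add_nonneg (quadForm_nonneg hG y) hc),
    integral_add h1 (integrable_const c), h2]
  simp

end Gaussian

/-! ### Histories and the Kalman filter -/

section History

/-- Append an entry to a history. -/
def snoc {Y : Type*} {t : ℕ} (h : (i : Finset.Iic t) → Y) (y : Y) : (i : Finset.Iic (t + 1)) → Y :=
  fun i => if hi : i.1 ≤ t then h ⟨i.1, Finset.mem_Iic.2 hi⟩ else y

theorem previous_snoc {Y : Type*} {t : ℕ} (h : (i : Finset.Iic t) → Y) (y : Y) :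
    previous (snoc h y) = h := by
  ext i
  simp [previous, snoc, Finset.mem_Iic.1 i.2]

theorem last_snoc {Y : Type*} {t : ℕ} (h : (i : Finset.Iic t) → Y) (y : Y) :
    last (snoc h y) = y := by
  simp [last, snoc]

theorem snoc_previous_last {Y : Type*} {t : ℕ} (h : (i : Finset.Iic (t + 1)) → Y) :
    snoc (previous h) (last h) = h := by
  ext ⟨i, hi⟩
  by_cases hit : i ≤ t
  · simp [snoc, hit, previous]
  · have : i = t + 1 := le_antisymm (Finset.mem_Iic.1 hi) (by omega)
    subst this
    simp [snoc, last]

theorem measurable_snoc {Y : Type*} [MeasurableSpace Y] {t : ℕ} :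
    Measurable fun z : ((i : Finset.Iic t) → Y) × Y => snoc z.1 z.2 := by
  refine measurable_pi_lambda _ fun i => ?_
  by_cases hi : i.1 ≤ t
  · simp only [snoc, hi, dif_pos]
    exact (measurable_pi_apply _).comp measurable_fst
  · simpa [snoc, hi] using measurable_snd

theorem measurable_previous {Y : Type*} [MeasurableSpace Y] {t : ℕ} :
    Measurable (previous : ((i : Finset.Iic (t + 1)) → Y) → (i : Finset.Iic t) → Y) :=
  measurable_pi_lambda _ fun _ => measurable_pi_apply _

theorem pad_apply {k : ℕ} (y : Fin k → ℝ) : (fun i : Fin k => pad y i) = y := by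
  ext i
  simp [pad]

end History

/-! ### One filter step and measurability of the filter -/

section FilterUpdate

variable [Fintype S] (m : Model d du dw S Q)

/-- One step of the Kalman filter in network state `s`, with query `q`, control `u` and
received signal `y`. -/
noncomputable def Model.filterUpdate (m : Model d du dw S Q) (q : Q) (s : S) (u : Fin du → ℝ)
    (z : Init d) (y : Signal S) : Init d :=
  if y.2.1 then
    (m.A *ᵥ z.1 + m.B *ᵥ u + m.kalmanGain q s z.2 *ᵥ
      ((fun i : Fin (m.obsDim q s) => y.2.2 i) - m.C q s *ᵥ (m.A *ᵥ z.1 + m.B *ᵥ u)),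
      m.covUpdate q s z.2)
  else (m.A *ᵥ z.1 + m.B *ᵥ u, m.Xi z.2)

variable [MeasurableSpace S]

theorem Model.measurable_filterUpdate_fixed (q : Q) (s : S) :
    Measurable fun a : (Fin du → ℝ) × Init d × Signal S => m.filterUpdate q s a.1 a.2.1 a.2.2 := by
  have hb : Measurable fun a : (Fin du → ℝ) × Init d × Signal S => a.2.2.2.1 :=
    measurable_snd.snd.snd.fst
  have hx : Measurable fun a : (Fin du → ℝ) × Init d × Signal S =>
      m.A *ᵥ a.2.1.1 + m.B *ᵥ a.1 :=
    ((measurable_mulVec m.A).comp measurable_snd.fst.fst).add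
      ((measurable_mulVec m.B).comp measurable_fst)
  have hV : Measurable fun a : (Fin du → ℝ) × Init d × Signal S => a.2.1.2 :=
    measurable_snd.fst.snd
  have hy : Measurable fun a : (Fin du → ℝ) × Init d × Signal S =>
      fun i : Fin (m.obsDim q s) => a.2.2.2.2 i :=
    measurable_pi_lambda _ fun i => (measurable_pi_apply _).comp measurable_snd.snd.snd.snd
  have hmv : Measurable fun z : Matrix (Fin d) (Fin (m.obsDim q s)) ℝ ×
      (Fin (m.obsDim q s) → ℝ) => z.1 *ᵥ z.2 :=
    (Continuous.matrix_mulVec continuous_fst continuous_snd).measurable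
  exact Measurable.ite (hb (measurableSet_singleton true))
    ((hx.add (hmv.comp (((m.measurable_kalmanGain q s).comp hV).prodMk
      (hy.sub ((measurable_mulVec (m.C q s)).comp hx))))).prodMk
      ((m.measurable_covUpdate q s).comp hV))
    (hx.prodMk (m.measurable_Xi.comp hV))

variable [MeasurableSpace Q] [MeasurableSingletonClass S] [MeasurableSingletonClass Q]
  [Fintype Q]

theorem Model.measurable_filterUpdate {X : Type*} [MeasurableSpace X] {q : X → Q} {s : X → S}
    {u : X → Fin du → ℝ} {z : X → Init d} {y : X → Signal S} (hq : Measurable q)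
    (hs : Measurable s) (hu : Measurable u) (hz : Measurable z) (hy : Measurable y) :
    Measurable fun a => m.filterUpdate (q a) (s a) (u a) (z a) (y a) := by
  have h : Measurable fun b : ((Fin du → ℝ) × Init d × Signal S) × (Q × S) =>
      m.filterUpdate b.2.1 b.2.2 b.1.1 b.1.2.1 b.1.2.2 :=
    measurable_from_prod_countable_left fun c => m.measurable_filterUpdate_fixed c.1 c.2
  exact h.comp ((hu.prodMk (hz.prodMk hy)).prodMk (hq.prodMk hs))

variable (v : Policy d du S Q)

theorem Model.kalmanFilter_succ (z : Init d) (t : ℕ) (h : History S (t + 1)) :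
    m.kalmanFilter v z (t + 1) h = m.filterUpdate (v.query t (z, previous h))
      (last (previous h)).1 (v.control t (z, previous h)) (m.kalmanFilter v z t (previous h))
      (last h) := rfl

theorem Model.measurable_kalmanFilter (t : ℕ) :
    Measurable fun a : Init d × History S t => m.kalmanFilter v a.1 t a.2 := by
  induction t with
  | zero => exact measurable_fst
  | succ t ih =>
    have hp : Measurable fun a : Init d × History S (t + 1) => (a.1, previous a.2) :=
      measurable_fst.prodMk (measurable_previous.comp measurable_snd)
    exact m.measurable_filterUpdate ((v.measurable_query t).comp hp)
      (measurable_last.comp (measurable_previous.comp measurable_snd)).fst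
      ((v.measurable_control t).comp hp) (ih.comp hp) (measurable_last.comp measurable_snd)

theorem Model.filterUpdate_snd_mem (q : Q) (s : S) (u : Fin du → ℝ) (z : Init d) (y : Signal S) :
    (m.filterUpdate q s u z y).2 = m.covUpdate q s z.2 ∨
      (m.filterUpdate q s u z y).2 = m.Xi z.2 := by
  unfold Model.filterUpdate
  split
  · exact Or.inl rfl
  · exact Or.inr rfl

theorem Model.kalmanFilter_posSemidef {z : Init d} (hz : z.2 ∈ psdCone d) (t : ℕ)
    (h : History S t) : (m.kalmanFilter v z t h).2 ∈ psdCone d := by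
  induction t with
  | zero => exact hz
  | succ t ih =>
    rw [m.kalmanFilter_succ]
    rcases m.filterUpdate_snd_mem (v.query t (z, previous h)) (last (previous h)).1
      (v.control t (z, previous h)) (m.kalmanFilter v z t (previous h)) (last h) with e | e
    · rw [e]; exact m.covUpdate_posSemidef _ _ (ih _)
    · rw [e]; exact m.Xi_posSemidef (ih _)

/-- The covariance ignores the observed values: each step applies one of finitely many updates, so
for fixed initial data only countably many covariances occur at time `t`. -/
theorem Model.countable_range_kalmanFilter (z : Init d) (t : ℕ) :
    (Set.range fun h : History S t => (m.kalmanFilter v z t h).2).Countable := by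
  induction t with
  | zero => exact (Set.countable_singleton z.2).mono (by rintro _ ⟨h, rfl⟩; rfl)
  | succ t ih =>
    set T := Set.range fun h : History S t => (m.kalmanFilter v z t h).2
    refine ((Set.countable_iUnion fun c : Q × S =>
      (ih.image (m.covUpdate c.1 c.2)).union (ih.image m.Xi))).mono ?_
    rintro _ ⟨h, rfl⟩
    refine Set.mem_iUnion.2 ⟨(v.query t (z, previous h), (last (previous h)).1), ?_⟩
    rcases m.filterUpdate_snd_mem (v.query t (z, previous h)) (last (previous h)).1
      (v.control t (z, previous h)) (m.kalmanFilter v z t (previous h)) (last h) with e | e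
    · exact Or.inl ⟨_, ⟨previous h, rfl⟩, e.symm⟩
    · exact Or.inr ⟨_, ⟨previous h, rfl⟩, e.symm⟩

theorem measurable_comp_of_countable_range {X Y Z : Type*} [MeasurableSpace X]
    [MeasurableSpace Y] [MeasurableSingletonClass Y] [MeasurableSpace Z] {f : X → Y}
    (hf : Measurable f) (hc : (Set.range f).Countable) (g : Y → Z) :
    Measurable fun x => g (f x) := by
  intro s _
  have : (fun x => g (f x)) ⁻¹' s = f ⁻¹' (Set.range f ∩ g ⁻¹' s) := by
    ext x; simp
  rw [this]
  exact hf (hc.mono Set.inter_subset_left).measurableSet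

theorem Model.measurable_kalmanFilter_fixed (z : Init d) (t : ℕ) :
    Measurable (m.kalmanFilter v z t) :=
  (m.measurable_kalmanFilter v t).comp (measurable_const.prodMk measurable_id)

/-- Since the covariance takes countably many values, `g` need not be measurable. This covers both
the Gaussian law as a function of its covariance and the value functions, about which little is
known off the cone. -/
theorem Model.measurable_comp_kalmanFilter_snd {Z : Type*} [MeasurableSpace Z] (z : Init d)
    (t : ℕ) (g : Matrix (Fin d) (Fin d) ℝ → Z) :
    Measurable fun h => g (m.kalmanFilter v z t h).2 :=
  measurable_comp_of_countable_range (m.measurable_kalmanFilter_fixed v z t).snd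
    (m.countable_range_kalmanFilter v z t) g

/-- Integral of `φ` over the conditional law of `(X_t, D W_t)` given the signals `h`. -/
noncomputable def Model.filterIntegral (m : Model d du dw S Q) (v : Policy d du S Q)
    (z : Init d) (t : ℕ) (φ : History S t × (Fin d → ℝ) × (Fin d → ℝ) → ℝ≥0∞)
    (h : History S t) : ℝ≥0∞ :=
  ∫⁻ x, ∫⁻ w, φ (h, x, m.D *ᵥ w) ∂(noiseLaw dw) ∂(initialPlantLaw (m.kalmanFilter v z t h).1
    (m.kalmanFilter v z t h).2)

/-- The estimate is moved into the integrand by translation; the centred law is then a kernel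
because it depends only on the covariance. -/
theorem Model.measurable_filterIntegral (z : Init d) (t : ℕ)
    {φ : History S t × (Fin d → ℝ) × (Fin d → ℝ) → ℝ≥0∞} (hφ : Measurable φ) :
    Measurable (m.filterIntegral v z t φ) := by
  let κ : Kernel (History S t) (Fin d → ℝ) :=
    ⟨fun h => initialPlantLaw 0 (m.kalmanFilter v z t h).2,
      m.measurable_comp_kalmanFilter_snd v z t fun V => initialPlantLaw 0 V⟩
  have : IsMarkovKernel κ := ⟨fun h => by
    change IsProbabilityMeasure (initialPlantLaw 0 _); infer_instance⟩
  have hinner : Measurable fun a : History S t × (Fin d → ℝ) =>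
      ∫⁻ w, φ (a.1, a.2, m.D *ᵥ w) ∂(noiseLaw dw) :=
    Measurable.lintegral_prod_right' (f := fun b : (History S t × (Fin d → ℝ)) × (Fin dw → ℝ) =>
      φ (b.1.1, b.1.2, m.D *ᵥ b.2)) (hφ.comp (measurable_fst.fst.prodMk
        (measurable_fst.snd.prodMk ((measurable_mulVec m.D).comp measurable_snd))))
  have hF : Measurable fun a : History S t × (Fin d → ℝ) =>
      ∫⁻ w, φ (a.1, (m.kalmanFilter v z t a.1).1 + a.2, m.D *ᵥ w) ∂(noiseLaw dw) :=
    hinner.comp (measurable_fst.prodMk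
      (((m.measurable_kalmanFilter_fixed v z t).comp measurable_fst).fst.add measurable_snd))
  have hmain : Measurable fun h => ∫⁻ e, ∫⁻ w, φ (h, (m.kalmanFilter v z t h).1 + e, m.D *ᵥ w)
      ∂(noiseLaw dw) ∂(κ h) := hF.lintegral_kernel_prod_right'
  convert hmain using 2 with h
  unfold Model.filterIntegral
  rw [initialPlantLaw_eq_map]
  exact lintegral_map (hinner.comp (measurable_const.prodMk measurable_id))
    (measurable_const.add measurable_id)

end FilterUpdate

/-! ### The conditional law of the plant state -/

section Law

variable [Fintype S] [MeasurableSpace S] [MeasurableSingletonClass S]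
  [MeasurableSpace Q] [MeasurableSingletonClass Q] [Fintype Q]
  (m : Model d du dw S Q) (v : Policy d du S Q)

/-- Signals received up to time `t` along a trajectory. -/
def signalsUpTo (t : ℕ) (ω : ℕ → State d dw S) : History S t :=
  signals (Preorder.frestrictLe (π := fun _ => State d dw S) t ω)

theorem measurable_signalsUpTo (t : ℕ) :
    Measurable (signalsUpTo (d := d) (dw := dw) (S := S) t) :=
  measurable_signals.comp (Preorder.measurable_frestrictLe t)

theorem signalsUpTo_succ (t : ℕ) (ω : ℕ → State d dw S) :
    signalsUpTo (t + 1) ω = snoc (signalsUpTo t ω) (ω (t + 1)).2 :=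
  (snoc_previous_last (signalsUpTo (t + 1) ω)).symm

instance (z : Init d) (s : S) : IsProbabilityMeasure (initialLaw dw z s) := by
  unfold initialLaw; infer_instance

instance (z : Init d) (s : S) : IsProbabilityMeasure (m.law v z s) := by
  unfold Model.law; infer_instance

theorem Model.lintegral_law_zero (z : Init d) (s : S)
    {G : (ℕ → State d dw S) → ℝ≥0∞} {F : State d dw S → ℝ≥0∞} (hF : Measurable F)
    (hG : ∀ ω, G ω = F (ω 0)) :
    ∫⁻ ω, G ω ∂(m.law v z s) = ∫⁻ x, F x ∂(initialLaw dw z s) := by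
  have hmap : (m.law v z s).map (Preorder.frestrictLe (π := fun _ => State d dw S) 0) =
      (initialLaw dw z s).map (MeasurableEquiv.piUnique
        (fun _ : Finset.Iic 0 => State d dw S)).symm := by
    unfold Model.law Kernel.trajMeasure
    rw [Measure.map_comp _ _ (by fun_prop), Kernel.traj_map_frestrictLe,
      Kernel.partialTraj_self, Measure.id_comp]
  have h0 : Measurable fun h : (i : Finset.Iic 0) → State d dw S => F (last h) :=
    hF.comp measurable_last
  calc ∫⁻ ω, G ω ∂(m.law v z s)
      = ∫⁻ ω, F (last (Preorder.frestrictLe (π := fun _ => State d dw S) 0 ω))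
          ∂(m.law v z s) := lintegral_congr fun ω => hG ω
    _ = ∫⁻ h, F (last h) ∂((m.law v z s).map
          (Preorder.frestrictLe (π := fun _ => State d dw S) 0)) :=
        (lintegral_map h0 (Preorder.measurable_frestrictLe 0)).symm
    _ = ∫⁻ x, F x ∂(initialLaw dw z s) := by
        rw [hmap, lintegral_map h0 (MeasurableEquiv.measurable _)]
        rfl

/-- Disintegration of the trajectory law: the coordinate at `t + 1` is integrated against the
transition kernel given the past. -/
theorem Model.lintegral_law_succ (z : Init d) (s : S) (t : ℕ)
    {G : (ℕ → State d dw S) → ℝ≥0∞}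
    {F : ((i : Finset.Iic t) → State d dw S) × State d dw S → ℝ≥0∞} (hF : Measurable F)
    (hG : ∀ ω, G ω = F (Preorder.frestrictLe (π := fun _ => State d dw S) t ω, ω (t + 1))) :
    ∫⁻ ω, G ω ∂(m.law v z s) =
      ∫⁻ ω, ∫⁻ y, F (Preorder.frestrictLe (π := fun _ => State d dw S) t ω, y)
        ∂(m.step v z t (Preorder.frestrictLe (π := fun _ => State d dw S) t ω))
        ∂(m.law v z s) := by
  have h := Kernel.map_frestrictLe_trajMeasure_compProd_eq_map_trajMeasure
    (X := fun _ => State d dw S) (μ₀ := initialLaw dw z s) (κ := m.step v z) (a := t)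
  have hm : Measurable fun ω : ℕ → State d dw S =>
      (Preorder.frestrictLe (π := fun _ => State d dw S) t ω, ω (t + 1)) :=
    (Preorder.measurable_frestrictLe t).prodMk (measurable_pi_apply _)
  calc ∫⁻ ω, G ω ∂(m.law v z s)
      = ∫⁻ a, F a ∂((m.law v z s).map fun ω =>
          (Preorder.frestrictLe (π := fun _ => State d dw S) t ω, ω (t + 1))) := by
        rw [lintegral_map hF hm]
        exact lintegral_congr hG
    _ = ∫⁻ a, F a ∂(((m.law v z s).map
          (Preorder.frestrictLe (π := fun _ => State d dw S) t)) ⊗ₘ m.step v z t) := by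
        rw [show (m.law v z s).map (fun ω =>
          (Preorder.frestrictLe (π := fun _ => State d dw S) t ω, ω (t + 1))) = _ from h.symm]
        rfl
    _ = _ := by
        have hint : Measurable fun b => ∫⁻ y, F (b, y) ∂(m.step v z t b) :=
          hF.lintegral_kernel_prod_right'
        rw [Measure.lintegral_compProd hF, lintegral_map hint (Preorder.measurable_frestrictLe t)]

theorem Model.lintegral_step (z : Init d) (t : ℕ) (h : (i : Finset.Iic t) → State d dw S)
    {G : State d dw S → ℝ≥0∞} (hG : Measurable G) :
    ∫⁻ y, G y ∂(m.step v z t h) =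
      ∫⁻ e, G (m.next v z t (h, e)) ∂(m.freshLaw ((last h).2.1, v.queryAt z t h)) := by
  have hmk : IsMarkovKernel (Kernel.ofFunOfCountable m.freshLaw) :=
    ⟨fun z' => by change IsProbabilityMeasure (m.freshLaw z'); infer_instance⟩
  unfold Model.step
  rw [Kernel.lintegral_map _ (m.measurable_next v z t) _ hG]
  exact Kernel.lintegral_id_prod (hG.comp (m.measurable_next v z t)) _ _

theorem Model.lintegral_freshLaw (s : S) (q : Q) {G : (Fin dw → ℝ) × S × Bool → ℝ≥0∞}
    (hG : Measurable G) :
    ∫⁻ e, G e ∂(m.freshLaw (s, q)) = ∑ s', ENNReal.ofReal (m.p q s s') *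
      (ENNReal.ofReal (1 - m.loss s q) * ∫⁻ w, G (w, s', true) ∂(noiseLaw dw) +
        ENNReal.ofReal (m.loss s q) * ∫⁻ w, G (w, s', false) ∂(noiseLaw dw)) := by
  have h1 : Measurable fun b : S × Bool => ∫⁻ w, G (w, b) ∂(noiseLaw dw) :=
    hG.lintegral_prod_left'
  unfold Model.freshLaw
  rw [lintegral_prod_symm' _ hG, lintegral_prod _ h1.aemeasurable]
  simp only [Model.netLaw, Model.receptionLaw, lintegral_finsetSum_measure,
    lintegral_smul_measure, lintegral_add_measure, lintegral_dirac, smul_eq_mul]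

/-- Conditional expectation of `φ` at time `t + 1` given the signals `a.1` up to time `t` and
the next plant state `a.2`, in network state `s` with query `q`. -/
noncomputable def Model.signalIntegral (m : Model d du dw S Q) {t : ℕ}
    (φ : History S (t + 1) × (Fin d → ℝ) × (Fin d → ℝ) → ℝ≥0∞) (q : Q) (s : S)
    (a : History S t × (Fin d → ℝ)) : ℝ≥0∞ :=
  ∑ s', ENNReal.ofReal (m.p q s s') *
    (ENNReal.ofReal (1 - m.loss s q) *
        ∫⁻ w, φ (snoc a.1 (s', true, pad (m.C q s *ᵥ a.2 + m.F q s *ᵥ w)), a.2, m.D *ᵥ w)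
          ∂(noiseLaw dw) +
      ENNReal.ofReal (m.loss s q) *
        ∫⁻ w, φ (snoc a.1 (s', false, 0), a.2, m.D *ᵥ w) ∂(noiseLaw dw))

/-- Conditional expectation of `φ` at time `t + 1` given the signals, the plant state and the
plant disturbance at time `t`. -/
noncomputable def Model.stepIntegral (m : Model d du dw S Q) (v : Policy d du S Q) (z : Init d)
    {t : ℕ} (φ : History S (t + 1) × (Fin d → ℝ) × (Fin d → ℝ) → ℝ≥0∞)
    (a : History S t × (Fin d → ℝ) × (Fin d → ℝ)) : ℝ≥0∞ :=
  m.signalIntegral φ (v.query t (z, a.1)) (last a.1).1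
    (a.1, m.A *ᵥ a.2.1 + m.B *ᵥ v.control t (z, a.1) + a.2.2)

variable {t : ℕ} {φ : History S (t + 1) × (Fin d → ℝ) × (Fin d → ℝ) → ℝ≥0∞}

theorem Model.measurable_received (hφ : Measurable φ) (q : Q) (s s' : S) :
    Measurable fun b : (History S t × (Fin d → ℝ)) × (Fin dw → ℝ) =>
      φ (snoc b.1.1 (s', true, pad (m.C q s *ᵥ b.1.2 + m.F q s *ᵥ b.2)), b.1.2, m.D *ᵥ b.2) := by
  have h1 : Measurable fun b : (History S t × (Fin d → ℝ)) × (Fin dw → ℝ) =>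
      pad (m.C q s *ᵥ b.1.2 + m.F q s *ᵥ b.2) :=
    measurable_pad.comp (((measurable_mulVec _).comp measurable_fst.snd).add
      ((measurable_mulVec _).comp measurable_snd))
  have h2 : Measurable fun b : (History S t × (Fin d → ℝ)) × (Fin dw → ℝ) =>
      ((s', true, pad (m.C q s *ᵥ b.1.2 + m.F q s *ᵥ b.2)) : Signal S) :=
    measurable_const.prodMk (measurable_const.prodMk h1)
  exact hφ.comp ((measurable_snoc.comp (measurable_fst.fst.prodMk h2)).prodMk
    (measurable_fst.snd.prodMk ((measurable_mulVec m.D).comp measurable_snd)))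

theorem Model.measurable_lost (hφ : Measurable φ) (s' : S) :
    Measurable fun b : (History S t × (Fin d → ℝ)) × (Fin dw → ℝ) =>
      φ (snoc b.1.1 (s', false, 0), b.1.2, m.D *ᵥ b.2) :=
  hφ.comp ((measurable_snoc.comp (measurable_fst.fst.prodMk measurable_const)).prodMk
    (measurable_fst.snd.prodMk ((measurable_mulVec m.D).comp measurable_snd)))

theorem Model.measurable_signalIntegral (hφ : Measurable φ) (q : Q) (s : S) :
    Measurable (m.signalIntegral φ q s) :=
  Finset.measurable_sum _ fun s' _ => measurable_const.mul
    ((measurable_const.mul (m.measurable_received hφ q s s').lintegral_prod_right').add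
      (measurable_const.mul (m.measurable_lost hφ s').lintegral_prod_right'))

theorem Model.measurable_stepIntegral (z : Init d) (hφ : Measurable φ) :
    Measurable (m.stepIntegral v z φ) := by
  have h : Measurable fun b : (History S t × (Fin d → ℝ)) × (Q × S) =>
      m.signalIntegral φ b.2.1 b.2.2 b.1 :=
    measurable_from_prod_countable_left fun c => m.measurable_signalIntegral hφ c.1 c.2
  have hz : Measurable fun a : History S t × (Fin d → ℝ) × (Fin d → ℝ) => (z, a.1) :=
    measurable_const.prodMk measurable_fst
  exact h.comp ((measurable_fst.prodMk ((((measurable_mulVec m.A).comp measurable_snd.fst).add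
    ((measurable_mulVec m.B).comp ((v.measurable_control t).comp hz))).add
    measurable_snd.snd)).prodMk
    (((v.measurable_query t).comp hz).prodMk (measurable_last.comp measurable_fst).fst))

/-- The Markov property. Test functions see the plant noise only as `D W`, which is all the next
plant state uses and the part that stays independent of the signals. -/
theorem Model.lintegral_law_stepIntegral (z : Init d) (s : S) (hφ : Measurable φ) :
    ∫⁻ ω, φ (signalsUpTo (t + 1) ω, (ω (t + 1)).1.1, m.D *ᵥ (ω (t + 1)).1.2) ∂(m.law v z s) =
      ∫⁻ ω, m.stepIntegral v z φ (signalsUpTo t ω, (ω t).1.1, m.D *ᵥ (ω t).1.2)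
        ∂(m.law v z s) := by
  have hF : Measurable fun a : ((i : Finset.Iic t) → State d dw S) × State d dw S =>
      φ (snoc (signals a.1) a.2.2, a.2.1.1, m.D *ᵥ a.2.1.2) :=
    hφ.comp ((measurable_snoc.comp ((measurable_signals.comp measurable_fst).prodMk
      measurable_snd.snd)).prodMk (measurable_snd.fst.fst.prodMk
        ((measurable_mulVec m.D).comp measurable_snd.fst.snd)))
  rw [m.lintegral_law_succ v z s t hF fun ω => by rw [signalsUpTo_succ]; rfl]
  refine lintegral_congr fun ω => ?_
  set h := Preorder.frestrictLe (π := fun _ => State d dw S) t ω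
  have hF1 : Measurable fun y : State d dw S =>
      φ (snoc (signals h) y.2, y.1.1, m.D *ᵥ y.1.2) :=
    hF.comp (measurable_const.prodMk measurable_id)
  have hF2 := hF1.comp ((m.measurable_next v z t).comp
    (measurable_const.prodMk measurable_id : Measurable fun e => (h, e)))
  exact (m.lintegral_step v z t h hF1).trans (m.lintegral_freshLaw _ _ hF2)

theorem lintegral_weighted_sum {X ι : Type*} [MeasurableSpace X] (I : Finset ι) (p : ι → ℝ≥0∞)
    (a b : ℝ≥0∞) {f g : ι → X → ℝ≥0∞} (hf : ∀ i, Measurable (f i)) (hg : ∀ i, Measurable (g i))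
    (μ : Measure X) :
    ∫⁻ x, ∑ i ∈ I, p i * (a * f i x + b * g i x) ∂μ =
      ∑ i ∈ I, p i * (a * ∫⁻ x, f i x ∂μ + b * ∫⁻ x, g i x ∂μ) := by
  have h : ∀ i, Measurable fun x => a * f i x + b * g i x := fun i =>
    ((hf i).const_mul a).add ((hg i).const_mul b)
  rw [lintegral_finsetSum _ fun i _ => (h i).const_mul (p i)]
  refine Finset.sum_congr rfl fun i _ => ?_
  rw [lintegral_const_mul _ (h i), lintegral_add_left ((hf i).const_mul a),
    lintegral_const_mul _ (hf i), lintegral_const_mul _ (hg i)]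

theorem Model.lintegral_signalIntegral (hφ : Measurable φ) (q : Q) (s : S) (h : History S t)
    (μ : Measure (Fin d → ℝ)) :
    ∫⁻ x, m.signalIntegral φ q s (h, x) ∂μ = ∑ s', ENNReal.ofReal (m.p q s s') *
      (ENNReal.ofReal (1 - m.loss s q) *
          ∫⁻ x, ∫⁻ w, φ (snoc h (s', true, pad (m.C q s *ᵥ x + m.F q s *ᵥ w)), x, m.D *ᵥ w)
            ∂(noiseLaw dw) ∂μ +
        ENNReal.ofReal (m.loss s q) *
          ∫⁻ x, ∫⁻ w, φ (snoc h (s', false, 0), x, m.D *ᵥ w) ∂(noiseLaw dw) ∂μ) := by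
  have h1 : ∀ s', Measurable fun x => ∫⁻ w,
      φ (snoc h (s', true, pad (m.C q s *ᵥ x + m.F q s *ᵥ w)), x, m.D *ᵥ w) ∂(noiseLaw dw) :=
    fun s' => (m.measurable_received hφ q s s').lintegral_prod_right'.comp
      (measurable_const.prodMk measurable_id)
  have h2 : ∀ s', Measurable fun x => ∫⁻ w,
      φ (snoc h (s', false, 0), x, m.D *ᵥ w) ∂(noiseLaw dw) :=
    fun s' => (m.measurable_lost hφ s').lintegral_prod_right'.comp
      (measurable_const.prodMk measurable_id)
  exact lintegral_weighted_sum _ _ _ _ h1 h2 μ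

/-- One-step prediction. -/
theorem Model.filterIntegral_eq_prediction {z : Init d} (hz : z.2 ∈ psdCone d)
    (hφ : Measurable φ) (h : History S t) :
    m.filterIntegral v z t (m.stepIntegral v z φ) h =
      ∫⁻ x, m.signalIntegral φ (v.query t (z, h)) (last h).1 (h, x)
        ∂(initialPlantLaw (m.A *ᵥ (m.kalmanFilter v z t h).1 + m.B *ᵥ v.control t (z, h))
          (m.Xi (m.kalmanFilter v z t h).2)) := by
  have hs : Measurable fun x => m.signalIntegral φ (v.query t (z, h)) (last h).1 (h, x) :=
    (m.measurable_signalIntegral hφ _ _).comp (measurable_const.prodMk measurable_id)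
  have hm : Measurable fun a : (Fin d → ℝ) × (Fin dw → ℝ) =>
      m.A *ᵥ a.1 + m.B *ᵥ v.control t (z, h) + m.D *ᵥ a.2 :=
    Continuous.measurable (by fun_prop)
  rw [Model.Xi, ← map_prediction m.A m.D (m.B *ᵥ v.control t (z, h))
    (m.kalmanFilter v z t h).1 (m.kalmanFilter_posSemidef v hz t h), lintegral_map hs hm]
  exact (lintegral_prod _ (hs.comp hm).aemeasurable).symm

/-- The Kalman filter computes the conditional law: integrating over one step and then over the
predicted law agrees with filtering after the step. -/
theorem Model.filterIntegral_stepIntegral {z : Init d} (hz : z.2 ∈ psdCone d)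
    (hφ : Measurable φ) (h : History S t) :
    m.filterIntegral v z t (m.stepIntegral v z φ) h =
      m.filterIntegral v z t
        (m.stepIntegral v z fun a => m.filterIntegral v z (t + 1) φ a.1) h := by
  have hφ' : Measurable fun a : History S (t + 1) × (Fin d → ℝ) × (Fin d → ℝ) =>
      m.filterIntegral v z (t + 1) φ a.1 :=
    (m.measurable_filterIntegral v z (t + 1) hφ).comp measurable_fst
  have hV := m.kalmanFilter_posSemidef v hz t h
  rw [m.filterIntegral_eq_prediction v hz hφ, m.filterIntegral_eq_prediction v hz hφ',
    m.lintegral_signalIntegral hφ, m.lintegral_signalIntegral hφ']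
  set q := v.query t (z, h) with hq
  set s := (last h).1 with hs
  set V := (m.kalmanFilter v z t h).2 with hVdef
  set xp := m.A *ᵥ (m.kalmanFilter v z t h).1 + m.B *ᵥ v.control t (z, h) with hxp
  have hsnoc : ∀ y : Signal S, m.kalmanFilter v z (t + 1) (snoc h y) =
      m.filterUpdate q s (v.control t (z, h)) (m.kalmanFilter v z t h) y := fun y => by
    rw [m.kalmanFilter_succ, previous_snoc, last_snoc]
  refine Finset.sum_congr rfl fun s' _ => ?_
  congr 2
  · congr 1
    -- the observation is received
    have hrec : ∀ y : Fin (m.obsDim q s) → ℝ,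
        m.kalmanFilter v z (t + 1) (snoc h (s', true, pad y)) =
          (xp + m.kalmanGain q s V *ᵥ (y - m.C q s *ᵥ xp), m.covUpdate q s V) := fun y => by
      rw [hsnoc]
      unfold Model.filterUpdate
      rw [if_pos rfl]
      simp only [pad_apply]
      rfl
    have hψ : Measurable fun b : (Fin (m.obsDim q s) → ℝ) × (Fin d → ℝ) × (Fin d → ℝ) =>
        φ (snoc h (s', true, pad b.1), b.2) := by
      have h1 : Measurable fun b : (Fin (m.obsDim q s) → ℝ) × (Fin d → ℝ) × (Fin d → ℝ) =>
          ((s', true, pad b.1) : Signal S) :=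
        measurable_const.prodMk (measurable_const.prodMk (measurable_pad.comp measurable_fst))
      exact hφ.comp ((measurable_snoc.comp (measurable_const.prodMk h1)).prodMk measurable_snd)
    -- The Bayes step: once the observation is fixed, the plant state and `D W` may be redrawn as a
    -- Gaussian around the updated estimate and as independent noise. Fubini then makes the inner
    -- integral the filter integral after the step.
    have hgauss := map_filtering (m.C q s) (m.F q s) m.D (m.D_mul_F q s) xp
      (m.Xi_posSemidef hV) (m.kalmanGain q s V) (m.kalmanGain_mul_innovCov q s hV)
      (by have := m.covUpdate_posSemidef q s hV; rwa [m.covUpdate_eq q s hV] at this)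
    rw [show m.Xi V - m.kalmanGain q s V * (m.C q s * m.Xi V * (m.C q s)ᵀ +
      m.F q s * (m.F q s)ᵀ) * (m.kalmanGain q s V)ᵀ = m.covUpdate q s V from
      (m.covUpdate_eq q s hV).symm] at hgauss
    have hm1 : Measurable fun a : (Fin d → ℝ) × (Fin dw → ℝ) =>
        (m.C q s *ᵥ a.1 + m.F q s *ᵥ a.2, a.1, m.D *ᵥ a.2) := Continuous.measurable (by fun_prop)
    have hm2 : Measurable fun a : ((Fin d → ℝ) × (Fin dw → ℝ)) × (Fin d → ℝ) × (Fin dw → ℝ) =>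
        (m.C q s *ᵥ a.1.1 + m.F q s *ᵥ a.1.2, xp + m.kalmanGain q s V *ᵥ
          (m.C q s *ᵥ a.1.1 + m.F q s *ᵥ a.1.2 - m.C q s *ᵥ xp) + a.2.1, m.D *ᵥ a.2.2) :=
      Continuous.measurable (by fun_prop)
    have hL := congrArg (fun μ => ∫⁻ b, φ (snoc h (s', true, pad b.1), b.2) ∂μ) hgauss
    rw [lintegral_map hψ hm1, lintegral_map hψ hm2] at hL
    replace hL := (lintegral_prod _ (hψ.comp hm1).aemeasurable).symm.trans
      (hL.trans (lintegral_prod _ (hψ.comp hm2).aemeasurable))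
    have hout : Measurable fun a : (Fin d → ℝ) × (Fin dw → ℝ) =>
        ∫⁻ b : (Fin d → ℝ) × (Fin dw → ℝ), φ (snoc h (s', true, pad (m.C q s *ᵥ a.1 +
          m.F q s *ᵥ a.2)), xp + m.kalmanGain q s V *ᵥ
          (m.C q s *ᵥ a.1 + m.F q s *ᵥ a.2 - m.C q s *ᵥ xp) + b.1, m.D *ᵥ b.2)
          ∂((initialPlantLaw 0 (m.covUpdate q s V)).prod (noiseLaw dw)) :=
      (hψ.comp hm2).lintegral_prod_right'
    refine (hL.trans (lintegral_prod _ hout.aemeasurable)).trans (lintegral_congr fun x => lintegral_congr fun w => ?_)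
    simp only [Model.filterIntegral, hrec]
    have hin : Measurable fun x' => ∫⁻ w', φ (snoc h (s', true, pad (m.C q s *ᵥ x +
        m.F q s *ᵥ w)), x', m.D *ᵥ w') ∂(noiseLaw dw) :=
      Measurable.lintegral_prod_right' (f := fun b : (Fin d → ℝ) × (Fin dw → ℝ) =>
        φ (snoc h (s', true, pad (m.C q s *ᵥ x + m.F q s *ᵥ w)), b.1, m.D *ᵥ b.2))
        (hφ.comp (measurable_const.prodMk (measurable_fst.prodMk
          ((measurable_mulVec m.D).comp measurable_snd))))
    rw [initialPlantLaw_eq_map (xp + _), lintegral_map hin (measurable_const_add _)]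
    exact lintegral_prod _ (hφ.comp (measurable_const.prodMk ((measurable_const.add
      measurable_fst).prodMk ((measurable_mulVec m.D).comp measurable_snd)))).aemeasurable
  · congr 1
    -- the observation is lost
    have hlost : m.kalmanFilter v z (t + 1) (snoc h (s', false, 0)) = (xp, m.Xi V) := by
      rw [hsnoc]
      unfold Model.filterUpdate
      rw [if_neg (by simp)]
    simp only [Model.filterIntegral, hlost, lintegral_const, measure_univ, mul_one]

/-- Given the signals up to time `t`, the plant state is Gaussian with mean and covariance given
by the Kalman filter, and independent of the current plant disturbance. -/
theorem Model.lintegral_law_eq_filterIntegral {z : Init d} (hz : z.2 ∈ psdCone d) (s : S)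
    (t : ℕ) {φ : History S t × (Fin d → ℝ) × (Fin d → ℝ) → ℝ≥0∞} (hφ : Measurable φ) :
    ∫⁻ ω, φ (signalsUpTo t ω, (ω t).1.1, m.D *ᵥ (ω t).1.2) ∂(m.law v z s) =
      ∫⁻ ω, m.filterIntegral v z t φ (signalsUpTo t ω) ∂(m.law v z s) := by
  induction t with
  | zero =>
    have hF : Measurable fun y : State d dw S => φ (fun _ => y.2, y.1.1, m.D *ᵥ y.1.2) :=
      hφ.comp ((measurable_pi_lambda _ fun _ => measurable_snd).prodMk
        (measurable_fst.fst.prodMk ((measurable_mulVec m.D).comp measurable_fst.snd)))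
    have hF' : Measurable fun y : State d dw S => m.filterIntegral v z 0 φ (fun _ => y.2) :=
      (m.measurable_filterIntegral v z 0 hφ).comp
        (measurable_pi_lambda _ fun _ => measurable_snd)
    have hsig : ∀ ω : ℕ → State d dw S, signalsUpTo 0 ω = fun _ => (ω 0).2 := by
      intro ω
      funext ⟨i, hi⟩
      obtain rfl : i = 0 := Nat.le_zero.1 (Finset.mem_Iic.1 hi)
      rfl
    rw [m.lintegral_law_zero v z s hF fun ω => by rw [hsig],
      m.lintegral_law_zero v z s hF' fun ω => by rw [hsig]]
    unfold initialLaw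
    have h1 : Measurable fun b : (Fin d → ℝ) × (Fin dw → ℝ) =>
        φ (fun _ => ((s, false, 0) : Signal S), b.1, m.D *ᵥ b.2) :=
      hF.comp (measurable_id.prodMk measurable_const)
    rw [lintegral_prod_symm' _ hF, lintegral_prod_symm' _ hF',
      lintegral_dirac' _ hF.lintegral_prod_left', lintegral_dirac' _ hF'.lintegral_prod_left']
    simp only [lintegral_const, measure_univ, mul_one]
    exact lintegral_prod _ h1.aemeasurable
  | succ t ih =>
    have hφ' : Measurable fun a : History S (t + 1) × (Fin d → ℝ) × (Fin d → ℝ) =>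
        m.filterIntegral v z (t + 1) φ a.1 :=
      (m.measurable_filterIntegral v z (t + 1) hφ).comp measurable_fst
    -- Both sides are moved back to time `t`, and the induction hypothesis is applied to both, so
    -- only the conditional integrals given the signals have to agree.
    rw [m.lintegral_law_stepIntegral v z s hφ, ih (m.measurable_stepIntegral v z hφ),
      m.lintegral_law_stepIntegral v z s hφ', ih (m.measurable_stepIntegral v z hφ')]
    exact lintegral_congr fun ω => m.filterIntegral_stepIntegral v hz hφ _

end Law

/-! ### Verification -/

section Verification

variable [Fintype S] [MeasurableSpace S] [MeasurableSingletonClass S]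
  [MeasurableSpace Q] [MeasurableSingletonClass Q] [Fintype Q]
  (m : Model d du dw S Q) (v : Policy d du S Q) {z : Init d} {α : ℝ}
  {P : Matrix (Fin d) (Fin d) ℝ} {f g : S → Matrix (Fin d) (Fin d) ℝ → ℝ}

theorem Model.filterIntegral_quadForm (hz : z.2 ∈ psdCone d) {G : Matrix (Fin d) (Fin d) ℝ}
    (hG : G.PosSemidef) {t : ℕ} {k : History S t → ℝ} (hk : ∀ h, 0 ≤ k h) (h : History S t) :
    m.filterIntegral v z t (fun a => ENNReal.ofReal (quadForm G a.2.1 + k a.1)) h =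
      ENNReal.ofReal (quadForm G (m.kalmanFilter v z t h).1 +
        (G * (m.kalmanFilter v z t h).2).trace + k h) := by
  simp only [Model.filterIntegral, lintegral_const, measure_univ, mul_one]
  exact lintegral_quadForm_initialPlantLaw hG _ (m.kalmanFilter_posSemidef v hz t h) (hk h)

/-- The tower property: conditioning on the signals replaces the quadratic form of the plant state
by that of the estimate plus a trace with the error covariance. -/
theorem Model.lintegral_quadForm (hz : z.2 ∈ psdCone d) (s : S) {G : Matrix (Fin d) (Fin d) ℝ}
    (hG : G.PosSemidef) {t : ℕ} {k : History S t → ℝ} (hk : ∀ h, 0 ≤ k h) (hkm : Measurable k) :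
    ∫⁻ ω, ENNReal.ofReal (quadForm G (ω t).1.1 + k (signalsUpTo t ω)) ∂(m.law v z s) =
      ∫⁻ ω, ENNReal.ofReal (quadForm G (m.kalmanFilter v z t (signalsUpTo t ω)).1 +
        (G * (m.kalmanFilter v z t (signalsUpTo t ω)).2).trace + k (signalsUpTo t ω))
        ∂(m.law v z s) := by
  have hφ : Measurable fun a : History S t × (Fin d → ℝ) × (Fin d → ℝ) =>
      ENNReal.ofReal (quadForm G a.2.1 + k a.1) :=
    (((measurable_quadForm G).comp measurable_snd.fst).add
      (hkm.comp measurable_fst)).ennreal_ofReal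
  refine (m.lintegral_law_eq_filterIntegral v hz s t hφ).trans (lintegral_congr fun ω => ?_)
  exact m.filterIntegral_quadForm v hz hG hk _

/-- Expected running cost at time `t`. -/
noncomputable def Model.expectedCost (m : Model d du dw S Q) (v : Policy d du S Q) (z : Init d)
    (s : S) (t : ℕ) : ℝ≥0∞ :=
  ∫⁻ ω, ENNReal.ofReal (m.runningCost v z t ω) ∂(m.law v z s)

/-- The constant `α / (1 - α) tr(P D Dᵀ)`. -/
noncomputable def Model.noiseCost (m : Model d du dw S Q) (α : ℝ)
    (P : Matrix (Fin d) (Fin d) ℝ) : ℝ := α / (1 - α) * (P * (m.D * m.Dᵀ)).trace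

/-- Expected value-to-go at time `t` when the network part is `g`. -/
noncomputable def Model.expectedValue (m : Model d du dw S Q) (α : ℝ)
    (P : Matrix (Fin d) (Fin d) ℝ) (g : S → Matrix (Fin d) (Fin d) ℝ → ℝ) (v : Policy d du S Q)
    (z : Init d) (s : S) (t : ℕ) : ℝ≥0∞ :=
  ∫⁻ ω, ENNReal.ofReal (quadForm P (ω t).1.1 + (m.noiseCost α P +
    g (last (signalsUpTo t ω)).1 (m.kalmanFilter v z t (signalsUpTo t ω)).2)) ∂(m.law v z s)

theorem Model.noiseCost_nonneg (hα : α ∈ Set.Ioo (0 : ℝ) 1) (hP : P.PosSemidef) :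
    0 ≤ m.noiseCost α P :=
  mul_nonneg (div_nonneg hα.1.le (sub_nonneg.2 hα.2.le))
    (trace_mul_nonneg hP (posSemidef_self_mul_conjTranspose m.D))

theorem Model.noiseCost_eq (hα : α ∈ Set.Ioo (0 : ℝ) 1) :
    α * (P * (m.D * m.Dᵀ)).trace + α * m.noiseCost α P = m.noiseCost α P := by
  have : 1 - α ≠ 0 := by linarith [hα.2]
  unfold Model.noiseCost
  field_simp
  ring

theorem Model.measurable_of_state_cov (z : Init d) (t : ℕ)
    (g : S → Matrix (Fin d) (Fin d) ℝ → ℝ) :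
    Measurable fun h : History S t => g (last h).1 (m.kalmanFilter v z t h).2 := by
  have h : Measurable fun a : History S t × S => g a.2 (m.kalmanFilter v z t a.1).2 :=
    measurable_from_prod_countable_left fun s => m.measurable_comp_kalmanFilter_snd v z t (g s)
  exact h.comp (measurable_id.prodMk measurable_last.fst)

theorem Model.measurable_runningCost (z : Init d) (t : ℕ) :
    Measurable (m.runningCost v z t) := by
  have hn : Measurable fun a : S × Q => m.netCost a.1 a.2 := measurable_of_countable _
  have hz : Measurable fun ω : ℕ → State d dw S => (z, signalsUpTo t ω) :=
    measurable_const.prodMk (measurable_signalsUpTo t)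
  have hq : Measurable fun ω : ℕ → State d dw S => v.query t (z, signalsUpTo t ω) :=
    (v.measurable_query t).comp hz
  have hu : Measurable fun ω : ℕ → State d dw S => v.control t (z, signalsUpTo t ω) :=
    (v.measurable_control t).comp hz
  have hω : Measurable fun ω : ℕ → State d dw S => ω t := measurable_pi_apply t
  exact (hn.comp (hω.snd.fst.prodMk hq)).add
    (((measurable_quadForm m.R).comp hω.fst.fst).add ((measurable_quadForm m.M).comp hu))

theorem Model.expectedCost_eq (hz : z.2 ∈ psdCone d) (s : S) (t : ℕ) :
    m.expectedCost v z s t =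
      ∫⁻ ω, ENNReal.ofReal (quadForm m.R (m.kalmanFilter v z t (signalsUpTo t ω)).1 +
        (m.R * (m.kalmanFilter v z t (signalsUpTo t ω)).2).trace +
        (m.netCost (last (signalsUpTo t ω)).1 (v.query t (z, signalsUpTo t ω)) +
          quadForm m.M (v.control t (z, signalsUpTo t ω)))) ∂(m.law v z s) := by
  have hn : Measurable fun a : S × Q => m.netCost a.1 a.2 := measurable_of_countable _
  have hz' : Measurable fun h : History S t => (z, h) := measurable_const.prodMk measurable_id
  rw [← m.lintegral_quadForm v hz s m.R_posDef.posSemidef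
    (k := fun h => m.netCost (last h).1 (v.query t (z, h)) + quadForm m.M (v.control t (z, h)))
    (fun h => add_nonneg (m.netCost_nonneg _ _) (quadForm_nonneg m.M_posDef.posSemidef _))
    ((hn.comp (measurable_last.fst.prodMk ((v.measurable_query t).comp hz'))).add
      ((measurable_quadForm m.M).comp ((v.measurable_control t).comp hz')))]
  refine lintegral_congr fun ω => congrArg _ ?_
  change _ + (quadForm m.R _ + quadForm m.M _) = _
  rw [add_left_comm]
  rfl

theorem Model.expectedValue_eq (hα : α ∈ Set.Ioo (0 : ℝ) 1) (hP : P.PosSemidef)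
    (hz : z.2 ∈ psdCone d) (hg : ∀ s, ∀ V ∈ psdCone d, 0 ≤ g s V) (s : S) (t : ℕ) :
    m.expectedValue α P g v z s t =
      ∫⁻ ω, ENNReal.ofReal (quadForm P (m.kalmanFilter v z t (signalsUpTo t ω)).1 +
        (P * (m.kalmanFilter v z t (signalsUpTo t ω)).2).trace + (m.noiseCost α P +
        g (last (signalsUpTo t ω)).1 (m.kalmanFilter v z t (signalsUpTo t ω)).2))
        ∂(m.law v z s) :=
  m.lintegral_quadForm v hz s hP
    (k := fun h => m.noiseCost α P + g (last h).1 (m.kalmanFilter v z t h).2)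
    (fun h => add_nonneg (m.noiseCost_nonneg hα hP) (hg _ _ (m.kalmanFilter_posSemidef v hz t h)))
    (measurable_const.add (m.measurable_of_state_cov v z t g))

theorem Model.sum_ofReal_transition (q : Q) (s : S) {V : Matrix (Fin d) (Fin d) ℝ} {c : ℝ}
    (hT : ∀ s', 0 ≤ c + g s' (m.covUpdate q s V)) (hX : ∀ s', 0 ≤ c + g s' (m.Xi V)) :
    ∑ s', ENNReal.ofReal (m.p q s s') *
      (ENNReal.ofReal (1 - m.loss s q) * ENNReal.ofReal (c + g s' (m.covUpdate q s V)) +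
        ENNReal.ofReal (m.loss s q) * ENNReal.ofReal (c + g s' (m.Xi V))) =
      ENNReal.ofReal (c + m.transition q g s V) := by
  have hl : 0 ≤ 1 - m.loss s q := sub_nonneg.2 (m.loss_lt_one s q).le
  have h1 : ∀ s', ENNReal.ofReal (m.p q s s') *
      (ENNReal.ofReal (1 - m.loss s q) * ENNReal.ofReal (c + g s' (m.covUpdate q s V)) +
        ENNReal.ofReal (m.loss s q) * ENNReal.ofReal (c + g s' (m.Xi V))) =
      ENNReal.ofReal (m.p q s s' * ((1 - m.loss s q) * (c + g s' (m.covUpdate q s V)) +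
        m.loss s q * (c + g s' (m.Xi V)))) := fun s' => by
    rw [ENNReal.ofReal_mul (m.p_nonneg q s s'), ENNReal.ofReal_add (mul_nonneg hl (hT s'))
      (mul_nonneg (m.loss_nonneg s q) (hX s')), ENNReal.ofReal_mul hl,
      ENNReal.ofReal_mul (m.loss_nonneg s q)]
  simp only [h1]
  rw [← ENNReal.ofReal_sum_of_nonneg fun s' _ => mul_nonneg (m.p_nonneg q s s')
    (add_nonneg (mul_nonneg hl (hT s')) (mul_nonneg (m.loss_nonneg s q) (hX s')))]
  congr 1
  have h2 := m.transition_add (V := V) (f := fun _ _ => c) (g := g) q s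
  rw [m.transition_const] at h2
  exact h2

/-- Condition on the signals at time `t`. The form in `P` concerns the plant state itself, so only
its predicted law counts and `Xi` appears there; reception of the observation matters for `g` alone,
which is averaged by `transition`. -/
theorem Model.expectedValue_succ (hα : α ∈ Set.Ioo (0 : ℝ) 1) (hP : P.PosSemidef)
    (hz : z.2 ∈ psdCone d) (hg : ∀ s, ∀ V ∈ psdCone d, 0 ≤ g s V) (s : S) (t : ℕ) :
    m.expectedValue α P g v z s (t + 1) =
      ∫⁻ ω, ENNReal.ofReal (quadForm P (m.A *ᵥ (m.kalmanFilter v z t (signalsUpTo t ω)).1 +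
          m.B *ᵥ v.control t (z, signalsUpTo t ω)) +
        (P * m.Xi (m.kalmanFilter v z t (signalsUpTo t ω)).2).trace + (m.noiseCost α P +
        m.transition (v.query t (z, signalsUpTo t ω)) g (last (signalsUpTo t ω)).1
          (m.kalmanFilter v z t (signalsUpTo t ω)).2)) ∂(m.law v z s) := by
  have hc := m.noiseCost_nonneg hα hP
  have hφ : Measurable fun a : History S (t + 1) × (Fin d → ℝ) × (Fin d → ℝ) =>
      ENNReal.ofReal (quadForm P a.2.1 + (m.noiseCost α P +
        g (last a.1).1 (m.kalmanFilter v z (t + 1) a.1).2)) :=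
    (((measurable_quadForm P).comp measurable_snd.fst).add (measurable_const.add
      ((m.measurable_of_state_cov v z (t + 1) g).comp measurable_fst))).ennreal_ofReal
  refine ((m.lintegral_law_stepIntegral v z s hφ).trans
    (m.lintegral_law_eq_filterIntegral v hz s t (m.measurable_stepIntegral v z hφ))).trans
    (lintegral_congr fun ω => ?_)
  set h := signalsUpTo t ω
  have hV := m.kalmanFilter_posSemidef v hz t h
  rw [m.filterIntegral_eq_prediction v hz hφ, ← lintegral_quadForm_initialPlantLaw hP _
    (m.Xi_posSemidef hV) (add_nonneg hc (m.transition_nonneg _ _ hV hg))]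
  refine lintegral_congr fun x => ?_
  set q := v.query t (z, h)
  have hrec : ∀ s' y, (m.kalmanFilter v z (t + 1) (snoc h (s', true, y))).2 =
      m.covUpdate q (last h).1 (m.kalmanFilter v z t h).2 := fun s' y => by
    rw [m.kalmanFilter_succ, previous_snoc, last_snoc]; rfl
  have hlost : ∀ s', (m.kalmanFilter v z (t + 1) (snoc h (s', false, 0))).2 =
      m.Xi (m.kalmanFilter v z t h).2 := fun s' => by
    rw [m.kalmanFilter_succ, previous_snoc, last_snoc]; rfl
  have hqx := quadForm_nonneg hP x
  simp only [Model.signalIntegral, last_snoc, hrec, hlost, lintegral_const, measure_univ, mul_one,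
    ← add_assoc]
  exact m.sum_ofReal_transition q (last h).1
    (fun s' => add_nonneg (add_nonneg hqx hc) (hg _ _ (m.covUpdate_posSemidef _ _ hV)))
    (fun s' => add_nonneg (add_nonneg hqx hc) (hg _ _ (m.Xi_posSemidef hV)))

/-- The one-step decomposition of cost plus discounted value-to-go. -/
theorem Model.expectedCost_add_expectedValue (hα : α ∈ Set.Ioo (0 : ℝ) 1) (hP : P.PosSemidef)
    (hric : m.IsRiccatiSolution α P) (hz : z.2 ∈ psdCone d)
    (hg : ∀ s, ∀ V ∈ psdCone d, 0 ≤ g s V) (s : S) (t : ℕ) :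
    m.expectedCost v z s t + ENNReal.ofReal α * m.expectedValue α P g v z s (t + 1) =
      ∫⁻ ω, ENNReal.ofReal (quadForm P (m.kalmanFilter v z t (signalsUpTo t ω)).1 +
        (P * (m.kalmanFilter v z t (signalsUpTo t ω)).2).trace + (m.noiseCost α P +
        m.bellmanTerm α P g (v.query t (z, signalsUpTo t ω)) (last (signalsUpTo t ω)).1
          (m.kalmanFilter v z t (signalsUpTo t ω)).2) +
        quadForm (m.controlWeight α P) (v.control t (z, signalsUpTo t ω) +
          m.feedbackGain α P *ᵥ (m.kalmanFilter v z t (signalsUpTo t ω)).1)) ∂(m.law v z s) := by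
  have hsig := measurable_signalsUpTo (d := d) (dw := dw) (S := S) t
  have hz' : Measurable fun ω : ℕ → State d dw S => (z, signalsUpTo t ω) :=
    measurable_const.prodMk hsig
  have hkf := (m.measurable_kalmanFilter_fixed v z t).comp hsig
  have hn : Measurable fun a : S × Q => m.netCost a.1 a.2 := measurable_of_countable _
  have hmeas : Measurable fun ω : ℕ → State d dw S =>
      ENNReal.ofReal (quadForm m.R (m.kalmanFilter v z t (signalsUpTo t ω)).1 +
        (m.R * (m.kalmanFilter v z t (signalsUpTo t ω)).2).trace +
        (m.netCost (last (signalsUpTo t ω)).1 (v.query t (z, signalsUpTo t ω)) +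
          quadForm m.M (v.control t (z, signalsUpTo t ω)))) := by
    have htr : Measurable fun V : Matrix (Fin d) (Fin d) ℝ => (m.R * V).trace :=
      Continuous.measurable (by fun_prop)
    exact ((((measurable_quadForm m.R).comp hkf.fst).add (htr.comp hkf.snd)).add
      ((hn.comp ((measurable_last.comp hsig).fst.prodMk ((v.measurable_query t).comp hz'))).add
        ((measurable_quadForm m.M).comp ((v.measurable_control t).comp hz')))).ennreal_ofReal
  rw [m.expectedCost_eq v hz, m.expectedValue_succ v hα hP hz hg,
    ← lintegral_const_mul' _ _ ENNReal.ofReal_ne_top, ← lintegral_add_left hmeas]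
  refine lintegral_congr fun ω => ?_
  set h := signalsUpTo t ω
  set x := (m.kalmanFilter v z t h).1
  set V := (m.kalmanFilter v z t h).2
  set u := v.control t (z, h)
  set q := v.query t (z, h)
  have hV : V.PosSemidef := m.kalmanFilter_posSemidef v hz t h
  have hc := m.noiseCost_nonneg hα hP
  rw [← ENNReal.ofReal_mul hα.1.le, ← ENNReal.ofReal_add]
  · congr 1
    -- The square is completed at the estimate. The covariance terms combine into `errorWeight`, and
    -- the noise constant is reproduced by its geometric fixed-point identity.
    have h1 := m.quadForm_riccatiMap hα.1.le hP x u
    rw [← show P = m.riccatiMap α P from hric] at h1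
    have h2 := m.noiseCost_eq (P := P) hα
    have h3 : (m.errorWeight α P * V).trace =
        (m.R * V).trace - (P * V).trace + α * (m.Aᵀ * P * m.A * V).trace := by
      simp [Model.errorWeight, Matrix.add_mul, Matrix.sub_mul, trace_add, trace_sub]
    rw [Model.bellmanTerm, h3, m.trace_mul_Xi]
    linarith
  · exact add_nonneg (add_nonneg (quadForm_nonneg m.R_posDef.posSemidef x)
      (trace_mul_nonneg m.R_posDef.posSemidef hV))
      (add_nonneg (m.netCost_nonneg _ _) (quadForm_nonneg m.M_posDef.posSemidef u))
  · exact mul_nonneg hα.1.le (add_nonneg (add_nonneg (quadForm_nonneg hP _)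
      (trace_mul_nonneg hP (m.Xi_posSemidef hV)))
      (add_nonneg hc (m.transition_nonneg _ _ hV hg)))

/-- For an arbitrary policy the completed square is dropped, and `f` is bounded by the Bellman term
at the query actually made. -/
theorem Model.expectedValue_le (hα : α ∈ Set.Ioo (0 : ℝ) 1) (hP : P.PosSemidef)
    (hric : m.IsRiccatiSolution α P) (hz : z.2 ∈ psdCone d)
    (hf : ∀ s, ∀ V ∈ psdCone d, 0 ≤ f s V) (hg : ∀ s, ∀ V ∈ psdCone d, 0 ≤ g s V)
    (hfg : ∀ q s, ∀ V ∈ psdCone d, f s V ≤ m.bellmanTerm α P g q s V) (s : S) (t : ℕ) :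
    m.expectedValue α P f v z s t ≤
      m.expectedCost v z s t + ENNReal.ofReal α * m.expectedValue α P g v z s (t + 1) := by
  rw [m.expectedCost_add_expectedValue v hα hP hric hz hg, m.expectedValue_eq v hα hP hz hf]
  refine lintegral_mono fun ω => ENNReal.ofReal_le_ofReal ?_
  have h1 := hfg (v.query t (z, signalsUpTo t ω)) (last (signalsUpTo t ω)).1 _
    (m.kalmanFilter_posSemidef v hz t (signalsUpTo t ω))
  have h2 := quadForm_nonneg (m.controlWeight_posDef hα.1.le hP).posSemidef
    (v.control t (z, signalsUpTo t ω) +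
      m.feedbackGain α P *ᵥ (m.kalmanFilter v z t (signalsUpTo t ω)).1)
  linarith

/-- The feedback annihilates the completed square and the query attains the Bellman minimum, so both
losses of the general inequality disappear. -/
theorem Model.expectedValue_eq_of_feedback (hα : α ∈ Set.Ioo (0 : ℝ) 1) (hP : P.PosSemidef)
    (hric : m.IsRiccatiSolution α P) (hz : z.2 ∈ psdCone d)
    (hf : ∀ s, ∀ V ∈ psdCone d, 0 ≤ f s V) {q : S × Matrix (Fin d) (Fin d) ℝ → Q}
    (hq : ∀ s, ∀ V ∈ psdCone d, m.bellmanTerm α P f (q (s, V)) s V = f s V)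
    (hv : m.IsStationaryFeedback (m.feedbackGain α P) q v) (s : S) (t : ℕ) :
    m.expectedValue α P f v z s t =
      m.expectedCost v z s t + ENNReal.ofReal α * m.expectedValue α P f v z s (t + 1) := by
  rw [m.expectedCost_add_expectedValue v hα hP hric hz hf, m.expectedValue_eq v hα hP hz hf]
  refine lintegral_congr fun ω => ?_
  obtain ⟨h1, h2⟩ := hv z hz t (signalsUpTo t ω)
  rw [h1, h2, neg_add_cancel, quadForm_zero_vec, add_zero,
    hq _ _ (m.kalmanFilter_posSemidef v hz t (signalsUpTo t ω))]

theorem Model.expectedValue_zero (hα : α ∈ Set.Ioo (0 : ℝ) 1) (hP : P.PosSemidef)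
    (hz : z.2 ∈ psdCone d) (hg : ∀ s, ∀ V ∈ psdCone d, 0 ≤ g s V) (s : S) :
    m.expectedValue α P g v z s 0 = ENNReal.ofReal (m.plantValue α P z.1 z.2 + g s z.2) := by
  have hF : Measurable fun y : State d dw S => ENNReal.ofReal (quadForm P z.1 + (P * z.2).trace +
      (m.noiseCost α P + g y.2.1 z.2)) := by
    have : Measurable fun s => g s z.2 := measurable_of_countable _
    exact (measurable_const.add (measurable_const.add
      (this.comp measurable_snd.fst))).ennreal_ofReal
  rw [m.expectedValue_eq v hα hP hz hg]
  refine (m.lintegral_law_zero v z s hF fun ω => rfl).trans ?_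
  unfold initialLaw
  rw [lintegral_prod_symm' _ hF, lintegral_dirac' _ hF.lintegral_prod_left']
  simp only [lintegral_const, measure_univ, mul_one]
  congr 1
  rw [← add_assoc]
  rfl

theorem Model.discountedCost_eq_tsum (hα : 0 ≤ α) (x : Fin d → ℝ) (s : S)
    (V : Matrix (Fin d) (Fin d) ℝ) :
    m.discountedCost α v x s V =
      ∑' t, ENNReal.ofReal α ^ t * m.expectedCost v (x, V) s t := by
  unfold Model.discountedCost
  rw [lintegral_tsum fun t => ((m.measurable_runningCost v (x, V) t).const_mul
    (α ^ t)).ennreal_ofReal.aemeasurable]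
  refine tsum_congr fun t => ?_
  rw [Model.expectedCost, ← lintegral_const_mul' _ _
    (ENNReal.pow_ne_top ENNReal.ofReal_ne_top)]
  refine lintegral_congr fun ω => ?_
  rw [ENNReal.ofReal_mul (pow_nonneg hα t), ENNReal.ofReal_pow hα]

/-- Since `P ≤ c R`, the terminal plant value is controlled by the running cost at the same time. A
finite total cost thus forces the discounted terminal value to zero. -/
theorem Model.expectedValue_const_le (α : ℝ) (P : Matrix (Fin d) (Fin d) ℝ) :
    ∃ c : ℝ, ∀ (v : Policy d du S Q) (z : Init d) (s : S) (t : ℕ),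
      m.expectedValue α P (fun _ _ => 0) v z s t ≤
        ENNReal.ofReal c * m.expectedCost v z s t + ENNReal.ofReal (m.noiseCost α P) := by
  obtain ⟨c, hc, hcR⟩ := exists_quadForm_le_quadForm P m.R_posDef
  refine ⟨c, fun v z s t => ?_⟩
  have h1 : ∀ ω, ENNReal.ofReal (quadForm P (ω t).1.1 + (m.noiseCost α P + 0)) ≤
      ENNReal.ofReal c * ENNReal.ofReal (m.runningCost v z t ω) +
        ENNReal.ofReal (m.noiseCost α P) := fun ω => by
    rw [add_zero, ← ENNReal.ofReal_mul hc]
    refine ENNReal.ofReal_add_le.trans (add_le_add_left (ENNReal.ofReal_le_ofReal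
      ((hcR _).trans (mul_le_mul_of_nonneg_left ?_ hc))) _)
    have h2 := m.netCost_nonneg (ω t).2.1 (v.queryAt z t fun i => ω i)
    have h3 := quadForm_nonneg m.M_posDef.posSemidef (v.controlAt z t fun i => ω i)
    change _ ≤ _ + (quadForm m.R _ + quadForm m.M _)
    linarith
  refine (lintegral_mono h1).trans (le_of_eq ?_)
  rw [lintegral_add_right _ measurable_const, lintegral_const_mul' _ _ ENNReal.ofReal_ne_top]
  simp [Model.expectedCost]

variable [Nonempty Q]

/-- Each use of the one-step inequality lowers the iterate by one, so after `n` steps the network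
part of the terminal value is the zero function. -/
theorem Model.expectedValue_dpIter_le (hα : α ∈ Set.Ioo (0 : ℝ) 1) (hP : P.PosSemidef)
    (hric : m.IsRiccatiSolution α P) (hz : z.2 ∈ psdCone d) (s : S) (n t : ℕ) :
    m.expectedValue α P (m.dpIter α P n) v z s t ≤
      ∑ k ∈ Finset.range n, ENNReal.ofReal α ^ k * m.expectedCost v z s (t + k) +
        ENNReal.ofReal α ^ n * m.expectedValue α P (fun _ _ => 0) v z s (t + n) := by
  have hW := m.errorWeight_posSemidef hα.1.le hP hric
  induction n generalizing t with
  | zero => simp [Model.dpIter]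
  | succ n ih =>
    have h := m.expectedValue_le v hα hP hric hz
      (fun s V hV => (m.isRegularOnCone_dpIter hα.1.le hW (n + 1) s).nonneg V hV)
      (fun s V hV => (m.isRegularOnCone_dpIter hα.1.le hW n s).nonneg V hV)
      (fun q s V _ => m.bellmanMin_le q s) s t
    refine h.trans ((add_le_add_right (mul_le_mul_right (ih (t + 1)) _) _).trans (le_of_eq ?_))
    have h1 : ∀ k, t + 1 + k = t + (k + 1) := fun k => by omega
    rw [Finset.sum_range_succ', mul_add, Finset.mul_sum, pow_zero, one_mul, ← add_assoc,
      h1 n, pow_succ' _ n, mul_assoc, add_comm (m.expectedCost v z s t)]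
    refine congrArg₂ _ (congrArg₂ _ (Finset.sum_congr rfl fun k _ => ?_) rfl) rfl
    rw [h1 k, pow_succ', mul_assoc]

/-- Every policy costs at least the plant value plus the iterates of the dynamic programming
operator. -/
theorem Model.le_discountedCost (hα : α ∈ Set.Ioo (0 : ℝ) 1) (hP : P.PosSemidef)
    (hric : m.IsRiccatiSolution α P) (x : Fin d → ℝ) (s : S) {V : Matrix (Fin d) (Fin d) ℝ}
    (hV : V ∈ psdCone d) (n : ℕ) :
    ENNReal.ofReal (m.plantValue α P x V + m.dpIter α P n s V) ≤ m.discountedCost α v x s V := by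
  have hW := m.errorWeight_posSemidef hα.1.le hP hric
  by_cases htop : m.discountedCost α v x s V = ∞
  · rw [htop]; exact le_top
  obtain ⟨c, hc⟩ := m.expectedValue_const_le α P
  set a := ENNReal.ofReal α with ha
  have ha1 : a < 1 := ENNReal.ofReal_lt_one.2 hα.2
  rw [m.discountedCost_eq_tsum v hα.1.le] at htop ⊢
  -- The terms of a convergent cost series tend to zero, and they dominate the terminal values up to
  -- a multiple of `a ^ n`.
  have h0 : Tendsto (fun n => a ^ n * m.expectedValue α P (fun _ _ => 0) v (x, V) s (0 + n))
      atTop (𝓝 0) := by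
    have h1 := ENNReal.Tendsto.const_mul (a := ENNReal.ofReal c)
      (ENNReal.tendsto_atTop_zero_of_tsum_ne_top htop) (Or.inr ENNReal.ofReal_ne_top)
    have h2 := ENNReal.Tendsto.mul_const (b := ENNReal.ofReal (m.noiseCost α P))
      (ENNReal.tendsto_pow_atTop_nhds_zero_of_lt_one ha1) (Or.inr ENNReal.ofReal_ne_top)
    have h3 := h1.add h2
    rw [mul_zero, zero_mul, add_zero] at h3
    refine tendsto_of_tendsto_of_tendsto_of_le_of_le tendsto_const_nhds h3
      (fun _ => zero_le) fun k => ?_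
    refine (mul_le_mul_right (hc v (x, V) s (0 + k)) (a ^ k)).trans (le_of_eq ?_)
    rw [mul_add, zero_add, mul_left_comm]
  have hmono : Monotone fun n => m.dpIter α P n s V :=
    monotone_nat_of_le_succ fun k => m.dpIter_le_succ hα.1.le hW k s V hV
  -- The horizon `k` goes to infinity with `n` fixed; monotonicity of value iteration lets iterate
  -- `k` stand in for iterate `n`.
  have h4 : ∀ k ≥ n, ENNReal.ofReal (m.plantValue α P x V + m.dpIter α P n s V) ≤
      (∑' t, a ^ t * m.expectedCost v (x, V) s t) +
        a ^ k * m.expectedValue α P (fun _ _ => 0) v (x, V) s (0 + k) := fun k hk => by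
    have h5 := m.expectedValue_dpIter_le v (z := (x, V)) hα hP hric hV s k 0
    rw [m.expectedValue_zero v hα hP hV fun s V hV =>
      (m.isRegularOnCone_dpIter hα.1.le hW k s).nonneg V hV] at h5
    refine (ENNReal.ofReal_le_ofReal (add_le_add_right (hmono hk) _)).trans (h5.trans ?_)
    refine add_le_add_left ?_ _
    simp only [zero_add]
    exact ENNReal.sum_le_tsum _
  have h6 := (tendsto_const_nhds (x := ∑' t, a ^ t * m.expectedCost v (x, V) s t)).add h0
  rw [add_zero] at h6
  exact ge_of_tendsto h6 (eventually_atTop.2 ⟨n, h4⟩)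

/-- The stationary feedback policy costs at most the plant value plus `f`. -/
theorem Model.discountedCost_le (hα : α ∈ Set.Ioo (0 : ℝ) 1) (hP : P.PosSemidef)
    (hric : m.IsRiccatiSolution α P) (hf : ∀ s, ∀ V ∈ psdCone d, 0 ≤ f s V)
    {q : S × Matrix (Fin d) (Fin d) ℝ → Q}
    (hq : ∀ s, ∀ V ∈ psdCone d, m.bellmanTerm α P f (q (s, V)) s V = f s V)
    (hv : m.IsStationaryFeedback (m.feedbackGain α P) q v) (x : Fin d → ℝ) (s : S)
    {V : Matrix (Fin d) (Fin d) ℝ} (hV : V ∈ psdCone d) :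
    m.discountedCost α v x s V ≤ ENNReal.ofReal (m.plantValue α P x V + f s V) := by
  -- Exact telescoping. For an upper bound the nonnegative remainder is simply dropped, so no
  -- transversality condition is needed.
  have hsum : ∀ n, ∑ k ∈ Finset.range n, ENNReal.ofReal α ^ k * m.expectedCost v (x, V) s k +
      ENNReal.ofReal α ^ n * m.expectedValue α P f v (x, V) s n =
        m.expectedValue α P f v (x, V) s 0 := by
    intro n
    induction n with
    | zero => simp
    | succ n ih =>
      rw [← ih, m.expectedValue_eq_of_feedback v (z := (x, V)) hα hP hric hV hf hq hv s n,
        Finset.sum_range_succ, mul_add, add_assoc, pow_succ, mul_assoc]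
  rw [m.discountedCost_eq_tsum v hα.1.le, ENNReal.tsum_eq_iSup_nat]
  refine iSup_le fun n => ?_
  have h0 := m.expectedValue_zero v (z := (x, V)) hα hP hV hf s
  simp only at h0
  rw [← h0, ← hsum n]
  exact le_self_add

end Verification

/-! ### Stationary policies and the value function -/

section Stationary

variable [Fintype S] (m : Model d du dw S Q)

/-- The Kalman filter under the stationary feedback given by `K` and `q`. -/
noncomputable def Model.stationaryFilter (m : Model d du dw S Q) (K : Matrix (Fin du) (Fin d) ℝ)
    (q : S × Matrix (Fin d) (Fin d) ℝ → Q) : (t : ℕ) → Init d × History S t → Init d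
  | 0, a => a.1
  | t + 1, a =>
    let y := m.stationaryFilter K q t (a.1, previous a.2)
    m.filterUpdate (q ((last (previous a.2)).1, y.2)) (last (previous a.2)).1 (-(K *ᵥ y.1)) y
      (last a.2)

variable [MeasurableSpace S] [MeasurableSingletonClass S] [MeasurableSpace Q]
  [MeasurableSingletonClass Q] [Fintype Q]

theorem Model.measurable_stationaryFilter (K : Matrix (Fin du) (Fin d) ℝ)
    {q : S × Matrix (Fin d) (Fin d) ℝ → Q} (hq : Measurable q) (t : ℕ) :
    Measurable (m.stationaryFilter K q t) := by
  induction t with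
  | zero => exact measurable_fst
  | succ t ih =>
    have hp : Measurable fun a : Init d × History S (t + 1) => (a.1, previous a.2) :=
      measurable_fst.prodMk (measurable_previous.comp measurable_snd)
    have hs : Measurable fun a : Init d × History S (t + 1) => (last (previous a.2)).1 :=
      (measurable_last.comp (measurable_previous.comp measurable_snd)).fst
    have hy := ih.comp hp
    exact m.measurable_filterUpdate (hq.comp (hs.prodMk hy.snd)) hs
      ((measurable_mulVec K).comp hy.fst).neg hy (measurable_last.comp measurable_snd)

/-- The filter is defined relative to a policy, whereas this policy refers to its own filter. The
circle is broken by `stationaryFilter`, a recursion of its own, which agrees with the filter of the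
resulting policy by induction. -/
theorem Model.exists_isStationaryFeedback (K : Matrix (Fin du) (Fin d) ℝ)
    {q : S × Matrix (Fin d) (Fin d) ℝ → Q} (hq : Measurable q) :
    ∃ v : Policy d du S Q, m.IsStationaryFeedback K q v := by
  let v : Policy d du S Q :=
    { query := fun t a => q ((last a.2).1, (m.stationaryFilter K q t a).2)
      control := fun t a => -(K *ᵥ (m.stationaryFilter K q t a).1)
      measurable_query := fun t => hq.comp ((measurable_last.comp measurable_snd).fst.prodMk
        (m.measurable_stationaryFilter K hq t).snd)
      measurable_control := fun t =>
        ((measurable_mulVec K).comp (m.measurable_stationaryFilter K hq t).fst).neg }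
  have hv : ∀ z t (h : History S t), m.kalmanFilter v z t h = m.stationaryFilter K q t (z, h) := by
    intro z t
    induction t with
    | zero => exact fun _ => rfl
    | succ t ih =>
      intro h
      rw [m.kalmanFilter_succ, ih]
      rfl
  exact ⟨v, fun z _ t h => by rw [hv]; exact ⟨rfl, rfl⟩⟩

end Stationary

/-! ### Identification and growth of the value function -/

section Value

variable [Fintype S] [MeasurableSpace S] [MeasurableSingletonClass S]
  [Fintype Q] [Nonempty Q] [MeasurableSpace Q] [MeasurableSingletonClass Q]
  (m : Model d du dw S Q) {α : ℝ} {P V : Matrix (Fin d) (Fin d) ℝ}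

theorem Model.le_discountedValue (hα : α ∈ Set.Ioo (0 : ℝ) 1) (hP : P.PosSemidef)
    (hric : m.IsRiccatiSolution α P) (x : Fin d → ℝ) (s : S) (hV : V ∈ psdCone d) (n : ℕ) :
    ENNReal.ofReal (m.plantValue α P x V + m.dpIter α P n s V) ≤ m.discountedValue α x s V :=
  le_iInf fun v => m.le_discountedCost v hα hP hric x s hV n

theorem Model.plantValue_nonneg (hα : α ∈ Set.Ioo (0 : ℝ) 1) (hP : P.PosSemidef)
    (x : Fin d → ℝ) (hV : V ∈ psdCone d) : 0 ≤ m.plantValue α P x V :=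
  add_nonneg (add_nonneg (quadForm_nonneg hP x) (trace_mul_nonneg hP hV))
    (m.noiseCost_nonneg hα hP)

theorem Model.discountedValue_lt_top (hJ : m.ValueLocallyBounded α) (x : Fin d → ℝ) (s : S)
    (hV : V ∈ psdCone d) : m.discountedValue α x s V < ∞ := by
  obtain ⟨c, hc, h⟩ := hJ x s V hV
  exact lt_of_le_of_lt (h.curry.self_of_nhds.self_of_nhdsWithin hV) hc

/-- Every policy dominates the iterates, so a finite optimal cost bounds them; mean zero serves as
the test point. -/
theorem Model.bddAbove_dpIter (hα : α ∈ Set.Ioo (0 : ℝ) 1) (hP : P.PosSemidef)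
    (hric : m.IsRiccatiSolution α P) (hJ : m.ValueLocallyBounded α) (s : S)
    (hV : V ∈ psdCone d) : BddAbove (Set.range fun n => m.dpIter α P n s V) := by
  refine ⟨(m.discountedValue α 0 s V).toReal, ?_⟩
  rintro _ ⟨n, rfl⟩
  have h := (ENNReal.ofReal_le_iff_le_toReal (m.discountedValue_lt_top hJ 0 s hV).ne).1
    (m.le_discountedValue hα hP hric 0 s hV n)
  exact (le_add_of_nonneg_left (m.plantValue_nonneg hα hP 0 hV)).trans h

theorem Model.le_discountedValue_dpValue (hα : α ∈ Set.Ioo (0 : ℝ) 1) (hP : P.PosSemidef)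
    (hric : m.IsRiccatiSolution α P) (hJ : m.ValueLocallyBounded α) (x : Fin d → ℝ) (s : S)
    (hV : V ∈ psdCone d) :
    ENNReal.ofReal (m.plantValue α P x V + m.dpValue α P s V) ≤ m.discountedValue α x s V :=
  le_of_tendsto (ENNReal.tendsto_ofReal ((m.tendsto_dpIter hα.1.le
    (m.errorWeight_posSemidef hα.1.le hP hric)
    (fun _ _ => m.bddAbove_dpIter hα hP hric hJ _) s hV).const_add _))
    (Eventually.of_forall fun n => m.le_discountedValue hα hP hric x s hV n)

theorem Model.bellmanTerm_minSelector (hα : α ∈ Set.Ioo (0 : ℝ) 1) (hP : P.PosSemidef)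
    (hric : m.IsRiccatiSolution α P) (hJ : m.ValueLocallyBounded α)
    {q : S × Matrix (Fin d) (Fin d) ℝ → Q} (hq : m.IsMinSelector α P (m.dpValue α P) q)
    (s : S) (hV : V ∈ psdCone d) :
    m.bellmanTerm α P (m.dpValue α P) (q (s, V)) s V = m.dpValue α P s V := by
  have h := m.dpValue_isLeast hα.1.le (m.errorWeight_posSemidef hα.1.le hP hric)
    (fun _ _ => m.bddAbove_dpIter hα hP hric hJ _) s hV
  obtain ⟨q', hq'⟩ := h.1
  exact le_antisymm (hq' ▸ hq.2 s V hV q') (h.2 ⟨_, rfl⟩)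

/-- The upper bound for this policy meets the lower bound for all policies, giving optimality and
the value formula at once. -/
theorem Model.discountedCost_eq_of_minSelector (hα : α ∈ Set.Ioo (0 : ℝ) 1) (hP : P.PosSemidef)
    (hric : m.IsRiccatiSolution α P) (hJ : m.ValueLocallyBounded α)
    {q : S × Matrix (Fin d) (Fin d) ℝ → Q} (hq : m.IsMinSelector α P (m.dpValue α P) q)
    {v : Policy d du S Q} (hv : m.IsStationaryFeedback (m.feedbackGain α P) q v)
    (x : Fin d → ℝ) (s : S) (hV : V ∈ psdCone d) :
    m.discountedCost α v x s V = m.discountedValue α x s V ∧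
      m.discountedValue α x s V =
        ENNReal.ofReal (m.plantValue α P x V + m.dpValue α P s V) := by
  have h1 := m.discountedCost_le v hα hP hric
    (fun s _ hV => m.dpValue_nonneg (fun _ _ => m.bddAbove_dpIter hα hP hric hJ _) s hV)
    (fun s _ => m.bellmanTerm_minSelector hα hP hric hJ hq s) hv x s hV
  have h2 := m.le_discountedValue_dpValue hα hP hric hJ x s hV
  have h3 : m.discountedValue α x s V ≤ m.discountedCost α v x s V := iInf_le _ v
  exact ⟨le_antisymm (h1.trans h2) h3, le_antisymm (h3.trans h1) h2⟩

theorem Model.discountedValue_eq (hα : α ∈ Set.Ioo (0 : ℝ) 1) (hP : P.PosSemidef)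
    (hric : m.IsRiccatiSolution α P) (hJ : m.ValueLocallyBounded α) (x : Fin d → ℝ) (s : S)
    (hV : V ∈ psdCone d) : m.discountedValue α x s V =
      ENNReal.ofReal (m.plantValue α P x V + m.dpValue α P s V) := by
  obtain ⟨q, hq⟩ := m.exists_measurable_minSelector (α := α) (P := P)
    (f := m.dpValue α P) m.measurable_dpValue
  obtain ⟨v, hv⟩ := m.exists_isStationaryFeedback (m.feedbackGain α P) hq.1
  exact (m.discountedCost_eq_of_minSelector hα hP hric hJ hq hv x s hV).2

theorem Model.exists_dpValue_le (hα : α ∈ Set.Ioo (0 : ℝ) 1) (hP : P.PosSemidef)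
    (hric : m.IsRiccatiSolution α P) (hJ : m.ValueLocallyBounded α) :
    ∃ κ : ℝ, 0 ≤ κ ∧ ∀ s, ∀ V ∈ psdCone d, m.dpValue α P s V ≤ κ * (1 + V.trace) := by
  have hbdd : ∀ s, ∀ V ∈ psdCone d, BddAbove (Set.range fun n => m.dpIter α P n s V) :=
    fun _ _ => m.bddAbove_dpIter hα hP hric hJ _
  choose κ hκ0 hκ using fun s => exists_linear_growth
    (fun V hV => m.dpValue_nonneg hbdd s hV)
    (m.dpValue_concave hα.1.le (m.errorWeight_posSemidef hα.1.le hP hric) hbdd s) fun V hV => by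
      obtain ⟨c, hc, h⟩ := hJ 0 s V hV
      refine ⟨c.toReal, ?_⟩
      filter_upwards [h.curry.self_of_nhds, self_mem_nhdsWithin] with V' h' hV'
      have h1 := (ENNReal.ofReal_le_iff_le_toReal hc.ne).1
        ((m.le_discountedValue_dpValue hα hP hric hJ 0 s hV').trans h')
      exact (le_add_of_nonneg_left (m.plantValue_nonneg hα hP 0 hV')).trans h1
  -- The sum over the finite set of network states is a constant that works for all of them.
  refine ⟨∑ s, κ s, Finset.sum_nonneg fun s _ => hκ0 s, fun s V hV => (hκ s V hV).trans
    (mul_le_mul_of_nonneg_right (Finset.single_le_sum (fun s _ => hκ0 s) (Finset.mem_univ s)) ?_)⟩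
  exact add_nonneg zero_le_one (Matrix.PosSemidef.trace_nonneg hV)

theorem Model.isDPSolution_dpValue (hα : α ∈ Set.Ioo (0 : ℝ) 1) (hP : P.PosSemidef)
    (hric : m.IsRiccatiSolution α P) (hJ : m.ValueLocallyBounded α) :
    m.IsDPSolution α P (m.dpValue α P) := by
  have hbdd : ∀ s, ∀ V ∈ psdCone d, BddAbove (Set.range fun n => m.dpIter α P n s V) :=
    fun _ _ => m.bddAbove_dpIter hα hP hric hJ _
  have hW := m.errorWeight_posSemidef hα.1.le hP hric
  obtain ⟨κ, -, hκ⟩ := m.exists_dpValue_le hα hP hric hJ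
  exact ⟨fun s V hV => m.dpValue_nonneg hbdd s hV, m.dpValue_lsc hα.1.le hW hbdd,
    fun s V hV => m.dpValue_isLeast hα.1.le hW hbdd s hV, κ, hκ⟩

theorem exists_growth_trace_mul {f : S → Matrix (Fin d) (Fin d) ℝ → ℝ} {κ : ℝ} (hκ0 : 0 ≤ κ)
    (hκ : ∀ s, ∀ V ∈ psdCone d, f s V ≤ κ * (1 + V.trace)) {G : Matrix (Fin d) (Fin d) ℝ}
    (hG : G.PosDef) : ∃ κ' : ℝ, ∀ s, ∀ V ∈ psdCone d, f s V ≤ κ' * (1 + (G * V).trace) := by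
  obtain ⟨c, hc, hcG⟩ := exists_trace_le hG
  refine ⟨κ * (1 + c⁻¹), fun s V hV => (hκ s V hV).trans ?_⟩
  rw [mul_assoc]
  refine mul_le_mul_of_nonneg_left ?_ hκ0
  have h1 : V.trace ≤ c⁻¹ * (G * V).trace := by
    rw [inv_mul_eq_div, le_div_iff₀ hc, mul_comm]
    exact hcG V hV
  have h2 := inv_pos.2 hc
  have h3 := trace_mul_nonneg hG.posSemidef hV
  nlinarith

end Value

end SensorLQG

/-! ### The main theorem -/

open SensorLQG
theorem mainTheorem1 {d du dw : ℕ} {S Q : Type*} [Fintype S] [Nonempty S] [MeasurableSpace S]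
    [MeasurableSingletonClass S] [Fintype Q] [Nonempty Q] [MeasurableSpace Q]
    [MeasurableSingletonClass Q] (m : Model d du dw S Q)
    (hAB : IsStabilizable m.A m.B) (α : ℝ) (hα : α ∈ Set.Ioo (0 : ℝ) 1)
    (hJ : m.ValueLocallyBounded α) :
    ∃ P : Matrix (Fin d) (Fin d) ℝ,
      (P.PosDef ∧ m.IsRiccatiSolution α P ∧
        ∀ P' : Matrix (Fin d) (Fin d) ℝ, P'.PosDef → m.IsRiccatiSolution α P' → P' = P) ∧
      ∃ f : S → Matrix (Fin d) (Fin d) ℝ → ℝ,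
        (∀ x s, ∀ V ∈ psdCone d,
          m.discountedValue α x s V = ENNReal.ofReal (m.plantValue α P x V + f s V)) ∧
        m.IsDPSolution α P f ∧
        (∀ g, m.IsDPSolution α P g → ∀ s, ∀ V ∈ psdCone d, g s V = f s V) ∧
        ((m.errorWeight α P).PosDef → ∃ κ : ℝ, ∀ s, ∀ V ∈ psdCone d,
          f s V ≤ κ * (1 + (m.errorWeight α P * V).trace)) ∧
        (∀ s, ConcaveOn ℝ (psdCone d) (f s)) ∧
        (∃ q, m.IsMinSelector α P f q) ∧
        ∀ q, m.IsMinSelector α P f q →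
          (∃ v : Policy d du S Q, m.IsStationaryFeedback (m.feedbackGain α P) q v) ∧
          ∀ v : Policy d du S Q, m.IsStationaryFeedback (m.feedbackGain α P) q v →
            ∀ x s, ∀ V ∈ psdCone d,
              m.discountedCost α v x s V = m.discountedValue α x s V := by
  obtain ⟨P, hP, hric⟩ := m.exists_riccati_solution hAB hα
  have hP' := hP.posSemidef
  have hsol := m.isDPSolution_dpValue hα hP' hric hJ
  refine ⟨P, ⟨hP, hric, fun P' hP' h' => m.riccati_solution_ext hα hP hric hP' h'⟩,
    m.dpValue α P, fun x s V hV => m.discountedValue_eq hα hP' hric hJ x s hV, hsol,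
    fun g hg s V hV => le_antisymm (m.le_of_isDPSolution hα hP hsol hg s hV)
      (m.le_of_isDPSolution hα hP hg hsol s hV), fun hW => ?_,
    m.dpValue_concave hα.1.le (m.errorWeight_posSemidef hα.1.le hP' hric)
      fun s V hV => m.bddAbove_dpIter hα hP' hric hJ s hV,
    m.exists_measurable_minSelector m.measurable_dpValue, fun q hq =>
      ⟨m.exists_isStationaryFeedback _ hq.1, fun v hv x s V hV =>
        (m.discountedCost_eq_of_minSelector hα hP' hric hJ hq hv x s hV).1⟩⟩
  obtain ⟨κ, hκ0, hκ⟩ := m.exists_dpValue_le hα hP' hric hJ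
  exact exists_growth_trace_mul hκ0 hκ hW
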